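/- Let $d\ge 3$, $\lambda>0$, $\epsilon\in\mathbb R$, $\delta>0$. Let $p\in C^\infty(\mathbb R^d;\mathbb R)$ and let $Q:\mathbb R^d\to\mathbb R$ be measurable, with $|\partial^\beta p(x)|\le C_\beta|x|^{-(2+|\beta|+\delta)}$ (all multi-indices $\beta$) and $|Q(x)|\le C|x|^{-(3+\delta)}$ for $|x|\ge 1$, and, for $0<|x|\le 1$, $|Q(x)|\le C|x|^{-(2-\delta)}$ if $d=3$ and $|Q(x)|\le C|x|^{-2}$ if $d>3$. Assume $1+p/\lambda>0$ on $\mathbb R^d$ (which holds for all large $\lambda$). Let $K$ be a solution of the eikonal equation $|\nabla K|^2=1+\frac p\lambda$ on $\mathbb R^d\setminus\{0\}$ of the form $K(x)=g(x)|x|$, that is: $K(0)=0$, $K>0$ and $K\in C^\infty$ on $\mathbb R^d\setminus\{0\}$, and $|x|^k|D^kg(x)|$ is bounded on $\mathbb R^d\setminus\{0\}$ for $k=0,1,2,3$. Put $$F_{ij}=-\delta_{ij}\big(|x|^2|\nabla g|^2+2g\,x\cdot\nabla g\big)+|x|^2\partial_ig\,\partial_jg+2x_ig\,\partial_jg+2x_jg\,\partial_ig+g|x|^2\partial^2_{ij}g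 ,$$ and, for a function $u$, $$\nabla_K^ru=\frac{\nabla K}{|\nabla K|}\cdot\nabla u,\qquad \nabla_K^\perp u=\nabla u-\frac{\nabla K}{|\nabla K|}\nabla_K^ru .$$ Let $\psi=h(K)$ be a regular $K$-radial function: $h$ is differentiable on $(0,\infty)$, $h'$ is Lipschitz on $(0,T]$ for every $T>0$, and $h'(t)\to0$ as $t\to0^+$. Write $\psi'=h'(K)$ and $\psi''=h''(K)$ (defined almost everywhere). Let $f\in L^2_{loc}(\mathbb R^d;\mathbb C)$ and let $u\in H^1_{loc}(\mathbb R^d;\mathbb C)$ be a distributional solution of $$\Delta u+pu+Qu+\lambda u+i\epsilon u=f .$$ Assume that at least one of the following holds, so that the integrals below converge: (a) $(|\psi'|+|\psi''|)(|u|^2+|\nabla u|^2)+|\psi'||f|^2$ is integrable on $\mathbb R^d$; or (b) $\epsilon>0$, $u\in H^1(\mathbb R^d)$, and for some integer $m\ge0$ and some $C$ one has $|h''(t)|\le C(1+t)^m$ wherever $h''(t)$ exists, $t>0$, and $\int(1+|x|)^{m+1}|f|^2<\infty$. Then all integrals below converge absolutely and \begin{align*} &\frac{1}{2}\int |\nabla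 K|^2 \psi''\left|\nabla_K^r u-i\lambda^{1/2}|\nabla K| u\right|^2 +\int \left(\frac{\psi'}{K}-\frac{\psi''}{2}\right)|\nabla K|^2|\nabla_K^{\perp} u|^2\\ &+ \frac{d-1}{2}\Re\int \nabla \left( \frac{\psi'}{K}|\nabla K|^2\right) \cdot\nabla u\, \overline{u} -\frac{d-1}{2}\int \frac{\psi'}{K}|\nabla K|^2 Q |u|^2 -\Re \int Q\,\nabla \psi \cdot \nabla \overline{u}\, u\\ &-\lambda^{1/2}\,\Im \int\psi'\,\nabla (|\nabla K|^2)\cdot \nabla u\, \overline{u}+ \frac{1}{2}\int \nabla \psi \cdot \nabla p\,|u|^2\\ &+\Re\int\frac{\psi'}{K}\left(\nabla u \cdot F \cdot \nabla_K^{\perp}\overline{u}+ \nabla u \cdot F \cdot \frac{\nabla K}{|\nabla K|}\nabla_K^r\overline{u}\right)\\ &+ \frac{1}{2}\Re\int \nabla \left( \frac{\psi'}{K}\sum_i F_{ii}\right) \cdot\nabla u\, \overline{u} -\frac{1}{2}\int \frac{\psi'}{K}\Big(\sum_i F_{ii}\Big) Q |u|^2\\ &+\frac{\epsilon}{2\lambda^{1/2}}\int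 \psi' \left| \nabla u-i\lambda^{1/2} \nabla K\, u\right|^2 -\frac{\epsilon}{2\lambda^{1/2}}\int \psi' Q |u|^2 +\frac{\epsilon}{2\lambda^{1/2}} \Re \int \nabla (\psi') \cdot \nabla u\, \overline{u}\\ =&-\Re \int f\, \nabla \psi \cdot \nabla \overline{u}-\frac{1}{2} \Re \int f\, \psi'\left(\frac{d-1}{K}|\nabla K|^2 +\frac{1}{K}\sum_i F_{ii}\right)\overline{u}\\ &+\lambda^{1/2}\,\Im \int |\nabla K|^2 \psi' f\, \overline{u}-\frac{\epsilon}{2\lambda^{1/2}}\Re\int \psi' f\, \overline{u}. \end{align*} -/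

import Mathlib

open MeasureTheory Set Filter Topology
open scoped ContDiff Gradient ComplexConjugate

noncomputable section

/-- `p` is smooth, `|∂^β p| ≤ C_β |x|^{-(2+|β|+δ)}` for `|x| ≥ 1`; `Q` is measurable with
`|Q| ≤ C |x|^{-(3+δ)}` for `|x| ≥ 1`, and for `|x| ≤ 1`
`|Q| ≤ C |x|^{-(2-δ)}` if `d = 3`, `|Q| ≤ C |x|^{-2}` if `d > 3`. -/
structure IsAdmissiblePotential (d : ℕ) (p Q : EuclideanSpace ℝ (Fin d) → ℝ) (δ : ℝ) : Prop where
  smooth : ContDiff ℝ ∞ p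
  decay : ∀ k : ℕ, ∃ C : ℝ, ∀ x, 1 ≤ ‖x‖ →
    ‖iteratedFDeriv ℝ k p x‖ ≤ C * ‖x‖ ^ (-(2 + (k : ℝ) + δ))
  measurable : AEMeasurable Q volume
  near_three : d = 3 → ∃ C : ℝ, ∀ x, x ≠ 0 → ‖x‖ ≤ 1 → |Q x| ≤ C * ‖x‖ ^ (-(2 - δ))
  near : 3 < d → ∃ C : ℝ, ∀ x, x ≠ 0 → ‖x‖ ≤ 1 → |Q x| ≤ C * ‖x‖ ^ (-2 : ℝ)
  far : ∃ C : ℝ, ∀ x, 1 ≤ ‖x‖ → |Q x| ≤ C * ‖x‖ ^ (-(3 + δ))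

/-- The factor `g` in `K(x) = g(x) |x|`. -/
def eikonalRatio {d : ℕ} (K : EuclideanSpace ℝ (Fin d) → ℝ) (x : EuclideanSpace ℝ (Fin d)) : ℝ :=
  K x / ‖x‖

/-- `K = g |x|` is a solution of `|∇K|² = 1 + p/λ` of point source type: positive and smooth away
from the origin, where it vanishes, with `|x|^k |D^k g|` bounded for `k ≤ 3`. -/
structure IsEikonalSolution {d : ℕ} (p : EuclideanSpace ℝ (Fin d) → ℝ) (lam : ℝ)
    (K : EuclideanSpace ℝ (Fin d) → ℝ) : Prop where
  zero : K 0 = 0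
  pos : ∀ x, x ≠ 0 → 0 < K x
  smooth : ContDiffOn ℝ ∞ K {0}ᶜ
  eikonal : ∀ x, x ≠ 0 → ‖∇ K x‖ ^ 2 = 1 + p x / lam
  bounds : ∀ k : ℕ, k ≤ 3 → ∃ C : ℝ, ∀ x, x ≠ 0 →
    ‖x‖ ^ k * ‖iteratedFDeriv ℝ k (eikonalRatio K) x‖ ≤ C

/-- `ψ = h ∘ K` is a regular (that is, `C^{1,1}_loc`) `K`-radial function: `h'` is locally Lipschitz
up to `0` and tends to `0` there. -/
structure IsRegularProfile (h : ℝ → ℝ) : Prop where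
  differentiable : DifferentiableOn ℝ h (Ioi 0)
  lipschitz : ∀ T : ℝ, ∃ L : NNReal, LipschitzOnWith L (deriv h) (Ioc 0 T)
  zero : Tendsto (deriv h) (𝓝[>] 0) (𝓝 0)

/-- `u ∈ H^1_loc(ℝ^d)` with weak gradient `G`. -/
structure IsH1LocWithGradient {d : ℕ} (u : EuclideanSpace ℝ (Fin d) → ℂ)
    (G : EuclideanSpace ℝ (Fin d) → EuclideanSpace ℂ (Fin d)) : Prop where
  meas : AEStronglyMeasurable u volume
  meas_grad : AEStronglyMeasurable G volume
  sq : LocallyIntegrable (fun x => ‖u x‖ ^ 2) volume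
  sq_grad : LocallyIntegrable (fun x => ‖G x‖ ^ 2) volume
  weak : ∀ φ : EuclideanSpace ℝ (Fin d) → ℝ, ContDiff ℝ ∞ φ → HasCompactSupport φ →
    ∀ i, ∫ x, u x * ((∇ φ x i : ℝ) : ℂ) = -∫ x, G x i * (φ x : ℂ)

/-- The bilinear product `a · z` of a real and a complex vector. -/
def rdot {d : ℕ} (a : EuclideanSpace ℝ (Fin d)) (z : EuclideanSpace ℂ (Fin d)) : ℂ :=
  ∑ i, (a i : ℂ) * z i

/-- A real vector seen as a complex one. -/
def toComplexVec {d : ℕ} (a : EuclideanSpace ℝ (Fin d)) : EuclideanSpace ℂ (Fin d) :=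
  WithLp.toLp 2 fun i => (a i : ℂ)

/-- `u` (with weak gradient `G`) solves `Δu + pu + Qu + λu + iεu = f` in the sense of
distributions. -/
def IsHelmholtzSolution {d : ℕ} (p Q : EuclideanSpace ℝ (Fin d) → ℝ) (lam ε : ℝ)
    (f u : EuclideanSpace ℝ (Fin d) → ℂ)
    (G : EuclideanSpace ℝ (Fin d) → EuclideanSpace ℂ (Fin d)) : Prop :=
  ∀ φ : EuclideanSpace ℝ (Fin d) → ℝ, ContDiff ℝ ∞ φ → HasCompactSupport φ →
    -(∫ x, rdot (∇ φ x) (G x))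
      + ∫ x, ((p x : ℂ) + (Q x : ℂ) + (lam : ℂ) + Complex.I * (ε : ℂ)) * u x * (φ x : ℂ)
    = ∫ x, f x * (φ x : ℂ)

/-- `∇_K^r u = (∇K/|∇K|) · ∇u`, for `G = ∇u`. -/
def radialDeriv {d : ℕ} (K : EuclideanSpace ℝ (Fin d) → ℝ)
    (G : EuclideanSpace ℝ (Fin d) → EuclideanSpace ℂ (Fin d)) (x : EuclideanSpace ℝ (Fin d)) : ℂ :=
  rdot (‖∇ K x‖⁻¹ • ∇ K x) (G x)

/-- `∇_K^⊥ u = ∇u - (∇K/|∇K|) ∇_K^r u`, for `G = ∇u`. -/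
def angularGrad {d : ℕ} (K : EuclideanSpace ℝ (Fin d) → ℝ)
    (G : EuclideanSpace ℝ (Fin d) → EuclideanSpace ℂ (Fin d)) (x : EuclideanSpace ℝ (Fin d)) :
    EuclideanSpace ℂ (Fin d) :=
  G x - radialDeriv K G x • toComplexVec (‖∇ K x‖⁻¹ • ∇ K x)

/-- `F_ij = -δ_ij (|x|²|∇g|² + 2 g x·∇g) + |x|² ∂_i g ∂_j g + 2 x_i g ∂_j g + 2 x_j g ∂_i g
+ g |x|² ∂²_ij g`, where `K = g |x|`. -/
def eikonalF {d : ℕ} (K : EuclideanSpace ℝ (Fin d) → ℝ) (i j : Fin d)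
    (x : EuclideanSpace ℝ (Fin d)) : ℝ :=
  let g := eikonalRatio K;
  -(if i = j then ‖x‖ ^ 2 * ‖∇ g x‖ ^ 2 + 2 * g x * inner ℝ x (∇ g x) else 0)
    + ‖x‖ ^ 2 * ∇ g x i * ∇ g x j + 2 * x i * g x * ∇ g x j + 2 * x j * g x * ∇ g x i
    + g x * ‖x‖ ^ 2 * ∇ (fun y => ∇ g y j) x i

/-- `∑ F_ii`. -/
def eikonalTraceF {d : ℕ} (K : EuclideanSpace ℝ (Fin d) → ℝ) (x : EuclideanSpace ℝ (Fin d)) : ℝ :=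
  ∑ i, eikonalF K i i x

section Integrands

/-! The integrands of the identity; `h` is the profile of `ψ = h(K)`, `G = ∇u`,
`ψ' = h'(K)` and `ψ'' = h''(K)`. -/

variable {d : ℕ} (lam : ℝ) (K : EuclideanSpace ℝ (Fin d) → ℝ) (h : ℝ → ℝ)
  (p Q : EuclideanSpace ℝ (Fin d) → ℝ) (f u : EuclideanSpace ℝ (Fin d) → ℂ)
  (G : EuclideanSpace ℝ (Fin d) → EuclideanSpace ℂ (Fin d)) (x : EuclideanSpace ℝ (Fin d))

/-- `|∇K|² ψ'' |∇_K^r u - iλ^{1/2}|∇K|u|²` -/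
def radialTerm : ℝ :=
  ‖∇ K x‖ ^ 2 * deriv (deriv h) (K x) *
    ‖radialDeriv K G x - Complex.I * (√lam : ℂ) * (‖∇ K x‖ : ℂ) * u x‖ ^ 2

/-- `(ψ'/K - ψ''/2) |∇K|² |∇_K^⊥ u|²` -/
def angularTerm : ℝ :=
  (deriv h (K x) / K x - deriv (deriv h) (K x) / 2) * ‖∇ K x‖ ^ 2 * ‖angularGrad K G x‖ ^ 2

/-- `∇(ψ'/K |∇K|²) · ∇u ū` -/
def gradWeightTerm : ℂ :=
  rdot (∇ (fun y => deriv h (K y) / K y * ‖∇ K y‖ ^ 2) x) (G x) * conj (u x)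

/-- `(ψ'/K) |∇K|² Q |u|²` -/
def weightQTerm : ℝ :=
  deriv h (K x) / K x * ‖∇ K x‖ ^ 2 * Q x * ‖u x‖ ^ 2

/-- `Q ∇ψ · ∇ū u` -/
def gradPsiQTerm : ℂ :=
  (Q x : ℂ) * conj (rdot (∇ (fun y => h (K y)) x) (G x)) * u x

/-- `∇(|∇K|²) ψ' · ∇u ū` -/
def gradSpeedTerm : ℂ :=
  rdot (∇ (fun y => ‖∇ K y‖ ^ 2) x) (G x) * ((deriv h (K x) : ℝ) : ℂ) * conj (u x)

/-- `∇ψ · ∇p |u|²` -/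
def gradPTerm : ℝ :=
  inner ℝ (∇ (fun y => h (K y)) x) (∇ p x) * ‖u x‖ ^ 2

/-- `(ψ'/K) (∇u · F · ∇_K^⊥ ū + ∇u · F · (∇K/|∇K|) ∇_K^r ū)` -/
def matrixFTerm : ℂ :=
  ((deriv h (K x) / K x : ℝ) : ℂ) *
    ((∑ i, ∑ j, G x i * (eikonalF K i j x : ℂ) * conj (angularGrad K G x j))
      + ∑ i, ∑ j, G x i * (eikonalF K i j x : ℂ) *
          ((‖∇ K x‖⁻¹ * ∇ K x j : ℝ) : ℂ) * conj (radialDeriv K G x))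

/-- `∇((ψ'/K) ∑ F_ii) · ∇u ū` -/
def gradTraceFTerm : ℂ :=
  rdot (∇ (fun y => deriv h (K y) / K y * eikonalTraceF K y) x) (G x) * conj (u x)

/-- `(ψ'/K) (∑ F_ii) Q |u|²` -/
def traceFQTerm : ℝ :=
  deriv h (K x) / K x * eikonalTraceF K x * Q x * ‖u x‖ ^ 2

/-- `ψ' |∇u - iλ^{1/2} ∇K u|²` -/
def sommerfeldTerm : ℝ :=
  deriv h (K x) * ‖G x - (Complex.I * (√lam : ℂ) * u x) • toComplexVec (∇ K x)‖ ^ 2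

/-- `ψ' Q |u|²` -/
def psiQTerm : ℝ :=
  deriv h (K x) * Q x * ‖u x‖ ^ 2

/-- `∇(ψ') · ∇u ū` -/
def gradPsiPrimeTerm : ℂ :=
  rdot (∇ (fun y => deriv h (K y)) x) (G x) * conj (u x)

/-- `f ∇ψ · ∇ū` -/
def sourceGradTerm : ℂ :=
  f x * conj (rdot (∇ (fun y => h (K y)) x) (G x))

/-- `f [ψ' ((d-1)/K |∇K|² + (1/K) ∑ F_ii)] ū` -/
def sourceWeightTerm : ℂ :=
  f x * ((deriv h (K x) *
    (((d : ℝ) - 1) / K x * ‖∇ K x‖ ^ 2 + 1 / K x * eikonalTraceF K x) : ℝ) : ℂ) * conj (u x)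

/-- `|∇K|² ψ' f ū` -/
def sourceSpeedTerm : ℂ :=
  ((‖∇ K x‖ ^ 2 * deriv h (K x) : ℝ) : ℂ) * f x * conj (u x)

/-- `ψ' f ū` -/
def sourcePsiTerm : ℂ :=
  ((deriv h (K x) : ℝ) : ℂ) * f x * conj (u x)

end Integrands

end

/-! The identity is of Morawetz type. Write `ψ' = h'(K)` and `Δu = f - (p + Q + λ + iε) u`. Up to
sign, the equation is multiplied by `∇ψ · ∇ū + ρ ū`, keeping real parts, and by `√λ ψ' |∇K|² ū`,
keeping imaginary parts, where `ρ = ½ ψ' ΔK + ε/(2√λ) ψ'` is `zerothWeight`.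

Two facts about `K` turn the result into the stated form. Differentiating `K² = g²|x|²` twice gives
`K D²K = F + |∇K|² I - ∇K ⊗ ∇K` (`IsEikonalSolution.hessian_formula`), so `F` is the deviation from
the flat case `K = |x|`. The eikonal equation gives `p + λ = λ|∇K|²`. Then the `ψ''` terms complete
the square `|∇_K^r u - i√λ|∇K|u|²` and leave a multiple of `|∇_K^⊥ u|²`, the `ψ'/K` terms give the
angular gradient and the form `F`, and the `ε` terms complete `|∇u - i√λ ∇K u|²`. With a cutoff `θ`
in all multipliers this is an identity at almost every point, up to an error linear in `∇θ`:
`multiplier_pointwise`, resting on `multiplier_algebra`.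

The integrations by parts are delicate because `u` is only in `H¹_loc`, `ψ'` is only Lipschitz, and
`K`, `Q` are singular at the origin. With `θ` supported in an annulus the multipliers are Lipschitz
with compact support and `Δu` is square integrable on that support. For mollified functions the
divergence theorem for Lipschitz fields applies. Every integrand is a bounded bilinear form in
square integrable quantities, so the mollification can be removed:
`HasWeakGradient.stress_identity`, `HasWeakGradient.greens_identity`,
`HasWeakGradient.flux_identity`.

The cutoffs satisfy `|∇θ| ≤ M/|x|` uniformly. Near the origin this factor is compensated by `|ψ'| ≤
L K`, with `K` comparable to `|x|`, or by Hardy's inequality, which makes `|u|²/|x|²` integrable for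
`d ≥ 3` and also controls `Q|u|²`. One integrable function, `dominant`, bounds all terms and the
cutoff error, and dominated convergence gives `integral_combinedIntegrand`.

Hypothesis (b) is reduced to (a): for `ε > 0` the imaginary part of the equation controls
`|x|^(k+1)|u|²` by weights of degree `k`, and the real part then controls `|x|^(k+1)|∇u|²`
(`IsHelmholtzSolution.integrable_norm_pow_succ`). Iteration reaches the growth of `ψ'`. -/

/-! ### The divergence theorem for Lipschitz vector fields. -/

section LipschitzDivergence

/-- A locally Lipschitz function with compact support is Lipschitz. -/
lemma LocallyLipschitz.exists_lipschitzWith_of_hasCompactSupport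
    {X Y : Type*} [NormedAddCommGroup X] [NormedSpace ℝ X] [FiniteDimensional ℝ X]
    [NormedAddCommGroup Y] {f : X → Y} (hf : LocallyLipschitz f) (hc : HasCompactSupport f) :
    ∃ L, LipschitzWith L f := by
  have : ProperSpace X := FiniteDimensional.proper ℝ X
  obtain ⟨L, hL⟩ := LocallyLipschitzOn.exists_lipschitzOnWith_of_compact
    (hc.isCompact.cthickening (r := 1)) (hf.locallyLipschitzOn (s := Metric.cthickening 1 (tsupport f)))
  obtain ⟨M, hM⟩ := hc.exists_bound_of_continuous hf.continuous
  have hM0 : 0 ≤ M := (norm_nonneg _).trans (hM 0)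
  -- Near the support the constant `L` of the compact thickening serves. Farther away `f y = 0` and
  -- `‖x - y‖ ≥ 1`, so the sup bound `M` serves.
  have key : ∀ x ∈ tsupport f, ∀ y, ‖f x - f y‖ ≤ (max (L : ℝ) M) * ‖x - y‖ := by
    intro x hx y
    by_cases hy : y ∈ Metric.cthickening 1 (tsupport f)
    · have := hL.norm_sub_le (Metric.self_subset_cthickening _ hx) hy
      exact this.trans (by gcongr; exact le_max_left _ _)
    · have hy0 : f y = 0 := by
        by_contra h0
        exact hy (Metric.self_subset_cthickening _ (subset_tsupport f h0))
      have h1 : 1 ≤ ‖x - y‖ := by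
        by_contra! h1
        refine hy (Metric.mem_cthickening_of_dist_le y x 1 _ hx ?_)
        rw [dist_comm, dist_eq_norm]; exact h1.le
      rw [hy0, sub_zero]
      calc ‖f x‖ ≤ M * 1 := by simpa using hM x
        _ ≤ _ := by gcongr; exact le_max_right _ _
  refine ⟨max L ⟨M, hM0⟩, LipschitzWith.of_dist_le_mul fun x y => ?_⟩
  rw [dist_eq_norm, dist_eq_norm]
  change _ ≤ max (L : ℝ) M * _
  by_cases hx : x ∈ tsupport f
  · exact key x hx y
  by_cases hy : y ∈ tsupport f
  · rw [norm_sub_rev, norm_sub_rev x]; exact key y hy x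
  · rw [image_eq_zero_of_notMem_tsupport hx, image_eq_zero_of_notMem_tsupport hy]
    simp only [sub_self, norm_zero]
    positivity

lemma ContDiff.comp_locallyLipschitz {X Y Z : Type*} [NormedAddCommGroup X]
    [NormedAddCommGroup Y] [NormedSpace ℝ Y] [NormedAddCommGroup Z] [NormedSpace ℝ Z]
    {f : Y → Z} {g : X → Y} (hf : ContDiff ℝ 1 f) (hg : LocallyLipschitz g) :
    LocallyLipschitz (fun x => f (g x)) :=
  hf.locallyLipschitz.comp hg

lemma LocallyLipschitz.smul_fun {X Y : Type*} [NormedAddCommGroup X] [NormedAddCommGroup Y]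
    [NormedSpace ℝ Y] {f : X → ℝ} {g : X → Y} (hf : LocallyLipschitz f)
    (hg : LocallyLipschitz g) : LocallyLipschitz (fun x => f x • g x) := by
  have h : ContDiff ℝ 1 (fun z : ℝ × Y => z.1 • z.2) := contDiff_fst.smul contDiff_snd
  exact h.comp_locallyLipschitz (hf.prodMk hg)

lemma LocallyLipschitz.mul_fun {X : Type*} [NormedAddCommGroup X] {f g : X → ℝ}
    (hf : LocallyLipschitz f) (hg : LocallyLipschitz g) :
    LocallyLipschitz (fun x => f x * g x) := by
  have h : ContDiff ℝ 1 (fun z : ℝ × ℝ => z.1 * z.2) := contDiff_fst.mul contDiff_snd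
  exact h.comp_locallyLipschitz (hf.prodMk hg)

lemma LocallyLipschitz.sub_fun {X Y : Type*} [NormedAddCommGroup X] [NormedAddCommGroup Y]
    [NormedSpace ℝ Y] {f g : X → Y} (hf : LocallyLipschitz f)
    (hg : LocallyLipschitz g) : LocallyLipschitz (fun x => f x - g x) := by
  have h : ContDiff ℝ 1 (fun z : Y × Y => z.1 - z.2) := contDiff_fst.sub contDiff_snd
  exact h.comp_locallyLipschitz (hf.prodMk hg)

lemma LocallyLipschitz.inner_fun {X Y : Type*} [NormedAddCommGroup X] [NormedAddCommGroup Y]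
    [InnerProductSpace ℝ Y] {f g : X → Y}
    (hf : LocallyLipschitz f) (hg : LocallyLipschitz g) :
    LocallyLipschitz (fun x => (inner ℝ (f x) (g x) : ℝ)) := by
  have h : ContDiff ℝ 1 (fun z : Y × Y => (inner ℝ z.1 z.2 : ℝ)) :=
    contDiff_fst.inner ℝ contDiff_snd
  exact h.comp_locallyLipschitz (hf.prodMk hg)

variable {d : ℕ}

local notation "𝔼" => EuclideanSpace ℝ (Fin d)

/-- The trace of the derivative of a vector field. -/
noncomputable def divergence (X : 𝔼 → 𝔼) (x : 𝔼) : ℝ :=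
  ∑ i, fderiv ℝ X x (EuclideanSpace.single i 1) i

lemma fderiv_coord {X : 𝔼 → 𝔼} {x : 𝔼} (hX : DifferentiableAt ℝ X x) (i : Fin d) (v : 𝔼) :
    fderiv ℝ (fun y => X y i) x v = fderiv ℝ X x v i := by
  have := ((EuclideanSpace.proj (𝕜 := ℝ) i).hasFDerivAt.comp x hX.hasFDerivAt).fderiv
  have h2 : fderiv ℝ (fun y => X y i) x = (EuclideanSpace.proj (𝕜 := ℝ) i) ∘L (fderiv ℝ X x) := by
    rw [← this]; rfl
  rw [h2]; rfl

lemma sum_single_eq (v : 𝔼) : ∑ i, v i • EuclideanSpace.single i (1 : ℝ) = v := by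
  have := (EuclideanSpace.basisFun (Fin d) ℝ).sum_repr v
  simpa using this

lemma sum_apply_single_mul (L : 𝔼 →L[ℝ] ℝ) (v : 𝔼) :
    ∑ i, L (EuclideanSpace.single i 1) * v i = L v := by
  conv_rhs => rw [← sum_single_eq v, map_sum]
  exact Finset.sum_congr rfl fun i _ => by rw [map_smul, smul_eq_mul, mul_comm]

lemma divergence_smul {f : 𝔼 → ℝ} {X : 𝔼 → 𝔼} {x : 𝔼} (hf : DifferentiableAt ℝ f x)
    (hX : DifferentiableAt ℝ X x) :
    divergence (fun y => f y • X y) x = fderiv ℝ f x (X x) + f x * divergence X x := by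
  unfold divergence
  rw [fderiv_fun_smul hf hX, ← sum_apply_single_mul (fderiv ℝ f x) (X x), Finset.mul_sum,
    ← Finset.sum_add_distrib]
  refine Finset.sum_congr rfl fun i _ => ?_
  simp [add_comm]

lemma divergence_sub {X Y : 𝔼 → 𝔼} {x : 𝔼} (hX : DifferentiableAt ℝ X x)
    (hY : DifferentiableAt ℝ Y x) :
    divergence (fun y => X y - Y y) x = divergence X x - divergence Y x := by
  unfold divergence
  rw [fderiv_fun_sub hX hY, ← Finset.sum_sub_distrib]
  rfl

lemma abs_divergence_le (X : 𝔼 → 𝔼) (x : 𝔼) : |divergence X x| ≤ d * ‖fderiv ℝ X x‖ := by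
  unfold divergence
  refine (Finset.abs_sum_le_sum_abs _ _).trans ?_
  calc ∑ i, |fderiv ℝ X x (EuclideanSpace.single i 1) i| ≤ ∑ _i : Fin d, ‖fderiv ℝ X x‖ := by
        refine Finset.sum_le_sum fun i _ => ?_
        have h1 := PiLp.norm_apply_le (p := 2) (fderiv ℝ X x (EuclideanSpace.single i 1)) i
        have h2 := (fderiv ℝ X x).le_opNorm (EuclideanSpace.single i 1)
        rw [PiLp.norm_single, norm_one, mul_one] at h2
        exact h1.trans h2
    _ = _ := by simp

lemma measurable_divergence (X : 𝔼 → 𝔼) : Measurable (divergence X) := by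
  unfold divergence
  refine Finset.measurable_sum _ fun i _ => ?_
  have := measurable_fderiv_apply_const ℝ X (EuclideanSpace.single i 1)
  fun_prop

/-- The divergence theorem for compactly supported locally Lipschitz vector fields. -/
theorem integral_divergence_eq_zero {X : 𝔼 → 𝔼} (hX : LocallyLipschitz X)
    (hc : HasCompactSupport X) : ∫ x, divergence X x = 0 := by
  obtain ⟨L, hL⟩ := hX.exists_lipschitzWith_of_hasCompactSupport hc
  have hcoord : ∀ i, LipschitzWith L (fun x => X x i) := fun i => by
    refine LipschitzWith.of_dist_le_mul fun x y => ?_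
    refine le_trans ?_ (hL.dist_le_mul x y)
    rw [dist_eq_norm, dist_eq_norm]
    exact PiLp.norm_apply_le (p := 2) (X x - X y) i
  have hcc : ∀ i, HasCompactSupport (fun x => X x i) := fun i =>
    hc.comp_left (g := fun v : 𝔼 => v i) rfl
  -- Integration by parts against the constant one, whose line derivatives vanish. The formula moves
  -- a derivative along `v` to one along `-v`, hence the negative direction.
  have h0 : ∀ i, ∫ x, lineDeriv ℝ (fun x => X x i) x (EuclideanSpace.single i 1) = 0 := fun i => by
    have h2 := LipschitzWith.integral_lineDeriv_mul_eq (μ := (volume : Measure 𝔼))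
      (LipschitzWith.const (1 : ℝ) : LipschitzWith 0 fun _ : 𝔼 => (1 : ℝ)) (hcoord i) (hcc i)
      (-EuclideanSpace.single i 1)
    simp only [neg_neg, mul_one] at h2
    rw [← h2]
    have : ∀ x v, lineDeriv ℝ (fun _ : 𝔼 => (1 : ℝ)) x v = 0 := fun x v => by
      simp [lineDeriv]
    simp [this]
  have hae : ∀ᵐ x, divergence X x
      = ∑ i, lineDeriv ℝ (fun x => X x i) x (EuclideanSpace.single i 1) := by
    filter_upwards [hL.ae_differentiableAt] with x hx
    refine Finset.sum_congr rfl fun i _ => ?_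
    have hd : DifferentiableAt ℝ (fun y => X y i) x :=
      (EuclideanSpace.proj (𝕜 := ℝ) i).differentiableAt.comp x hx
    rw [hd.lineDeriv_eq_fderiv, fderiv_coord hx]
  rw [integral_congr_ae hae, integral_finsetSum]
  · simp [h0]
  · intro i _
    obtain ⟨R, hR⟩ := (hcc i).isCompact.isBounded.subset_closedBall (0 : 𝔼)
    have hint : IntegrableOn (fun x => lineDeriv ℝ (fun x => X x i) x (EuclideanSpace.single i 1))
        (Metric.closedBall 0 R) :=
      ((hcoord i).locallyIntegrable_lineDeriv _).integrableOn_isCompact (isCompact_closedBall _ _)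
    refine hint.integrable_of_forall_notMem_eq_zero fun x hx => ?_
    have hx' : x ∉ tsupport (fun x => X x i) := fun h => hx (hR h)
    have : (fun y => X y i) =ᶠ[𝓝 x] fun _ => 0 := notMem_tsupport_iff_eventuallyEq.1 hx'
    rw [this.lineDeriv_eq]
    simp [lineDeriv]

end LipschitzDivergence

/-! ### Mollification and its convergence in `L²`. -/

section Mollification

open scoped ENNReal Convolution

variable {d : ℕ} {Y : Type*} [NormedAddCommGroup Y] [NormedSpace ℝ Y]

local notation "𝔼" => EuclideanSpace ℝ (Fin d)

/-- Bump functions with support in the ball of radius `1 / (n + 1)`. -/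
noncomputable def mollifierBump (d n : ℕ) : ContDiffBump (0 : EuclideanSpace ℝ (Fin d)) where
  rIn := 1 / (2 * ((n : ℝ) + 1))
  rOut := 1 / ((n : ℝ) + 1)
  rIn_pos := by positivity
  rIn_lt_rOut := by
    apply one_div_lt_one_div_of_lt <;> linarith [(Nat.cast_nonneg n : (0 : ℝ) ≤ n)]

/-- The normalized mollifying kernel. -/
noncomputable def mollifier (d n : ℕ) : EuclideanSpace ℝ (Fin d) → ℝ :=
  (mollifierBump d n).normed volume

/-- Mollification at scale `1 / (n + 1)`. -/
noncomputable def mollify (n : ℕ) (a : 𝔼 → Y) : 𝔼 → Y :=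
  mollifier d n ⋆[ContinuousLinearMap.lsmul ℝ ℝ, volume] a

lemma tendsto_mollifier_radius (d : ℕ) :
    Tendsto (fun n => (mollifierBump d n).rOut) atTop (𝓝 0) :=
  tendsto_one_div_add_atTop_nhds_zero_nat

lemma contDiff_mollifier (d n : ℕ) : ContDiff ℝ ∞ (mollifier d n) :=
  (mollifierBump d n).contDiff_normed

lemma hasCompactSupport_mollifier (d n : ℕ) : HasCompactSupport (mollifier d n) :=
  (mollifierBump d n).hasCompactSupport_normed

lemma mollifier_nonneg (n : ℕ) (x : 𝔼) : 0 ≤ mollifier d n x :=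
  (mollifierBump d n).nonneg_normed x

lemma integral_mollifier (n : ℕ) : ∫ x, mollifier d n x = 1 :=
  (mollifierBump d n).integral_normed

lemma support_mollifier (n : ℕ) :
    Function.support (mollifier d n) = Metric.ball 0 (1 / ((n : ℝ) + 1)) :=
  (mollifierBump d n).support_normed_eq

lemma mollify_apply (n : ℕ) (a : 𝔼 → Y) (x : 𝔼) :
    mollify n a x = ∫ t, mollifier d n t • a (x - t) := rfl

lemma mollify_apply_swap (n : ℕ) (a : 𝔼 → Y) (x : 𝔼) :
    mollify n a x = ∫ t, mollifier d n (x - t) • a t :=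
  convolution_lsmul_swap

lemma lintegral_mollifier (n : ℕ) :
    ∫⁻ t, ENNReal.ofReal (mollifier d n t) = 1 := by
  rw [← ofReal_integral_eq_lintegral_ofReal
    ((contDiff_mollifier d n).continuous.integrable_of_hasCompactSupport
      (hasCompactSupport_mollifier d n)) (Eventually.of_forall fun x => mollifier_nonneg n x),
    integral_mollifier, ENNReal.ofReal_one]

/-- Jensen's inequality for the probability measure whose density is the mollifier, obtained from
Cauchy–Schwarz against the constant one. -/
lemma enorm_mollify_sq_le (n : ℕ) {a : 𝔼 → Y} (ha : AEStronglyMeasurable a volume) (x : 𝔼) :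
    ‖mollify n a x‖ₑ ^ (2 : ℝ) ≤
      ∫⁻ t, ENNReal.ofReal (mollifier d n t) * ‖a (x - t)‖ₑ ^ (2 : ℝ) := by
  set k : 𝔼 → ℝ≥0∞ := fun t => ENNReal.ofReal (mollifier d n t) with hk
  have hkm : Measurable k := (contDiff_mollifier d n).continuous.measurable.ennreal_ofReal
  have ham : AEMeasurable (fun t => ‖a (x - t)‖ₑ) volume :=
    (ha.comp_quasiMeasurePreserving
      (quasiMeasurePreserving_sub_left_of_right_invariant volume x)).enorm
  set ν : Measure 𝔼 := volume.withDensity k with hν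
  have hνac : ν ≪ volume := withDensity_absolutelyContinuous _ _
  have h1 : ‖mollify n a x‖ₑ ≤ ∫⁻ t, ‖a (x - t)‖ₑ ∂ν := by
    rw [mollify_apply, hν, lintegral_withDensity_eq_lintegral_mul₀ hkm.aemeasurable ham]
    refine (enorm_integral_le_lintegral_enorm _).trans (le_of_eq ?_)
    refine lintegral_congr fun t => ?_
    rw [enorm_smul, Real.enorm_of_nonneg (mollifier_nonneg n t)]
    rfl
  have h2 := ENNReal.lintegral_mul_le_Lp_mul_Lq ν (p := 2) (q := 2)
    Real.HolderConjugate.two_two (ham.mono_ac hνac) (aemeasurable_const (b := (1 : ℝ≥0∞)))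
  have hone : ν univ = 1 := by
    rw [hν, withDensity_apply _ MeasurableSet.univ, Measure.restrict_univ]
    exact lintegral_mollifier n
  simp only [Pi.mul_apply, mul_one, ENNReal.one_rpow, lintegral_const, hone] at h2
  calc ‖mollify n a x‖ₑ ^ (2 : ℝ)
      ≤ ((∫⁻ t, ‖a (x - t)‖ₑ ^ (2 : ℝ) ∂ν) ^ (1 / (2 : ℝ))) ^ (2 : ℝ) := by
        gcongr
        exact h1.trans h2
    _ = ∫⁻ t, ‖a (x - t)‖ₑ ^ (2 : ℝ) ∂ν := by
        rw [← ENNReal.rpow_mul]; norm_num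
    _ = _ := by
        rw [hν, lintegral_withDensity_eq_lintegral_mul₀ hkm.aemeasurable (ham.pow_const _)]
        rfl

/-- Integrating the pointwise Jensen bound, Tonelli and translation invariance leave the mass of the
kernel, which is one. -/
lemma eLpNorm_mollify_le (n : ℕ) {a : 𝔼 → Y} (ha : AEStronglyMeasurable a volume) :
    eLpNorm (mollify n a) 2 volume ≤ eLpNorm a 2 volume := by
  have hpow : ∀ b : 𝔼 → Y, eLpNorm b 2 volume = (∫⁻ x, ‖b x‖ₑ ^ (2 : ℝ)) ^ (1 / (2 : ℝ)) :=
    fun b => by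
      rw [eLpNorm_eq_lintegral_rpow_enorm_toReal (by norm_num) (by norm_num)]; norm_num
  rw [hpow, hpow]
  refine ENNReal.rpow_le_rpow ?_ (by norm_num)
  calc ∫⁻ x, ‖mollify n a x‖ₑ ^ (2 : ℝ)
      ≤ ∫⁻ x, ∫⁻ t, ENNReal.ofReal (mollifier d n t) * ‖a (x - t)‖ₑ ^ (2 : ℝ) :=
        lintegral_mono fun x => enorm_mollify_sq_le n ha x
    _ = ∫⁻ t, ∫⁻ x, ENNReal.ofReal (mollifier d n t) * ‖a (x - t)‖ₑ ^ (2 : ℝ) := by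
        refine lintegral_lintegral_swap ?_
        have h1 : AEStronglyMeasurable (fun z : 𝔼 × 𝔼 => a (z.1 - z.2))
            ((volume : Measure 𝔼).prod volume) :=
          ha.comp_quasiMeasurePreserving (quasiMeasurePreserving_sub_of_right_invariant _ _)
        have h2 : Measurable (fun z : 𝔼 × 𝔼 => ENNReal.ofReal (mollifier d n z.2)) :=
          ((contDiff_mollifier d n).continuous.comp continuous_snd).measurable.ennreal_ofReal
        exact h2.aemeasurable.mul (h1.enorm.pow_const _)
    _ = ∫⁻ t, ENNReal.ofReal (mollifier d n t) * ∫⁻ x, ‖a x‖ₑ ^ (2 : ℝ) := by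
        refine lintegral_congr fun t => ?_
        rw [lintegral_const_mul' _ _ ENNReal.ofReal_ne_top,
          lintegral_sub_right_eq_self (fun x => ‖a x‖ₑ ^ (2 : ℝ)) t]
    _ = ∫⁻ x, ‖a x‖ₑ ^ (2 : ℝ) := by
        rw [lintegral_mul_const _
          (contDiff_mollifier d n).continuous.measurable.ennreal_ofReal, lintegral_mollifier,
          one_mul]

lemma continuous_mollify (n : ℕ) {a : 𝔼 → Y} (ha : LocallyIntegrable a volume) :
    Continuous (mollify n a) :=
  (hasCompactSupport_mollifier d n).continuous_convolution_left _
    (contDiff_mollifier d n).continuous ha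

lemma convolutionExistsAt_mollifier (n : ℕ) {a : 𝔼 → Y} (ha : LocallyIntegrable a volume)
    (x : 𝔼) : Integrable (fun t => mollifier d n t • a (x - t)) :=
  (hasCompactSupport_mollifier d n).convolutionExists_left (ContinuousLinearMap.lsmul ℝ ℝ)
    (contDiff_mollifier d n).continuous ha x

lemma mollify_sub (n : ℕ) {a b : 𝔼 → Y} (ha : LocallyIntegrable a volume)
    (hb : LocallyIntegrable b volume) : mollify n (a - b) = mollify n a - mollify n b := by
  ext x
  rw [Pi.sub_apply, mollify_apply, mollify_apply, mollify_apply, ← integral_sub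
    (convolutionExistsAt_mollifier n ha x) (convolutionExistsAt_mollifier n hb x)]
  simp [smul_sub]

variable [CompleteSpace Y]

/-- Uniform continuity makes the difference at most `c` everywhere, and it vanishes off the unit
thickening of the support, a set of finite measure. -/
lemma tendsto_eLpNorm_mollify_sub_of_continuous {g : 𝔼 → Y} (hg : Continuous g)
    (hc : HasCompactSupport g) :
    Tendsto (fun n => eLpNorm (mollify n g - g) 2 volume) atTop (𝓝 0) := by
  set S := Metric.cthickening 1 (tsupport g)
  have hS : IsCompact S := hc.isCompact.cthickening
  have hSfin : volume S ≠ ⊤ := hS.measure_lt_top.ne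
  have huc := hg.uniformContinuous_of_tendsto_cocompact hc.is_zero_at_infty
  rw [ENNReal.tendsto_nhds_zero]
  intro ε hε
  obtain ⟨c, hc0, hcε⟩ : ∃ c : ℝ, 0 < c ∧ volume S ^ (2 : ℝ)⁻¹ * ENNReal.ofReal c ≤ ε := by
    have hT : Tendsto (fun c : ℝ => volume S ^ (2 : ℝ)⁻¹ * ENNReal.ofReal c) (𝓝[>] 0) (𝓝 0) := by
      have h1 : Tendsto (fun c : ℝ => ENNReal.ofReal c) (𝓝[>] 0) (𝓝 0) := by
        have := (ENNReal.continuous_ofReal.tendsto 0).mono_left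
          (nhdsWithin_le_nhds (s := Ioi (0 : ℝ)))
        simpa using this
      have h2 := ENNReal.Tendsto.const_mul (a := volume S ^ (2 : ℝ)⁻¹) h1
        (Or.inr (ENNReal.rpow_ne_top_of_nonneg (by norm_num) hSfin))
      simpa using h2
    have := (ENNReal.tendsto_nhds_zero.1 hT ε hε).and self_mem_nhdsWithin
    obtain ⟨c, h1, h2⟩ := this.exists
    exact ⟨c, h2, h1⟩
  obtain ⟨r, hr0, hr⟩ := Metric.uniformContinuous_iff.1 huc c hc0
  have hev : ∀ᶠ n in atTop, (mollifierBump d n).rOut < min r 1 :=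
    (tendsto_mollifier_radius d).eventually_lt_const (lt_min hr0 one_pos)
  filter_upwards [hev] with n hn
  have hz : ∀ x, x ∉ S → (mollify n g - g) x = 0 := by
    intro x hx
    have hball : ∀ y ∈ Metric.closedBall x 1, g y = 0 := by
      intro y hy
      by_contra h0
      exact hx (Metric.mem_cthickening_of_dist_le x y 1 _ (subset_tsupport g h0)
        (by rw [dist_comm]; exact hy))
    have hgx : g x = 0 := hball x (Metric.mem_closedBall_self zero_le_one)
    have := (mollifierBump d n).normed_convolution_eq_right (μ := volume) (g := g) (x₀ := x)
      (fun y hy => by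
        rw [hgx]
        exact hball y (Metric.ball_subset_closedBall
          (Metric.ball_subset_ball (hn.le.trans (min_le_right _ _)) hy)))
    change mollify n g x = g x at this
    rw [Pi.sub_apply, this, sub_self]
  have hb : ∀ x, ‖(mollify n g - g) x‖ ≤ c := by
    intro x
    rw [Pi.sub_apply, ← dist_eq_norm]
    exact (mollifierBump d n).dist_normed_convolution_le hg.aestronglyMeasurable
      fun y hy => (hr (lt_of_lt_of_le hy (hn.le.trans (min_le_left _ _)))).le
  have hsupp : (mollify n g - g) = S.indicator (mollify n g - g) := by
    rw [indicator_eq_self.2]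
    intro x hx
    by_contra h
    exact hx (hz x h)
  rw [hsupp, eLpNorm_indicator_eq_eLpNorm_restrict hS.measurableSet]
  refine (eLpNorm_le_of_ae_bound (Eventually.of_forall hb)).trans ?_
  simpa using hcε

/-- Mollifications of a square integrable function converge to it in `L²`. -/
theorem tendsto_eLpNorm_mollify_sub {a : 𝔼 → Y} (ha : MemLp a 2 volume) :
    Tendsto (fun n => eLpNorm (mollify n a - a) 2 volume) atTop (𝓝 0) := by
  have hloc : ∀ {b : 𝔼 → Y}, MemLp b 2 volume → LocallyIntegrable b volume :=
    fun hb => hb.locallyIntegrable (by norm_num)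
  rw [ENNReal.tendsto_nhds_zero]
  intro ε hε
  have hε3 : ε / 3 ≠ 0 := (ENNReal.div_pos hε.ne' (by norm_num)).ne'
  obtain ⟨g, hgc, hag, hg, hgL⟩ :=
    ha.exists_hasCompactSupport_eLpNorm_sub_le (by norm_num) hε3
  have hag' : eLpNorm (g - a) 2 volume ≤ ε / 3 := by rwa [eLpNorm_sub_comm]
  filter_upwards [ENNReal.tendsto_nhds_zero.1
    (tendsto_eLpNorm_mollify_sub_of_continuous hg hgc) (ε / 3) hε3.bot_lt] with n hn
  -- Mollification contracts `L²`, so the error coming from `a - g` stays below `ε / 3` for every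
  -- `n`.
  have hsplit : mollify n a - a = mollify n (a - g) + ((mollify n g - g) + (g - a)) := by
    rw [mollify_sub n (hloc ha) (hloc hgL)]; abel
  have hm1 : AEStronglyMeasurable (mollify n (a - g)) volume :=
    (continuous_mollify n ((hloc ha).sub (hloc hgL))).aestronglyMeasurable
  have hm2 : AEStronglyMeasurable (mollify n g - g) volume :=
    (continuous_mollify n (hloc hgL)).aestronglyMeasurable.sub hg.aestronglyMeasurable
  have hm3 : AEStronglyMeasurable (g - a) volume := hg.aestronglyMeasurable.sub ha.1
  rw [hsplit]
  calc _ ≤ eLpNorm (mollify n (a - g)) 2 volume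
        + (eLpNorm (mollify n g - g) 2 volume + eLpNorm (g - a) 2 volume) := by
        refine (eLpNorm_add_le hm1 (hm2.add hm3) (by norm_num)).trans ?_
        gcongr
        exact eLpNorm_add_le hm2 hm3 (by norm_num)
    _ ≤ ε / 3 + (ε / 3 + ε / 3) := by
        gcongr
        exact (eLpNorm_mollify_le n (ha.1.sub hgL.1)).trans hag
    _ = ε := by rw [← add_assoc, ENNReal.add_thirds]

/-- Mollifications of a function which is square integrable near the compact set `S` converge to
it in `L²(S)`. -/
theorem tendsto_eLpNorm_mollify_sub_restrict {a : 𝔼 → Y} {S : Set 𝔼} (hS : IsCompact S)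
    (ha : ∀ T : Set 𝔼, IsCompact T → MemLp a 2 (volume.restrict T)) :
    Tendsto (fun n => eLpNorm (mollify n a - a) 2 (volume.restrict S)) atTop (𝓝 0) := by
  set T := Metric.cthickening 1 S
  have hT : IsCompact T := hS.cthickening
  have haT : MemLp (T.indicator a) 2 volume :=
    (memLp_indicator_iff_restrict hT.measurableSet).2 (ha T hT)
  have hlim := tendsto_eLpNorm_mollify_sub haT
  refine tendsto_of_tendsto_of_tendsto_of_le_of_le' tendsto_const_nhds hlim
    (Eventually.of_forall fun _ => zero_le) (Eventually.of_forall fun n => ?_)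
  -- The kernels have radius at most one, so at points of `S` only the values of `a` on the unit
  -- thickening enter.
  have heq : ∀ x ∈ S, (mollify n a - a) x = (mollify n (T.indicator a) - T.indicator a) x := by
    intro x hx
    have hxT : x ∈ T := Metric.self_subset_cthickening _ hx
    rw [Pi.sub_apply, Pi.sub_apply, indicator_of_mem hxT]
    congr 1
    rw [mollify_apply, mollify_apply]
    refine integral_congr_ae (Eventually.of_forall fun t => ?_)
    by_cases ht : t ∈ Function.support (mollifier d n)
    · have htT : x - t ∈ T := by
        refine Metric.mem_cthickening_of_dist_le (x - t) x 1 S hx ?_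
        rw [support_mollifier, mem_ball_zero_iff] at ht
        have : 1 / ((n : ℝ) + 1) ≤ 1 := by
          rw [div_le_one (by positivity)]; linarith [(Nat.cast_nonneg n : (0 : ℝ) ≤ n)]
        simp only [dist_eq_norm, sub_sub_cancel_left, norm_neg]
        linarith
      simp only [indicator_of_mem htT]
    · simp only [Function.notMem_support.1 ht, zero_smul]
  calc eLpNorm (mollify n a - a) 2 (volume.restrict S)
      = eLpNorm (mollify n (T.indicator a) - T.indicator a) 2 (volume.restrict S) :=
        eLpNorm_congr_ae ((ae_restrict_iff' hS.measurableSet).2 (Eventually.of_forall heq))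
    _ ≤ _ := eLpNorm_mono_measure _ Measure.restrict_le_self

/-! ### Passage to the limit in integrals of bilinear forms. -/

/-- Data of a bounded family of bilinear forms on measurable vector fields. -/
structure IsBoundedBilinFamily {α Y Z : Type*} [MeasurableSpace α] (ν : Measure α)
    [NormedAddCommGroup Y] [NormedAddCommGroup Z] (L : α → Y → Z → ℝ) (C : ℝ) : Prop where
  sub_left : ∀ x y y' z, L x (y - y') z = L x y z - L x y' z
  sub_right : ∀ x y z z', L x y (z - z') = L x y z - L x y z'
  bound : ∀ x y z, |L x y z| ≤ C * ‖y‖ * ‖z‖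
  meas : ∀ (y : α → Y) (z : α → Z), AEStronglyMeasurable y ν → AEStronglyMeasurable z ν →
    AEStronglyMeasurable (fun x => L x (y x) (z x)) ν

section Bilin

variable {α Y Z : Type*} [MeasurableSpace α] {ν : Measure α} [NormedAddCommGroup Y]
  [NormedAddCommGroup Z] {L : α → Y → Z → ℝ} {C : ℝ}

lemma IsBoundedBilinFamily.eLpNorm_le (hL : IsBoundedBilinFamily ν L C) {y : α → Y} {z : α → Z}
    (hy : MemLp y 2 ν) (hz : MemLp z 2 ν) :
    eLpNorm (fun x => L x (y x) (z x)) 1 ν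
      ≤ ENNReal.ofReal C * eLpNorm y 2 ν * eLpNorm z 2 ν := by
  have h1 := eLpNorm_le_eLpNorm_mul_eLpNorm'_of_norm (p := 2) (q := 2) (r := 1)
    hy.1.norm hz.1.norm (fun s t : ℝ => s * t) 1
    (Eventually.of_forall fun x => by simp [norm_mul])
  have h2 : eLpNorm (fun x => L x (y x) (z x)) 1 ν
      ≤ ENNReal.ofReal C * eLpNorm (fun x => ‖y x‖ * ‖z x‖) 1 ν := by
    refine eLpNorm_le_mul_eLpNorm_of_ae_le_mul (Eventually.of_forall fun x => ?_) 1
    refine (hL.bound x _ _).trans (le_of_eq ?_)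
    simp only [norm_mul, norm_norm]; ring
  refine h2.trans ?_
  rw [mul_assoc]
  gcongr
  simpa [eLpNorm_norm] using h1

lemma IsBoundedBilinFamily.integrable (hL : IsBoundedBilinFamily ν L C) {y : α → Y} {z : α → Z}
    (hy : MemLp y 2 ν) (hz : MemLp z 2 ν) : Integrable (fun x => L x (y x) (z x)) ν := by
  rw [← memLp_one_iff_integrable]
  refine ⟨hL.meas y z hy.1 hz.1, (hL.eLpNorm_le hy hz).trans_lt ?_⟩
  exact ENNReal.mul_lt_top (ENNReal.mul_lt_top ENNReal.ofReal_lt_top hy.2) hz.2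

/-- Continuity of the integral of a bounded bilinear form under `L²` convergence. -/
theorem IsBoundedBilinFamily.tendsto_integral (hL : IsBoundedBilinFamily ν L C)
    {a : ℕ → α → Y} {a' : α → Y} {b : ℕ → α → Z} {b' : α → Z}
    (ha : ∀ n, MemLp (a n) 2 ν) (ha' : MemLp a' 2 ν) (hb : ∀ n, MemLp (b n) 2 ν)
    (hb' : MemLp b' 2 ν) (hat : Tendsto (fun n => eLpNorm (a n - a') 2 ν) atTop (𝓝 0))
    (hbt : Tendsto (fun n => eLpNorm (b n - b') 2 ν) atTop (𝓝 0)) :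
    Tendsto (fun n => ∫ x, L x (a n x) (b n x) ∂ν) atTop (𝓝 (∫ x, L x (a' x) (b' x) ∂ν)) := by
  refine tendsto_integral_of_L1' _ (hL.meas _ _ ha'.1 hb'.1)
    (Eventually.of_forall fun n => hL.integrable (ha n) (hb n)) ?_
  have hub : ∀ n, eLpNorm ((fun x => L x (a n x) (b n x)) - fun x => L x (a' x) (b' x)) 1 ν
      ≤ ENNReal.ofReal C * eLpNorm (a n - a') 2 ν * (eLpNorm (b n - b') 2 ν + eLpNorm b' 2 ν)
        + ENNReal.ofReal C * eLpNorm a' 2 ν * eLpNorm (b n - b') 2 ν := by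
    intro n
    have hs : ((fun x => L x (a n x) (b n x)) - fun x => L x (a' x) (b' x))
        = (fun x => L x ((a n - a') x) (b n x)) + fun x => L x (a' x) ((b n - b') x) := by
      ext x
      simp only [Pi.sub_apply, Pi.add_apply, hL.sub_left, hL.sub_right]
      ring
    rw [hs]
    refine (eLpNorm_add_le (hL.integrable ((ha n).sub ha') (hb n)).1
      (hL.integrable ha' ((hb n).sub hb')).1
      le_rfl).trans ?_
    refine add_le_add ((hL.eLpNorm_le ((ha n).sub ha') (hb n)).trans ?_) (hL.eLpNorm_le ha' ((hb n).sub hb'))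
    gcongr
    have : b n = (b n - b') + b' := by abel
    conv_lhs => rw [this]
    exact eLpNorm_add_le ((hb n).sub hb').1 hb'.1 (by norm_num)
  refine tendsto_of_tendsto_of_tendsto_of_le_of_le tendsto_const_nhds ?_ (fun _ => zero_le) hub
  have e1 : Tendsto (fun n => ENNReal.ofReal C * eLpNorm (a n - a') 2 ν
      * (eLpNorm (b n - b') 2 ν + eLpNorm b' 2 ν)) atTop (𝓝 (ENNReal.ofReal C * 0
        * (0 + eLpNorm b' 2 ν))) :=
    ENNReal.Tendsto.mul (ENNReal.Tendsto.const_mul hat (Or.inr ENNReal.ofReal_ne_top))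
      (Or.inr (by simpa using hb'.2.ne)) (hbt.add tendsto_const_nhds) (Or.inr (by simp))
  have e2 : Tendsto (fun n => ENNReal.ofReal C * eLpNorm a' 2 ν * eLpNorm (b n - b') 2 ν) atTop
      (𝓝 (ENNReal.ofReal C * eLpNorm a' 2 ν * 0)) :=
    ENNReal.Tendsto.const_mul hbt
      (Or.inr (ENNReal.mul_ne_top ENNReal.ofReal_ne_top ha'.2.ne))
  simpa using e1.add e2

end Bilin

end Mollification

/-! ### Weak gradients and divergences under mollification. -/

section WeakDerivatives

open scoped ENNReal Convolution

variable {d : ℕ}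

local notation "𝔼" => EuclideanSpace ℝ (Fin d)

lemma gradient_apply (f : 𝔼 → ℝ) (x : 𝔼) (i : Fin d) :
    ∇ f x i = fderiv ℝ f x (EuclideanSpace.single i 1) := by
  have h : inner ℝ (∇ f x) (EuclideanSpace.single i (1 : ℝ))
      = fderiv ℝ f x (EuclideanSpace.single i 1) := by
    rw [gradient, InnerProductSpace.toDual_symm_apply]
  rw [← h, EuclideanSpace.inner_single_right, one_mul]; rfl

lemma inner_gradient (f : 𝔼 → ℝ) (x v : 𝔼) : inner ℝ (∇ f x) v = fderiv ℝ f x v := by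
  rw [gradient, InnerProductSpace.toDual_symm_apply]

/-- `a` is locally square integrable and so is its distributional gradient `A`. -/
structure HasWeakGradient (a : 𝔼 → ℝ) (A : 𝔼 → 𝔼) : Prop where
  memLp : ∀ T : Set 𝔼, IsCompact T → MemLp a 2 (volume.restrict T)
  memLp_grad : ∀ T : Set 𝔼, IsCompact T → MemLp A 2 (volume.restrict T)
  weak : ∀ φ : 𝔼 → ℝ, ContDiff ℝ ∞ φ → HasCompactSupport φ →
    ∀ i, ∫ x, a x * fderiv ℝ φ x (EuclideanSpace.single i 1) = -∫ x, A x i * φ x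

/-- `F` is the distributional divergence of `A` on the complement of the origin, where it is
locally square integrable. -/
structure HasWeakDivergence (A : 𝔼 → 𝔼) (F : 𝔼 → ℝ) : Prop where
  memLp : ∀ T : Set 𝔼, IsCompact T → (0 : 𝔼) ∉ T → MemLp F 2 (volume.restrict T)
  weak : ∀ φ : 𝔼 → ℝ, ContDiff ℝ ∞ φ → HasCompactSupport φ → (0 : 𝔼) ∉ tsupport φ →
    ∫ x, fderiv ℝ φ x (A x) = -∫ x, F x * φ x

lemma locallyIntegrable_of_memLp {Y : Type*} [NormedAddCommGroup Y] {a : 𝔼 → Y}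
    (ha : ∀ T : Set 𝔼, IsCompact T → MemLp a 2 (volume.restrict T)) :
    LocallyIntegrable a volume := by
  rw [locallyIntegrable_iff]
  intro T hT
  have : IsFiniteMeasure (volume.restrict T) := ⟨by
    rw [Measure.restrict_apply_univ]; exact hT.measure_lt_top⟩
  exact (ha T hT).integrable (by norm_num)

section

variable {Y : Type*} [NormedAddCommGroup Y] [NormedSpace ℝ Y]

lemma integrable_fderiv_mollifier_smul (n : ℕ) {a : 𝔼 → Y} (ha : LocallyIntegrable a volume)
    (x v : 𝔼) : Integrable (fun t => fderiv ℝ (mollifier d n) (x - t) v • a t) := by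
  have hc : HasCompactSupport (fun t => fderiv ℝ (mollifier d n) (x - t) v) :=
    (((hasCompactSupport_mollifier d n).fderiv ℝ).comp_left (g := fun L : 𝔼 →L[ℝ] ℝ => L v)
      (by simp)).comp_homeomorph (Homeomorph.subLeft x)
  have hcont : Continuous (fun t => fderiv ℝ (mollifier d n) (x - t) v) := by
    have := (contDiff_mollifier d n).continuous_fderiv (by simp)
    fun_prop
  exact ha.integrable_smul_left_of_hasCompactSupport hcont hc

lemma fderiv_mollify [CompleteSpace Y] (n : ℕ) {a : 𝔼 → Y} (ha : LocallyIntegrable a volume)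
    (x v : 𝔼) :
    fderiv ℝ (mollify n a) x v = ∫ t, fderiv ℝ (mollifier d n) (x - t) v • a t := by
  have h := ((hasCompactSupport_mollifier d n).hasFDerivAt_convolution_left
    (ContinuousLinearMap.lsmul ℝ ℝ) ((contDiff_mollifier d n).of_le (by simp)) ha x).fderiv
  have hint := ((hasCompactSupport_mollifier d n).fderiv ℝ).convolutionExists_left
    ((ContinuousLinearMap.lsmul ℝ ℝ : ℝ →L[ℝ] Y →L[ℝ] Y).precompL 𝔼)
    ((contDiff_mollifier d n).continuous_fderiv (by simp)) ha x
  rw [mollify, h, convolution_def, ContinuousLinearMap.integral_apply hint,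
    ← integral_sub_left_eq_self _ volume x]
  simp

lemma contDiff_mollify [CompleteSpace Y] (n : ℕ) {a : 𝔼 → Y}
    (ha : LocallyIntegrable a volume) : ContDiff ℝ ∞ (mollify n a) :=
  (hasCompactSupport_mollifier d n).contDiff_convolution_left _ (contDiff_mollifier d n) ha

end

/-- The mollifier centred at `x`, as a test function. -/
lemma fderiv_mollifier_sub (n : ℕ) (x y v : 𝔼) :
    fderiv ℝ (fun t => mollifier d n (x - t)) y v = -fderiv ℝ (mollifier d n) (x - y) v := by
  have h1 : HasFDerivAt (fun t : 𝔼 => x - t) (-ContinuousLinearMap.id ℝ 𝔼) y :=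
    (hasFDerivAt_id y).const_sub x
  have h2 : DifferentiableAt ℝ (mollifier d n) (x - y) :=
    (contDiff_mollifier d n).differentiable (by simp) _
  have := (h2.hasFDerivAt.comp y h1).fderiv
  change fderiv ℝ (mollifier d n ∘ fun t => x - t) y v = _
  rw [this]; simp

lemma contDiff_mollifier_sub (n : ℕ) (x : 𝔼) :
    ContDiff ℝ ∞ (fun t => mollifier d n (x - t)) :=
  (contDiff_mollifier d n).comp (contDiff_const.sub contDiff_id)

lemma hasCompactSupport_mollifier_sub (n : ℕ) (x : 𝔼) :
    HasCompactSupport (fun t => mollifier d n (x - t)) :=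
  (hasCompactSupport_mollifier d n).comp_homeomorph (Homeomorph.subLeft x)

lemma tsupport_mollifier_sub_subset (n : ℕ) (x : 𝔼) :
    tsupport (fun t => mollifier d n (x - t)) ⊆ Metric.closedBall x (1 / ((n : ℝ) + 1)) := by
  refine closure_minimal (fun t ht => ?_) Metric.isClosed_closedBall
  have : x - t ∈ Function.support (mollifier d n) := ht
  rw [support_mollifier, mem_ball_zero_iff] at this
  rw [Metric.mem_closedBall, dist_comm, dist_eq_norm]
  exact this.le

lemma integral_coord {A : 𝔼 → 𝔼} (hA : Integrable A) (i : Fin d) :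
    (∫ x, A x) i = ∫ x, A x i :=
  ((EuclideanSpace.proj (𝕜 := ℝ) i).integral_comp_comm hA).symm

/-- The derivative of the convolution falls on the kernel, and the kernel centred at `x` is a test
function for the weak gradient. -/
lemma HasWeakGradient.fderiv_mollify {a : 𝔼 → ℝ} {A : 𝔼 → 𝔼} (h : HasWeakGradient a A) (n : ℕ)
    (x v : 𝔼) : fderiv ℝ (mollify n a) x v = inner ℝ (mollify n A x) v := by
  have ha := locallyIntegrable_of_memLp h.memLp
  have hA := locallyIntegrable_of_memLp h.memLp_grad
  have key : ∀ i, fderiv ℝ (mollify n a) x (EuclideanSpace.single i 1) = mollify n A x i := by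
    intro i
    have hw := h.weak _ (contDiff_mollifier_sub n x) (hasCompactSupport_mollifier_sub n x) i
    simp only [fderiv_mollifier_sub, mul_neg, integral_neg, neg_inj] at hw
    rw [_root_.fderiv_mollify n ha, mollify_apply_swap, integral_coord]
    · simp only [smul_eq_mul, PiLp.smul_apply]
      simp only [mul_comm (mollifier d n _)]
      rw [← hw]
      simp only [mul_comm]
    · have := (convolutionExistsAt_mollifier n hA x).comp_sub_left x
      simpa using this
  rw [← sum_apply_single_mul (fderiv ℝ (mollify n a) x) v, PiLp.inner_apply]
  exact Finset.sum_congr rfl fun i _ => by rw [key i]; simp [mul_comm]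

/-- Again the kernel centred at `x` is the test function. It must miss the origin, hence the
restriction to `x ∈ S` and to radii at most `r`. The source is cut off because it need not be
locally integrable at the origin. -/
lemma HasWeakDivergence.divergence_mollify {A : 𝔼 → 𝔼} {F : 𝔼 → ℝ} (h : HasWeakDivergence A F)
    (hA : LocallyIntegrable A volume) {S : Set 𝔼} {r : ℝ} (hr : (0 : 𝔼) ∉ Metric.cthickening r S)
    {n : ℕ} (hn : 1 / ((n : ℝ) + 1) ≤ r) {x : 𝔼} (hx : x ∈ S) :
    divergence (mollify n A) x = mollify n ((Metric.cthickening r S).indicator F) x := by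
  have hsub : tsupport (fun t => mollifier d n (x - t)) ⊆ Metric.cthickening r S :=
    (tsupport_mollifier_sub_subset n x).trans ((Metric.closedBall_subset_closedBall hn).trans
      (Metric.closedBall_subset_cthickening hx r))
  have hw := h.weak _ (contDiff_mollifier_sub n x) (hasCompactSupport_mollifier_sub n x)
    (fun h0 => hr (hsub h0))
  simp only [fderiv_mollifier_sub, integral_neg, neg_inj] at hw
  have hint : ∀ v, Integrable (fun t => fderiv ℝ (mollifier d n) (x - t) v • A t) :=
    fun v => integrable_fderiv_mollifier_smul n hA x v
  unfold divergence
  simp only [fderiv_mollify n hA]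
  rw [Finset.sum_congr rfl fun i _ => integral_coord (hint _) i, ← integral_finsetSum]
  · rw [mollify_apply_swap]
    trans ∫ t, fderiv ℝ (mollifier d n) (x - t) (A t)
    · refine integral_congr_ae (Eventually.of_forall fun t => ?_)
      simp only [PiLp.smul_apply, smul_eq_mul]
      exact sum_apply_single_mul _ _
    · rw [hw]
      refine integral_congr_ae (Eventually.of_forall fun t => ?_)
      by_cases ht : t ∈ Metric.cthickening r S
      · simp [indicator_of_mem ht, mul_comm]
      · have : mollifier d n (x - t) = 0 :=
          image_eq_zero_of_notMem_tsupport (f := fun t => mollifier d n (x - t))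
            fun h' => ht (hsub h')
        simp [this]
  · exact fun i _ => (EuclideanSpace.proj (𝕜 := ℝ) i).integrable_comp (hint _)

end WeakDerivatives

/-! ### Multiplier identities for smooth functions. -/

section WeakIdentities

variable {d : ℕ}

local notation "𝔼" => EuclideanSpace ℝ (Fin d)

lemma LocallyLipschitz.ae_differentiableAt {Y : Type*} [NormedAddCommGroup Y] [NormedSpace ℝ Y]
    [FiniteDimensional ℝ Y] {V : 𝔼 → Y} (hV : LocallyLipschitz V) (hc : HasCompactSupport V) :
    ∀ᵐ x, DifferentiableAt ℝ V x := by
  obtain ⟨L, hL⟩ := hV.exists_lipschitzWith_of_hasCompactSupport hc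
  exact hL.ae_differentiableAt

lemma LocallyLipschitz.exists_fderiv_bound {Y : Type*} [NormedAddCommGroup Y] [NormedSpace ℝ Y]
    {V : 𝔼 → Y} (hV : LocallyLipschitz V) (hc : HasCompactSupport V) :
    ∃ M, 0 ≤ M ∧ (∀ x, ‖V x‖ ≤ M) ∧ ∀ x, ‖fderiv ℝ V x‖ ≤ M := by
  obtain ⟨L, hL⟩ := hV.exists_lipschitzWith_of_hasCompactSupport hc
  obtain ⟨M, hM⟩ := hc.exists_bound_of_continuous hV.continuous
  refine ⟨max M L, le_max_of_le_right L.2, fun x => (hM x).trans (le_max_left _ _), fun x => ?_⟩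
  exact (norm_fderiv_le_of_lipschitz ℝ hL).trans (le_max_right _ _)

lemma divergence_of_notMem_tsupport {V : 𝔼 → 𝔼} {x : 𝔼} (hx : x ∉ tsupport V) :
    divergence V x = 0 := by
  simp [divergence, fderiv_of_notMem_tsupport (𝕜 := ℝ) hx]

/-- The divergence of `⟪V, W⟫ W - ½ |W|² V` for a field `W` with symmetric derivative. -/
lemma integral_stress_eq_zero {V W : 𝔼 → 𝔼} (hV : LocallyLipschitz V) (hc : HasCompactSupport V)
    (hW : ContDiff ℝ 1 W)
    (hsymm : ∀ x y z, (inner ℝ (fderiv ℝ W x y) z : ℝ) = inner ℝ (fderiv ℝ W x z) y) :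
    ∫ x, (divergence W x * inner ℝ (V x) (W x) + inner ℝ (fderiv ℝ V x (W x)) (W x)
      - 1 / 2 * divergence V x * inner ℝ (W x) (W x)) = 0 := by
  have hWl := hW.locallyLipschitz
  set X1 : 𝔼 → 𝔼 := fun x => (inner ℝ (V x) (W x) : ℝ) • W x with hX1
  set X2 : 𝔼 → 𝔼 := fun x => (1 / 2 * inner ℝ (W x) (W x) : ℝ) • V x with hX2
  have l1 : LocallyLipschitz X1 := (hV.inner_fun hWl).smul_fun hWl
  have l2 : LocallyLipschitz X2 :=
    ((LocallyLipschitz.const (1 / 2 : ℝ)).mul_fun (hWl.inner_fun hWl)).smul_fun hV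
  have c1 : HasCompactSupport X1 := by
    refine hc.mono fun x hx => ?_
    contrapose! hx
    simp [hX1, Function.notMem_support.1 hx]
  have c2 : HasCompactSupport X2 := by
    refine hc.mono fun x hx => ?_
    contrapose! hx
    simp [hX2, Function.notMem_support.1 hx]
  have lX : LocallyLipschitz (fun x => X1 x - X2 x) := l1.sub_fun l2
  rw [← integral_divergence_eq_zero lX (c1.sub c2)]
  refine integral_congr_ae ?_
  filter_upwards [hV.ae_differentiableAt hc] with x hVx
  have hWx : DifferentiableAt ℝ W x := hW.differentiable one_ne_zero x
  have d1 : DifferentiableAt ℝ (fun y => (inner ℝ (V y) (W y) : ℝ)) x := hVx.inner ℝ hWx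
  have d2 : DifferentiableAt ℝ (fun y => (1 / 2 * inner ℝ (W y) (W y) : ℝ)) x :=
    (hWx.inner ℝ hWx).const_mul _
  have e1 : DifferentiableAt ℝ X1 x := d1.fun_smul hWx
  have e2 : DifferentiableAt ℝ X2 x := d2.fun_smul hVx
  rw [divergence_sub e1 e2, hX1, hX2, divergence_smul d1 hWx,
    divergence_smul d2 hVx, fderiv_const_mul (hWx.inner ℝ hWx)]
  simp only [smul_apply, smul_eq_mul]
  -- Symmetry cancels `⟪V, DW W⟫` from the first field against `⟪DW V, W⟫` from the second, so
  -- derivatives of `W` survive only through its divergence.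
  rw [fderiv_inner_apply ℝ hVx hWx, fderiv_inner_apply ℝ hWx hWx,
    hsymm x (V x) (W x), real_inner_comm (fderiv ℝ W x (W x)) (V x),
    real_inner_comm (fderiv ℝ W x (V x)) (W x), hsymm x (V x) (W x)]
  ring

/-- The integrand is the divergence of `(w b) W`. The gradient `Wb` of `b` may differ from `W`,
because later the real part of `u` is tested against the imaginary part. -/
lemma integral_greens_eq_zero {w b : 𝔼 → ℝ} {W Wb : 𝔼 → 𝔼} (hw : LocallyLipschitz w)
    (hc : HasCompactSupport w) (hb : ContDiff ℝ 1 b) (hW : ContDiff ℝ 1 W)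
    (hWb : ∀ x v, fderiv ℝ b x v = inner ℝ (Wb x) v) :
    ∫ x, (w x * divergence W x * b x + w x * inner ℝ (W x) (Wb x)
      + fderiv ℝ w x (W x) * b x) = 0 := by
  have lX : LocallyLipschitz (fun x => (w x * b x) • W x) :=
    (hw.mul_fun hb.locallyLipschitz).smul_fun hW.locallyLipschitz
  have cX : HasCompactSupport (fun x => (w x * b x) • W x) := by
    refine hc.mono fun x hx => ?_
    contrapose! hx
    simp [Function.notMem_support.1 hx]
  rw [← integral_divergence_eq_zero lX cX]
  refine integral_congr_ae ?_
  filter_upwards [hw.ae_differentiableAt hc] with x hwx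
  have hWx : DifferentiableAt ℝ W x := hW.differentiable one_ne_zero x
  have hbx : DifferentiableAt ℝ b x := hb.differentiable one_ne_zero x
  rw [divergence_smul (hwx.fun_mul hbx) hWx, fderiv_fun_mul hwx hbx]
  simp only [add_apply, smul_apply, smul_eq_mul, hWb,
    real_inner_comm (W x) (Wb x)]
  ring

lemma integral_flux_eq_zero {a : 𝔼 → ℝ} {V W : 𝔼 → 𝔼} (hV : LocallyLipschitz V)
    (hc : HasCompactSupport V) (ha : ContDiff ℝ 1 a)
    (hW : ∀ x v, fderiv ℝ a x v = inner ℝ (W x) v) :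
    ∫ x, (2 * a x * inner ℝ (V x) (W x) + divergence V x * a x * a x) = 0 := by
  have hl := ha.locallyLipschitz
  have cX : HasCompactSupport (fun x => (a x * a x) • V x) := by
    refine hc.mono fun x hx => ?_
    contrapose! hx
    simp [Function.notMem_support.1 hx]
  rw [← integral_divergence_eq_zero ((hl.mul_fun hl).smul_fun hV) cX]
  refine integral_congr_ae ?_
  filter_upwards [hV.ae_differentiableAt hc] with x hVx
  have hax : DifferentiableAt ℝ a x := ha.differentiable one_ne_zero x
  rw [divergence_smul (hax.fun_mul hax) hVx, fderiv_fun_mul hax hax]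
  simp only [add_apply, smul_apply, smul_eq_mul, hW,
    real_inner_comm (W x) (V x)]
  ring

/-- Passage to the limit in integrals of quadratic expressions in mollified functions. -/
lemma integral_bilin_eq_zero_of_mollify {Y : Type*} [NormedAddCommGroup Y] [NormedSpace ℝ Y]
    [CompleteSpace Y] {U1 U2 : 𝔼 → Y}
    (h1 : ∀ T : Set 𝔼, IsCompact T → MemLp U1 2 (volume.restrict T))
    (h2 : ∀ T : Set 𝔼, IsCompact T → MemLp U2 2 (volume.restrict T))
    {S : Set 𝔼} (hS : IsCompact S) {L : 𝔼 → Y → Y → ℝ} {C : ℝ}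
    (hL : IsBoundedBilinFamily (volume.restrict S) L C) (hL0 : ∀ x ∉ S, ∀ y z, L x y z = 0)
    (hz : ∀ᶠ n in atTop, ∫ x, L x (mollify n U1 x) (mollify n U2 x) = 0) :
    Integrable (fun x => L x (U1 x) (U2 x)) ∧ ∫ x, L x (U1 x) (U2 x) = 0 := by
  have hset : ∀ V1 V2 : 𝔼 → Y, ∫ x in S, L x (V1 x) (V2 x) = ∫ x, L x (V1 x) (V2 x) :=
    fun V1 V2 => setIntegral_eq_integral_of_forall_compl_eq_zero fun x hx => hL0 x hx _ _
  have hfin : IsFiniteMeasure (volume.restrict S) := ⟨by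
    rw [Measure.restrict_apply_univ]; exact hS.measure_lt_top⟩
  have hcont : ∀ {U : 𝔼 → Y}, (∀ T : Set 𝔼, IsCompact T → MemLp U 2 (volume.restrict T)) →
      ∀ n, MemLp (mollify n U) 2 (volume.restrict S) := by
    intro U hU n
    have hc := continuous_mollify n (locallyIntegrable_of_memLp hU)
    obtain ⟨M, hM⟩ := hS.exists_bound_of_continuousOn hc.continuousOn
    refine MemLp.of_bound hc.aestronglyMeasurable M ?_
    exact (ae_restrict_iff' hS.measurableSet).2 (Eventually.of_forall hM)
  have hlim := hL.tendsto_integral (hcont h1) (h1 S hS) (hcont h2) (h2 S hS)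
    (tendsto_eLpNorm_mollify_sub_restrict hS h1) (tendsto_eLpNorm_mollify_sub_restrict hS h2)
  simp only [hset] at hlim
  refine ⟨?_, ?_⟩
  · have := hL.integrable (h1 S hS) (h2 S hS)
    exact IntegrableOn.integrable_of_forall_notMem_eq_zero this fun x hx => hL0 x hx _ _
  · exact tendsto_nhds_unique hlim
      (tendsto_const_nhds.congr' (hz.mono fun n hn => hn.symm))

lemma mollify_prod {Y Z : Type*} [NormedAddCommGroup Y] [NormedSpace ℝ Y] [CompleteSpace Y]
    [NormedAddCommGroup Z] [NormedSpace ℝ Z] [CompleteSpace Z] (n : ℕ) {a : 𝔼 → Y} {b : 𝔼 → Z}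
    (ha : LocallyIntegrable a volume) (hb : LocallyIntegrable b volume) (x : 𝔼) :
    mollify n (fun x => (a x, b x)) x = (mollify n a x, mollify n b x) := by
  simp only [mollify_apply, Prod.smul_mk]
  exact integral_pair (convolutionExistsAt_mollifier n ha x) (convolutionExistsAt_mollifier n hb x)

/-- The mollified weak gradient is the gradient of a smooth function, so its derivative is a
Hessian. This supplies the symmetry required by `integral_stress_eq_zero`. -/
lemma HasWeakGradient.fderiv_mollify_symm {a : 𝔼 → ℝ} {A : 𝔼 → 𝔼} (h : HasWeakGradient a A)
    (n : ℕ) (x y z : 𝔼) : (inner ℝ (fderiv ℝ (mollify n A) x y) z : ℝ)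
      = inner ℝ (fderiv ℝ (mollify n A) x z) y := by
  have ha := contDiff_mollify n (locallyIntegrable_of_memLp h.memLp)
  have hA : Differentiable ℝ (mollify n A) :=
    (contDiff_mollify n (locallyIntegrable_of_memLp h.memLp_grad)).differentiable (by simp)
  have hfd : fderiv ℝ (mollify n a) = fun x => innerSL ℝ (mollify n A x) := by
    ext x v; rw [h.fderiv_mollify n x v]; rfl
  have hs : IsSymmSndFDerivAt ℝ (mollify n a) x :=
    
    (contDiff_infty.1 ha 2).contDiffAt.isSymmSndFDerivAt (by simp)
  have key : ∀ y z, fderiv ℝ (fderiv ℝ (mollify n a)) x y z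
      = inner ℝ (fderiv ℝ (mollify n A) x y) z := by
    intro y z
    rw [hfd]
    have := ((innerSL ℝ (E := 𝔼)).hasFDerivAt.comp x (hA x).hasFDerivAt).fderiv
    change fderiv ℝ ((innerSL ℝ) ∘ (mollify n A)) x y z = _
    rw [this]; rfl
  rw [← key, ← key]
  exact hs y z

/-- A compact set missing the origin has a compact thickening missing it. -/
lemma exists_cthickening_notMem {S : Set 𝔼} (hS : IsCompact S) (h0 : (0 : 𝔼) ∉ S) :
    ∃ r : ℝ, 0 < r ∧ (0 : 𝔼) ∉ Metric.cthickening r S := by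
  obtain ⟨r, hr, h⟩ := hS.exists_cthickening_subset_open (isOpen_compl_singleton (x := (0 : 𝔼)))
    (fun x hx => by rintro rfl; exact h0 hx)
  exact ⟨r, hr, fun h' => h h' rfl⟩

lemma HasWeakDivergence.memLp_indicator {A : 𝔼 → 𝔼} {F : 𝔼 → ℝ} (h : HasWeakDivergence A F)
    {S : Set 𝔼} (hS : IsCompact S) {r : ℝ} (hr : (0 : 𝔼) ∉ Metric.cthickening r S) :
    ∀ T : Set 𝔼, IsCompact T →
      MemLp ((Metric.cthickening r S).indicator F) 2 (volume.restrict T) := fun _ _ =>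
  ((memLp_indicator_iff_restrict hS.cthickening.measurableSet).2
    (h.memLp _ hS.cthickening hr)).restrict _

end WeakIdentities

/-! ### The multiplier identities for weakly differentiable functions. -/

section WeakIdentitiesLimit

variable {d : ℕ}

local notation "𝔼" => EuclideanSpace ℝ (Fin d)

lemma aestronglyMeasurable_fderiv_apply {Y : Type*} [NormedAddCommGroup Y] [NormedSpace ℝ Y]
    [FiniteDimensional ℝ Y] (V : 𝔼 → Y) {ν : Measure 𝔼} {y : 𝔼 → 𝔼}
    (hy : AEStronglyMeasurable y ν) : AEStronglyMeasurable (fun x => fderiv ℝ V x (y x)) ν := by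
  have : ProperSpace Y := FiniteDimensional.proper ℝ Y
  exact (isBoundedBilinearMap_apply (𝕜 := ℝ) (E := 𝔼) (F := Y)).continuous.comp_aestronglyMeasurable
    ((measurable_fderiv ℝ V).aestronglyMeasurable.prodMk hy)

lemma memLp_pair {Y Z : Type*} [NormedAddCommGroup Y] [NormedAddCommGroup Z] {ν : Measure 𝔼}
    {y : 𝔼 → Y} {z : 𝔼 → Z} (hy : MemLp y 2 ν) (hz : MemLp z 2 ν) :
    MemLp (fun x => (y x, z x)) 2 ν := by
  refine (hy.norm.add hz.norm).mono (hy.1.prodMk hz.1) (Eventually.of_forall fun x => ?_)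
  rw [Pi.add_apply, Real.norm_of_nonneg (by positivity), Prod.norm_mk]
  exact max_le (by linarith [norm_nonneg (z x)]) (by linarith [norm_nonneg (y x)])

lemma eventually_mollifier_radius_le {r : ℝ} (hr : 0 < r) :
    ∀ᶠ n : ℕ in atTop, 1 / ((n : ℝ) + 1) ≤ r :=
  tendsto_one_div_add_atTop_nhds_zero_nat.eventually_le_const hr

/-- The identity for the multiplier `V · ∇a`, where `div (∇a) = F`. -/
theorem HasWeakGradient.stress_identity {a F : 𝔼 → ℝ} {A V : 𝔼 → 𝔼} (h : HasWeakGradient a A)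
    (hF : HasWeakDivergence A F) (hV : LocallyLipschitz V) (hc : HasCompactSupport V)
    (h0 : (0 : 𝔼) ∉ tsupport V) :
    Integrable (fun x => F x * inner ℝ (V x) (A x) + inner ℝ (fderiv ℝ V x (A x)) (A x)
      - 1 / 2 * divergence V x * inner ℝ (A x) (A x)) ∧
    ∫ x, (F x * inner ℝ (V x) (A x) + inner ℝ (fderiv ℝ V x (A x)) (A x)
      - 1 / 2 * divergence V x * inner ℝ (A x) (A x)) = 0 := by
  set S := tsupport V
  have hS : IsCompact S := hc.isCompact
  obtain ⟨r, hr, hr0⟩ := exists_cthickening_notMem hS h0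
  set F' := (Metric.cthickening r S).indicator F with hF'
  have hF'L := hF.memLp_indicator hS hr0
  have hAl := locallyIntegrable_of_memLp h.memLp_grad
  have hF'l := locallyIntegrable_of_memLp hF'L
  obtain ⟨M, hM0, hM, hDM⟩ := hV.exists_fderiv_bound hc
  -- Gradient and source are mollified as one field, so the whole identity is a single bounded
  -- bilinear form evaluated at `(U, U)`. Replacing `F` by `F'` changes nothing on the support of
  -- `V`.
  set U : 𝔼 → 𝔼 × ℝ := fun x => (A x, F' x) with hU
  have hUL : ∀ T : Set 𝔼, IsCompact T → MemLp U 2 (volume.restrict T) := fun T hT =>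
    memLp_pair (h.memLp_grad T hT) (hF'L T hT)
  set L : 𝔼 → 𝔼 × ℝ → 𝔼 × ℝ → ℝ := fun x j k =>
    j.2 * inner ℝ (V x) k.1 + inner ℝ (fderiv ℝ V x j.1) k.1
      - 1 / 2 * divergence V x * inner ℝ j.1 k.1 with hLdef
  have hL : IsBoundedBilinFamily (volume.restrict S) L (M + M + d * M) := by
    refine ⟨fun x y y' z => ?_, fun x y z z' => ?_, fun x y z => ?_, fun y z hy hz => ?_⟩
    · simp only [hLdef, Prod.fst_sub, Prod.snd_sub, map_sub, inner_sub_left]; ring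
    · simp only [hLdef, Prod.fst_sub, inner_sub_right]; ring
    · have hy1 := norm_fst_le y
      have hy2 := norm_snd_le y
      have hz1 := norm_fst_le z
      have i1 : |y.2 * inner ℝ (V x) z.1| ≤ M * ‖y‖ * ‖z‖ := by
        rw [abs_mul]
        calc |y.2| * |(inner ℝ (V x) z.1 : ℝ)| ≤ ‖y‖ * (M * ‖z‖) := by
              gcongr
              · exact hy2
              · exact (abs_real_inner_le_norm _ _).trans (by gcongr; exact hM x)
          _ = _ := by ring
      have i2 : |(inner ℝ (fderiv ℝ V x y.1) z.1 : ℝ)| ≤ M * ‖y‖ * ‖z‖ := by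
        refine (abs_real_inner_le_norm _ _).trans ?_
        gcongr
        exact ((fderiv ℝ V x).le_opNorm _).trans (by gcongr; exact hDM x)
      have i3 : |1 / 2 * divergence V x * inner ℝ y.1 z.1| ≤ d * M * ‖y‖ * ‖z‖ := by
        rw [abs_mul, abs_mul]
        have hd : |divergence V x| ≤ d * M :=
          (abs_divergence_le V x).trans (by gcongr; exact hDM x)
        calc |(1 / 2 : ℝ)| * |divergence V x| * |(inner ℝ y.1 z.1 : ℝ)|
            ≤ 1 * (d * M) * (‖y‖ * ‖z‖) := by
              gcongr
              · norm_num
              · exact (abs_real_inner_le_norm _ _).trans (by gcongr)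
          _ = _ := by ring
      have j1 := abs_sub (y.2 * inner ℝ (V x) z.1 + inner ℝ (fderiv ℝ V x y.1) z.1)
        (1 / 2 * divergence V x * inner ℝ y.1 z.1)
      have j2 := abs_add_le (y.2 * inner ℝ (V x) z.1) (inner ℝ (fderiv ℝ V x y.1) z.1)
      simp only [hLdef]
      linarith
    · have hVm : AEStronglyMeasurable V (volume.restrict S) := hV.continuous.aestronglyMeasurable
      have hdm : AEStronglyMeasurable (divergence V) (volume.restrict S) :=
        (measurable_divergence V).aestronglyMeasurable
      have hfm := aestronglyMeasurable_fderiv_apply V hy.fst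
      exact ((hy.snd.mul (hVm.inner hz.fst)).add (hfm.inner hz.fst)).sub
        ((hdm.const_mul _).mul (hy.fst.inner hz.fst))
  have hL0 : ∀ x ∉ S, ∀ y z, L x y z = 0 := by
    intro x hx y z
    simp only [hLdef, divergence_of_notMem_tsupport hx, fderiv_of_notMem_tsupport (𝕜 := ℝ) hx,
      image_eq_zero_of_notMem_tsupport hx]
    simp
  have key := integral_bilin_eq_zero_of_mollify hUL hUL hS hL hL0 ?_
  · have hFF : (fun x => L x (U x) (U x)) = fun x => F x * inner ℝ (V x) (A x)
        + inner ℝ (fderiv ℝ V x (A x)) (A x)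
        - 1 / 2 * divergence V x * inner ℝ (A x) (A x) := by
      ext x
      by_cases hx : x ∈ S
      · simp only [hLdef, hU, hF', indicator_of_mem (Metric.self_subset_cthickening S hx)]
      · rw [hL0 x hx]
        simp [divergence_of_notMem_tsupport hx, fderiv_of_notMem_tsupport (𝕜 := ℝ) hx,
          image_eq_zero_of_notMem_tsupport hx]
    rwa [hFF] at key
  · filter_upwards [eventually_mollifier_radius_le hr] with n hn
    rw [← integral_stress_eq_zero hV hc ((contDiff_mollify n hAl).of_le (by simp))
      (h.fderiv_mollify_symm n)]
    refine integral_congr_ae (Eventually.of_forall fun x => ?_)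
    by_cases hx : x ∈ S
    · simp only [hLdef, hU, mollify_prod n hAl hF'l, hF.divergence_mollify hAl hr0 hn hx, hF']
    · simp only [hL0 x hx]
      simp [divergence_of_notMem_tsupport hx, fderiv_of_notMem_tsupport (𝕜 := ℝ) hx,
        image_eq_zero_of_notMem_tsupport hx]

/-- Green's identity for the multiplier `w b`, where `div (∇a) = F`. -/
theorem HasWeakGradient.greens_identity {a b F w : 𝔼 → ℝ} {A B : 𝔼 → 𝔼}
    (h : HasWeakGradient a A) (hb : HasWeakGradient b B) (hF : HasWeakDivergence A F)
    (hw : LocallyLipschitz w) (hc : HasCompactSupport w) (h0 : (0 : 𝔼) ∉ tsupport w) :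
    Integrable (fun x => w x * F x * b x + w x * inner ℝ (A x) (B x) + fderiv ℝ w x (A x) * b x) ∧
    ∫ x, (w x * F x * b x + w x * inner ℝ (A x) (B x) + fderiv ℝ w x (A x) * b x) = 0 := by
  set S := tsupport w
  have hS : IsCompact S := hc.isCompact
  obtain ⟨r, hr, hr0⟩ := exists_cthickening_notMem hS h0
  set F' := (Metric.cthickening r S).indicator F with hF'
  have hF'L := hF.memLp_indicator hS hr0
  have hAl := locallyIntegrable_of_memLp h.memLp_grad
  have hBl := locallyIntegrable_of_memLp hb.memLp_grad
  have hbl := locallyIntegrable_of_memLp hb.memLp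
  have hF'l := locallyIntegrable_of_memLp hF'L
  obtain ⟨M, hM0, hM, hDM⟩ := hw.exists_fderiv_bound hc
  set U1 : 𝔼 → 𝔼 × ℝ := fun x => (A x, F' x) with hU1
  set U2 : 𝔼 → 𝔼 × ℝ := fun x => (B x, b x) with hU2
  have hUL1 : ∀ T : Set 𝔼, IsCompact T → MemLp U1 2 (volume.restrict T) := fun T hT =>
    memLp_pair (h.memLp_grad T hT) (hF'L T hT)
  have hUL2 : ∀ T : Set 𝔼, IsCompact T → MemLp U2 2 (volume.restrict T) := fun T hT =>
    memLp_pair (hb.memLp_grad T hT) (hb.memLp T hT)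
  set L : 𝔼 → 𝔼 × ℝ → 𝔼 × ℝ → ℝ := fun x j k =>
    w x * j.2 * k.2 + w x * inner ℝ j.1 k.1 + fderiv ℝ w x j.1 * k.2 with hLdef
  have hL : IsBoundedBilinFamily (volume.restrict S) L (M + M + M) := by
    refine ⟨fun x y y' z => ?_, fun x y z z' => ?_, fun x y z => ?_, fun y z hy hz => ?_⟩
    · simp only [hLdef, Prod.fst_sub, Prod.snd_sub, map_sub, inner_sub_left]; ring
    · simp only [hLdef, Prod.fst_sub, Prod.snd_sub, inner_sub_right]; ring
    · have hy1 := norm_fst_le y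
      have hy2 : |y.2| ≤ ‖y‖ := norm_snd_le y
      have hz1 := norm_fst_le z
      have hz2 : |z.2| ≤ ‖z‖ := norm_snd_le z
      have hMx : |w x| ≤ M := hM x
      have i1 : |w x * y.2 * z.2| ≤ M * ‖y‖ * ‖z‖ := by
        rw [abs_mul, abs_mul]; gcongr
      have i2 : |w x * inner ℝ y.1 z.1| ≤ M * ‖y‖ * ‖z‖ := by
        rw [abs_mul, mul_assoc]
        gcongr
        exact (abs_real_inner_le_norm _ _).trans (by gcongr)
      have i3 : |fderiv ℝ w x y.1 * z.2| ≤ M * ‖y‖ * ‖z‖ := by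
        rw [abs_mul]
        gcongr
        exact ((fderiv ℝ w x).le_opNorm _).trans (by gcongr; exact hDM x)
      have j1 := abs_add_le (w x * y.2 * z.2 + w x * inner ℝ y.1 z.1) (fderiv ℝ w x y.1 * z.2)
      have j2 := abs_add_le (w x * y.2 * z.2) (w x * inner ℝ y.1 z.1)
      simp only [hLdef]
      linarith
    · have hwm : AEStronglyMeasurable w (volume.restrict S) := hw.continuous.aestronglyMeasurable
      have hfm := aestronglyMeasurable_fderiv_apply w hy.fst
      exact (((hwm.mul hy.snd).mul hz.snd).add (hwm.mul (hy.fst.inner hz.fst))).add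
        (hfm.mul hz.snd)
  have hL0 : ∀ x ∉ S, ∀ y z, L x y z = 0 := by
    intro x hx y z
    simp only [hLdef, fderiv_of_notMem_tsupport (𝕜 := ℝ) hx, image_eq_zero_of_notMem_tsupport hx]
    simp
  have key := integral_bilin_eq_zero_of_mollify hUL1 hUL2 hS hL hL0 ?_
  · have hFF : (fun x => L x (U1 x) (U2 x)) = fun x => w x * F x * b x
        + w x * inner ℝ (A x) (B x) + fderiv ℝ w x (A x) * b x := by
      ext x
      by_cases hx : x ∈ S
      · simp only [hLdef, hU1, hU2, hF', indicator_of_mem (Metric.self_subset_cthickening S hx)]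
      · rw [hL0 x hx]
        simp [fderiv_of_notMem_tsupport (𝕜 := ℝ) hx, image_eq_zero_of_notMem_tsupport hx]
    rwa [hFF] at key
  · filter_upwards [eventually_mollifier_radius_le hr] with n hn
    rw [← integral_greens_eq_zero hw hc ((contDiff_mollify n hbl).of_le (by simp))
      ((contDiff_mollify n hAl).of_le (by simp)) (hb.fderiv_mollify n)]
    refine integral_congr_ae (Eventually.of_forall fun x => ?_)
    by_cases hx : x ∈ S
    · simp only [hLdef, hU1, hU2, mollify_prod n hAl hF'l, mollify_prod n hBl hbl,
        hF.divergence_mollify hAl hr0 hn hx, hF']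
    · simp only [hL0 x hx]
      simp [fderiv_of_notMem_tsupport (𝕜 := ℝ) hx, image_eq_zero_of_notMem_tsupport hx]

/-- Integration by parts for `V · ∇(a²)`. -/
theorem HasWeakGradient.flux_identity {a : 𝔼 → ℝ} {A V : 𝔼 → 𝔼} (h : HasWeakGradient a A)
    (hV : LocallyLipschitz V) (hc : HasCompactSupport V) :
    Integrable (fun x => 2 * a x * inner ℝ (V x) (A x) + divergence V x * a x * a x) ∧
    ∫ x, (2 * a x * inner ℝ (V x) (A x) + divergence V x * a x * a x) = 0 := by
  set S := tsupport V
  have hS : IsCompact S := hc.isCompact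
  have hAl := locallyIntegrable_of_memLp h.memLp_grad
  have hal := locallyIntegrable_of_memLp h.memLp
  obtain ⟨M, hM0, hM, hDM⟩ := hV.exists_fderiv_bound hc
  set U : 𝔼 → 𝔼 × ℝ := fun x => (A x, a x) with hU
  have hUL : ∀ T : Set 𝔼, IsCompact T → MemLp U 2 (volume.restrict T) := fun T hT =>
    memLp_pair (h.memLp_grad T hT) (h.memLp T hT)
  set L : 𝔼 → 𝔼 × ℝ → 𝔼 × ℝ → ℝ := fun x j k =>
    2 * j.2 * inner ℝ (V x) k.1 + divergence V x * j.2 * k.2 with hLdef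
  have hL : IsBoundedBilinFamily (volume.restrict S) L (2 * M + d * M) := by
    refine ⟨fun x y y' z => ?_, fun x y z z' => ?_, fun x y z => ?_, fun y z hy hz => ?_⟩
    · simp only [hLdef, Prod.snd_sub]; ring
    · simp only [hLdef, Prod.fst_sub, Prod.snd_sub, inner_sub_right]; ring
    · have hy2 : |y.2| ≤ ‖y‖ := norm_snd_le y
      have hz1 := norm_fst_le z
      have hz2 : |z.2| ≤ ‖z‖ := norm_snd_le z
      have i1 : |2 * y.2 * inner ℝ (V x) z.1| ≤ 2 * M * ‖y‖ * ‖z‖ := by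
        rw [abs_mul, abs_mul, abs_two]
        calc 2 * |y.2| * |(inner ℝ (V x) z.1 : ℝ)| ≤ 2 * ‖y‖ * (M * ‖z‖) := by
              gcongr
              exact (abs_real_inner_le_norm _ _).trans (by gcongr; exact hM x)
          _ = _ := by ring
      have i2 : |divergence V x * y.2 * z.2| ≤ d * M * ‖y‖ * ‖z‖ := by
        rw [abs_mul, abs_mul]
        gcongr
        exact (abs_divergence_le V x).trans (by gcongr; exact hDM x)
      have j := abs_add_le (2 * y.2 * inner ℝ (V x) z.1) (divergence V x * y.2 * z.2)
      simp only [hLdef]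
      linarith
    · have hVm : AEStronglyMeasurable V (volume.restrict S) := hV.continuous.aestronglyMeasurable
      have hdm : AEStronglyMeasurable (divergence V) (volume.restrict S) :=
        (measurable_divergence V).aestronglyMeasurable
      exact ((hy.snd.const_mul _).mul (hVm.inner hz.fst)).add ((hdm.mul hy.snd).mul hz.snd)
  have hL0 : ∀ x ∉ S, ∀ y z, L x y z = 0 := by
    intro x hx y z
    simp only [hLdef, divergence_of_notMem_tsupport hx, image_eq_zero_of_notMem_tsupport hx]
    simp
  refine integral_bilin_eq_zero_of_mollify hUL hUL hS hL hL0 (Eventually.of_forall fun n => ?_)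
  simp only [hLdef, hU, mollify_prod n hAl hal]
  exact integral_flux_eq_zero hV hc ((contDiff_mollify n hal).of_le (by simp))
    (h.fderiv_mollify n)

end WeakIdentitiesLimit

/-! ### Hardy's inequality near the origin. -/

section Hardy

/-- A consequence of Fatou's lemma. -/
lemma integrable_of_tendsto_of_integral_le {α : Type*} [MeasurableSpace α] {ν : Measure α}
    {g : ℕ → α → ℝ} {f : α → ℝ} {C : ℝ} (hg : ∀ n, Integrable (g n) ν)
    (h0 : ∀ n x, 0 ≤ g n x) (hC : ∀ n, ∫ x, g n x ∂ν ≤ C)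
    (hlim : ∀ᵐ x ∂ν, Tendsto (fun n => g n x) atTop (𝓝 (f x))) : Integrable f ν := by
  refine ⟨aestronglyMeasurable_of_tendsto_ae atTop (fun n => (hg n).1) hlim, ?_⟩
  rw [hasFiniteIntegral_iff_enorm]
  have h1 : ∫⁻ x, ‖f x‖ₑ ∂ν ≤ ∫⁻ x, liminf (fun n => ‖g n x‖ₑ) atTop ∂ν := by
    refine lintegral_mono_ae ?_
    filter_upwards [hlim] with x hx
    exact (hx.enorm.liminf_eq).ge
  have h2 : ∫⁻ x, liminf (fun n => ‖g n x‖ₑ) atTop ∂ν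
      ≤ liminf (fun n => ∫⁻ x, ‖g n x‖ₑ ∂ν) atTop :=
    lintegral_liminf_le' fun n => (hg n).1.enorm
  have h3 : ∀ n, ∫⁻ x, ‖g n x‖ₑ ∂ν ≤ ENNReal.ofReal C := by
    intro n
    have : ∫⁻ x, ‖g n x‖ₑ ∂ν = ENNReal.ofReal (∫ x, g n x ∂ν) := by
      rw [ofReal_integral_eq_lintegral_ofReal (hg n) (Eventually.of_forall (h0 n))]
      exact lintegral_congr fun x => Real.enorm_of_nonneg (h0 n x)
    rw [this]
    exact ENNReal.ofReal_le_ofReal (hC n)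
  have h4 : liminf (fun n => ∫⁻ x, ‖g n x‖ₑ ∂ν) atTop ≤ ENNReal.ofReal C :=
    liminf_le_of_le (h := fun b hb => by
      obtain ⟨n, hn⟩ := hb.exists
      exact hn.trans (h3 n))
  exact ((h1.trans h2).trans h4).trans_lt ENNReal.ofReal_lt_top

variable {d : ℕ}

local notation "𝔼" => EuclideanSpace ℝ (Fin d)

lemma divergence_id (x : 𝔼) : divergence (fun y : 𝔼 => y) x = d := by
  simp [divergence]

lemma integrableOn_sq {Y : Type*} [NormedAddCommGroup Y] {a : 𝔼 → Y} {T : Set 𝔼}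
    (h : MemLp a 2 (volume.restrict T)) : IntegrableOn (fun x => ‖a x‖ ^ 2) T := by
  have := h.integrable_norm_rpow (by norm_num) (by norm_num)
  change Integrable _ _
  simpa using this

/-- A smooth cutoff, equal to one on the unit ball and supported in the ball of radius two. -/
noncomputable def unitCutoff (d : ℕ) : ContDiffBump (0 : EuclideanSpace ℝ (Fin d)) where
  rIn := 1
  rOut := 2
  rIn_pos := one_pos
  rIn_lt_rOut := one_lt_two

lemma exists_fderiv_unitCutoff_bound (d : ℕ) : ∃ M : ℝ, 0 ≤ M ∧
    ∀ x v, |fderiv ℝ (unitCutoff d) x v| ≤ M * ‖v‖ := by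
  have hs : ContDiff ℝ 1 (unitCutoff d) := (unitCutoff d).contDiff
  obtain ⟨M, hM0, -, hM⟩ :=
    hs.locallyLipschitz.exists_fderiv_bound (unitCutoff d).hasCompactSupport
  exact ⟨M, hM0, fun x v => ((fderiv ℝ (unitCutoff d) x).le_opNorm v).trans (by gcongr; exact hM x)⟩

lemma fderiv_unitCutoff_of_lt {x : 𝔼} (hx : ‖x‖ < 1) : fderiv ℝ (unitCutoff d) x = 0 := by
  have : (unitCutoff d : 𝔼 → ℝ) =ᶠ[𝓝 x] fun _ => 1 := by
    filter_upwards [Metric.isOpen_ball.mem_nhds (mem_ball_zero_iff.2 hx)] with y hy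
    exact (unitCutoff d).one_of_mem_closedBall (Metric.ball_subset_closedBall hy)
  rw [this.fderiv_eq]; simp

lemma fderiv_unitCutoff_of_gt {x : 𝔼} (hx : 2 < ‖x‖) : fderiv ℝ (unitCutoff d) x = 0 := by
  refine fderiv_of_notMem_tsupport (𝕜 := ℝ) fun h => ?_
  rw [(unitCutoff d).tsupport_eq, mem_closedBall_zero_iff] at h
  exact absurd h (not_le.2 hx)

/-- Hardy's inequality, in local form. -/
theorem HasWeakGradient.integrableOn_hardy (hd : 3 ≤ d) {a : 𝔼 → ℝ} {A : 𝔼 → 𝔼}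
    (h : HasWeakGradient a A) :
    IntegrableOn (fun x => a x ^ 2 / ‖x‖ ^ 2) (Metric.closedBall 0 1) := by
  obtain ⟨M, hM0, hM⟩ := exists_fderiv_unitCutoff_bound d
  set χ := unitCutoff d with hχ
  set B2 : Set 𝔼 := Metric.closedBall 0 2 with hB2
  have hB2c : IsCompact B2 := isCompact_closedBall _ _
  set R : 𝔼 → ℝ := B2.indicator (fun x => 2 * ‖A x‖ ^ 2 + M * ‖a x‖ ^ 2) with hR
  have hRint : Integrable R := by
    rw [hR, integrable_indicator_iff hB2c.measurableSet]
    exact ((integrableOn_sq (h.memLp_grad _ hB2c)).const_mul 2).add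
      ((integrableOn_sq (h.memLp _ hB2c)).const_mul M)
  have key : ∀ η : ℝ, 0 < η →
      IntegrableOn (fun x => a x ^ 2 / (‖x‖ ^ 2 + η)) (Metric.closedBall 0 1) ∧
      ∫ x in Metric.closedBall (0 : 𝔼) 1, a x ^ 2 / (‖x‖ ^ 2 + η) ≤ 2 * ∫ x, R x := by
    intro η hη
    have hs : ∀ x : 𝔼, 0 < ‖x‖ ^ 2 + η := fun x => by positivity
    have hsd : ContDiff ℝ ∞ (fun x : 𝔼 => ‖x‖ ^ 2 + η) := (contDiff_norm_sq ℝ).add contDiff_const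
    have hcd : ContDiff ℝ ∞ (fun x : 𝔼 => χ x / (‖x‖ ^ 2 + η)) :=
      χ.contDiff.div hsd fun x => (hs x).ne'
    -- A regularisation of `x/|x|²`, whose divergence is `(d - 2)/|x|²`, at least `1/|x|²` since `d
    -- ≥ 3`. The support contains the origin, which the flux identity allows. Fatou's lemma removes
    -- `η` at the end.
    set V : 𝔼 → 𝔼 := fun x => (χ x / (‖x‖ ^ 2 + η)) • x with hV
    have hVd : ContDiff ℝ 1 V := (hcd.smul contDiff_id).of_le (by simp)
    have hVc : HasCompactSupport V := by
      refine χ.hasCompactSupport.mono fun x hx => ?_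
      contrapose! hx
      simp [hV, Function.notMem_support.1 hx]
    obtain ⟨hI, hI0⟩ := h.flux_identity hVd.locallyLipschitz hVc
    have hdiv : ∀ x, divergence V x = fderiv ℝ χ x x / (‖x‖ ^ 2 + η)
        - χ x * (2 * ‖x‖ ^ 2) / (‖x‖ ^ 2 + η) ^ 2 + χ x / (‖x‖ ^ 2 + η) * d := by
      intro x
      have hd1 : DifferentiableAt ℝ χ x := χ.contDiff.differentiable (n := 1) one_ne_zero x
      have hd2 : HasFDerivAt (fun x : 𝔼 => ‖x‖ ^ 2 + η) (2 • innerSL ℝ x) x :=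
        (hasStrictFDerivAt_norm_sq x).hasFDerivAt.add_const η
      have hd4 := (hasDerivAt_inv (hs x).ne').comp_hasFDerivAt x hd2
      have hd3 : HasFDerivAt (fun x : 𝔼 => χ x / (‖x‖ ^ 2 + η)) _ x := hd1.hasFDerivAt.mul hd4
      rw [hV, divergence_smul hd3.differentiableAt differentiableAt_fun_id, divergence_id, hd3.fderiv]
      have := (hs x).ne'
      simp only [smul_apply, add_apply, smul_eq_mul, innerSL_apply_apply, nsmul_eq_mul,
        real_inner_self_eq_norm_sq, Nat.cast_ofNat]
      field_simp
      ring
    -- The divergence term contributes at least `χ P`, where `P = a² / (|x|² + η)`, and Young's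
    -- inequality in the cross term costs `χ P / 2`. Half of `χ P` remains, hence the factor two.
    -- `R` pays for the gradient of `a` and for the derivative of `χ`.
    have hpt : ∀ x, χ x * (a x ^ 2 / (‖x‖ ^ 2 + η)) ≤
        2 * (2 * a x * inner ℝ (V x) (A x) + divergence V x * a x * a x) + 2 * R x := by
      intro x
      have hχ0 : 0 ≤ χ x := χ.nonneg
      have hχ1 : χ x ≤ 1 := χ.le_one
      by_cases hx : x ∈ B2
      swap
      · have hx2 : 2 < ‖x‖ := by simpa [hB2] using hx
        have hz : χ x = 0 := χ.zero_of_le_dist (by rw [dist_zero_right]; exact hx2.le)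
        rw [hdiv, hV, hχ, fderiv_unitCutoff_of_gt hx2, ← hχ, hR, indicator_of_notMem hx]
        simp [hz]
      have hRx : R x = 2 * ‖A x‖ ^ 2 + M * ‖a x‖ ^ 2 := by rw [hR, indicator_of_mem hx]
      set s := ‖x‖ ^ 2 + η with hsdef
      have hs0 : 0 < s := hs x
      have hxs : ‖x‖ ^ 2 ≤ s := by rw [hsdef]; linarith
      have hD : -M ≤ fderiv ℝ χ x x / s := by
        rcases lt_or_ge ‖x‖ 1 with h1 | h1
        · rw [hχ, fderiv_unitCutoff_of_lt h1]; simpa using hM0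
        · rw [le_div_iff₀ hs0]
          have h2 := (abs_le.1 (hM x x)).1
          have : ‖x‖ ≤ s := by nlinarith
          nlinarith [mul_le_mul_of_nonneg_left this hM0]
      set t := ‖x‖ ^ 2 / s with ht
      have ht1 : t ≤ 1 := (div_le_one hs0).2 hxs
      have ht0 : 0 ≤ t := by positivity
      set P := a x ^ 2 / s with hP
      have hP0 : 0 ≤ P := by positivity
      have hcross : -(χ x * (P / 2 + 2 * ‖A x‖ ^ 2)) ≤ 2 * a x * inner ℝ (V x) (A x) := by
        have hin : (inner ℝ (V x) (A x) : ℝ) = χ x * (inner ℝ x (A x) / s) := by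
          rw [hV, real_inner_smul_left]; ring
        have hcs : |a x * (inner ℝ x (A x) / s)| ≤ |a x| * ‖x‖ / s * ‖A x‖ := by
          rw [abs_mul, abs_div, abs_of_pos hs0]
          calc |a x| * (|(inner ℝ x (A x) : ℝ)| / s) ≤ |a x| * (‖x‖ * ‖A x‖ / s) := by
                gcongr; exact abs_real_inner_le_norm _ _
            _ = _ := by ring
        have hsq : (|a x| * ‖x‖ / s) ^ 2 ≤ P := by
          have : (|a x| * ‖x‖ / s) ^ 2 = P * t := by
            rw [hP, ht, div_pow, mul_pow, sq_abs]; field_simp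
          rw [this]
          exact mul_le_of_le_one_right hP0 ht1
        have h3 : -(P / 2 + 2 * ‖A x‖ ^ 2) ≤ 2 * (a x * (inner ℝ x (A x) / s)) := by
          have h4 := (abs_le.1 hcs).1
          nlinarith [sq_nonneg (|a x| * ‖x‖ / s - 2 * ‖A x‖)]
        rw [hin]
        have := mul_le_mul_of_nonneg_left h3 hχ0
        linarith
      have hdv : χ x * P - M * a x ^ 2 ≤ divergence V x * a x * a x := by
        have he : divergence V x * a x * a x = fderiv ℝ χ x x / s * a x ^ 2
            + χ x * P * (d - 2 * t) := by
          rw [hdiv, hP, ht, ← hsdef]; field_simp; ring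
        have hd3 : (3 : ℝ) ≤ d := by exact_mod_cast hd
        have h5 : χ x * P ≤ χ x * P * (d - 2 * t) :=
          le_mul_of_one_le_right (by positivity) (by linarith)
        have h6 := mul_le_mul_of_nonneg_right hD (sq_nonneg (a x))
        rw [he]; linarith
      have hA2 : χ x * ‖A x‖ ^ 2 ≤ ‖A x‖ ^ 2 := mul_le_of_le_one_left (by positivity) hχ1
      rw [hRx, Real.norm_eq_abs, sq_abs]
      have : χ x * (P / 2 + 2 * ‖A x‖ ^ 2) = χ x * P / 2 + 2 * (χ x * ‖A x‖ ^ 2) := by ring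
      rw [this] at hcross
      linarith
    have hB1c : IsCompact (Metric.closedBall (0 : 𝔼) 1) := isCompact_closedBall _ _
    have hχ1 : ∀ x ∈ Metric.closedBall (0 : 𝔼) 1, χ x = 1 := fun x hx =>
      χ.one_of_mem_closedBall hx
    have hmaj := (hI.const_mul 2).add (hRint.const_mul 2)
    have hmeas : AEStronglyMeasurable (fun x => a x ^ 2 / (‖x‖ ^ 2 + η)) volume := by
      have ham := (locallyIntegrable_of_memLp h.memLp).aestronglyMeasurable
      have hc : Continuous fun x : 𝔼 => ‖x‖ ^ 2 + η := by fun_prop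
      exact ((ham.pow 2).aemeasurable.div hc.measurable.aemeasurable).aestronglyMeasurable
    have hint : Integrable (fun x => χ x * (a x ^ 2 / (‖x‖ ^ 2 + η))) := by
      refine hmaj.mono' (χ.continuous.aestronglyMeasurable.mul hmeas)
        (Eventually.of_forall fun x => ?_)
      have h0 : 0 ≤ χ x * (a x ^ 2 / (‖x‖ ^ 2 + η)) := by
        have := χ.nonneg (x := x); have := hs x; positivity
      rw [Real.norm_of_nonneg h0]
      exact hpt x
    refine ⟨?_, ?_⟩
    · refine (hint.integrableOn (s := Metric.closedBall 0 1)).congr_fun (fun x hx => ?_)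
        hB1c.measurableSet
      simp [hχ1 x hx]
    · calc ∫ x in Metric.closedBall (0 : 𝔼) 1, a x ^ 2 / (‖x‖ ^ 2 + η)
          = ∫ x in Metric.closedBall (0 : 𝔼) 1, χ x * (a x ^ 2 / (‖x‖ ^ 2 + η)) :=
            setIntegral_congr_fun hB1c.measurableSet fun x hx => by simp [hχ1 x hx]
        _ ≤ ∫ x, χ x * (a x ^ 2 / (‖x‖ ^ 2 + η)) :=
            setIntegral_le_integral hint (Eventually.of_forall fun x => by
              have := χ.nonneg (x := x); have := hs x
              simp only [Pi.zero_apply]; positivity)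
        _ ≤ ∫ x, (2 * (2 * a x * inner ℝ (V x) (A x) + divergence V x * a x * a x) + 2 * R x) :=
            integral_mono hint hmaj hpt
        _ = 2 * ∫ x, R x := by
            rw [integral_add (hI.const_mul 2) (hRint.const_mul 2), integral_const_mul, hI0,
              integral_const_mul]; ring
  refine integrable_of_tendsto_of_integral_le (g := fun n x => a x ^ 2 / (‖x‖ ^ 2 + 1 / ((n : ℝ) + 1)))
    (fun n => (key _ (by positivity)).1) (fun n x => by positivity)
    (fun n => (key _ (by positivity)).2) ?_
  have hd0 : Nonempty (Fin d) := ⟨⟨0, by omega⟩⟩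
  have hne : ∀ᵐ x : 𝔼 ∂(volume.restrict (Metric.closedBall 0 1)), x ≠ 0 :=
    ae_restrict_of_ae (by simp [ae_iff, measure_singleton])
  filter_upwards [hne] with x hx
  have h1 : Tendsto (fun n : ℕ => ‖x‖ ^ 2 + 1 / ((n : ℝ) + 1)) atTop (𝓝 (‖x‖ ^ 2 + 0)) :=
    tendsto_const_nhds.add tendsto_one_div_add_atTop_nhds_zero_nat
  rw [add_zero] at h1
  exact Filter.Tendsto.div tendsto_const_nhds h1 (by positivity)

end Hardy

/-! ### Functions of homogeneous size away from the origin. -/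

section Symbols

variable {d : ℕ}

local notation "𝔼" => EuclideanSpace ℝ (Fin d)

/-- `φ` is smooth away from the origin, of size `|x|^m` there, with derivative of size
`|x|^(m-1)`. -/
structure IsSymbol {Y : Type*} [NormedAddCommGroup Y] [NormedSpace ℝ Y] (m : ℤ) (φ : 𝔼 → Y) :
    Prop where
  smooth : ContDiffOn ℝ ∞ φ {0}ᶜ
  bound : ∃ C : ℝ, ∀ x, x ≠ 0 → ‖φ x‖ ≤ C * ‖x‖ ^ m
  bound_fderiv : ∃ C : ℝ, ∀ x, x ≠ 0 → ‖fderiv ℝ φ x‖ ≤ C * ‖x‖ ^ (m - 1)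

lemma compl_zero_mem_nhds {x : 𝔼} (hx : x ≠ 0) : ({0}ᶜ : Set 𝔼) ∈ 𝓝 x :=
  isOpen_compl_singleton.mem_nhds hx

lemma ContDiffOn.contDiffAt_of_ne {Y : Type*} [NormedAddCommGroup Y] [NormedSpace ℝ Y]
    {φ : 𝔼 → Y} (h : ContDiffOn ℝ ∞ φ {0}ᶜ) {x : 𝔼} (hx : x ≠ 0) : ContDiffAt ℝ ∞ φ x :=
  h.contDiffAt (compl_zero_mem_nhds hx)

lemma ContDiffOn.differentiableAt_of_ne {Y : Type*} [NormedAddCommGroup Y] [NormedSpace ℝ Y]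
    {φ : 𝔼 → Y} (h : ContDiffOn ℝ ∞ φ {0}ᶜ) {x : 𝔼} (hx : x ≠ 0) : DifferentiableAt ℝ φ x :=
  (h.contDiffAt_of_ne hx).differentiableAt (by simp)

lemma ContDiffOn.fderiv_compl_zero {Y : Type*} [NormedAddCommGroup Y] [NormedSpace ℝ Y]
    {φ : 𝔼 → Y} (h : ContDiffOn ℝ ∞ φ {0}ᶜ) : ContDiffOn ℝ ∞ (fderiv ℝ φ) {0}ᶜ :=
  h.fderiv_of_isOpen isOpen_compl_singleton (by simp)

lemma zpow_bound_of_mul_le {a r C : ℝ} {k : ℕ} (hr : 0 < r) (h : r ^ k * a ≤ C) :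
    a ≤ C * r ^ (-(k : ℤ)) := by
  rw [zpow_neg, zpow_natCast, ← div_eq_mul_inv, le_div_iff₀ (by positivity), mul_comm]
  exact h

namespace IsSymbol

variable {Y Z : Type*} [NormedAddCommGroup Y] [NormedSpace ℝ Y] [NormedAddCommGroup Z]
  [NormedSpace ℝ Z] {m m₁ m₂ : ℤ}

lemma differentiableAt {φ : 𝔼 → Y} (h : IsSymbol m φ) {x : 𝔼} (hx : x ≠ 0) :
    DifferentiableAt ℝ φ x := h.smooth.differentiableAt_of_ne hx

lemma of_iteratedFDeriv {φ : 𝔼 → Y} (k : ℕ) (hm : m = -(k : ℤ)) (hφ : ContDiffOn ℝ ∞ φ {0}ᶜ)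
    {C C' : ℝ} (h0 : ∀ x, x ≠ 0 → ‖x‖ ^ k * ‖iteratedFDeriv ℝ 0 φ x‖ ≤ C)
    (h1 : ∀ x, x ≠ 0 → ‖x‖ ^ (k + 1) * ‖iteratedFDeriv ℝ 1 φ x‖ ≤ C') : IsSymbol m φ := by
  refine ⟨hφ, ⟨C, fun x hx => ?_⟩, ⟨C', fun x hx => ?_⟩⟩
  · have := h0 x hx
    rw [norm_iteratedFDeriv_zero] at this
    rw [hm]
    exact zpow_bound_of_mul_le (norm_pos_iff.2 hx) this
  · have := h1 x hx
    rw [norm_iteratedFDeriv_one] at this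
    have e : m - 1 = -((k + 1 : ℕ) : ℤ) := by push_cast; omega
    rw [e]
    exact zpow_bound_of_mul_le (norm_pos_iff.2 hx) this

lemma congr {φ ψ : 𝔼 → Y} (h : IsSymbol m φ) (he : ∀ x, x ≠ 0 → ψ x = φ x) : IsSymbol m ψ := by
  have hf : ∀ x, x ≠ 0 → fderiv ℝ ψ x = fderiv ℝ φ x := fun x hx =>
    Filter.EventuallyEq.fderiv_eq (Filter.mem_of_superset (compl_zero_mem_nhds hx) he)
  obtain ⟨C, hC⟩ := h.bound
  obtain ⟨C', hC'⟩ := h.bound_fderiv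
  exact ⟨h.smooth.congr he, ⟨C, fun x hx => by rw [he x hx]; exact hC x hx⟩,
    ⟨C', fun x hx => by rw [hf x hx]; exact hC' x hx⟩⟩

lemma clm_apply {φ : 𝔼 → Y} (h : IsSymbol m φ) (L : Y →L[ℝ] Z) : IsSymbol m (fun x => L (φ x)) := by
  obtain ⟨C, hC⟩ := h.bound
  obtain ⟨C', hC'⟩ := h.bound_fderiv
  refine ⟨L.contDiff.comp_contDiffOn h.smooth, ⟨‖L‖ * C, fun x hx => ?_⟩,
    ⟨‖L‖ * C', fun x hx => ?_⟩⟩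
  · rw [mul_assoc]
    exact (L.le_opNorm _).trans (by gcongr; exact hC x hx)
  · have : fderiv ℝ (fun x => L (φ x)) x = L ∘L fderiv ℝ φ x :=
      (L.hasFDerivAt.comp x (h.differentiableAt hx).hasFDerivAt).fderiv
    rw [this, mul_assoc]
    exact (L.opNorm_comp_le _).trans (by gcongr; exact hC' x hx)

lemma add {φ ψ : 𝔼 → Y} (h : IsSymbol m φ) (h' : IsSymbol m ψ) :
    IsSymbol m (fun x => φ x + ψ x) := by
  obtain ⟨C, hC⟩ := h.bound
  obtain ⟨D, hD⟩ := h.bound_fderiv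
  obtain ⟨C', hC'⟩ := h'.bound
  obtain ⟨D', hD'⟩ := h'.bound_fderiv
  refine ⟨h.smooth.add h'.smooth, ⟨C + C', fun x hx => ?_⟩, ⟨D + D', fun x hx => ?_⟩⟩
  · rw [add_mul]; exact (norm_add_le _ _).trans (add_le_add (hC x hx) (hC' x hx))
  · rw [add_mul, fderiv_fun_add (h.differentiableAt hx) (h'.differentiableAt hx)]
    exact (norm_add_le _ _).trans (add_le_add (hD x hx) (hD' x hx))

lemma zero : IsSymbol m (fun _ : 𝔼 => (0 : Y)) :=
  ⟨contDiffOn_const, ⟨0, fun x _ => by simp⟩, ⟨0, fun x _ => by simp⟩⟩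

lemma sum {ι : Type*} (s : Finset ι) {φ : ι → 𝔼 → Y} (h : ∀ i, IsSymbol m (φ i)) :
    IsSymbol m (fun x => ∑ i ∈ s, φ i x) := by
  classical
  induction s using Finset.induction_on with
  | empty => simpa using zero
  | insert a s ha ih => simp only [Finset.sum_insert ha]; exact (h a).add ih

lemma mul (hm : m = m₁ + m₂) {φ ψ : 𝔼 → ℝ} (h : IsSymbol m₁ φ) (h' : IsSymbol m₂ ψ) :
    IsSymbol m (fun x => φ x * ψ x) := by
  obtain ⟨C, hC⟩ := h.bound
  obtain ⟨D, hD⟩ := h.bound_fderiv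
  obtain ⟨C', hC'⟩ := h'.bound
  obtain ⟨D', hD'⟩ := h'.bound_fderiv
  refine ⟨h.smooth.mul h'.smooth, ⟨C * C', fun x hx => ?_⟩, ⟨C * D' + C' * D, fun x hx => ?_⟩⟩
  · have hx0 := norm_ne_zero_iff.2 hx
    rw [norm_mul, hm, zpow_add₀ hx0]
    calc ‖φ x‖ * ‖ψ x‖ ≤ (C * ‖x‖ ^ m₁) * (C' * ‖x‖ ^ m₂) :=
          mul_le_mul (hC x hx) (hC' x hx) (norm_nonneg _) ((norm_nonneg _).trans (hC x hx))
      _ = _ := by ring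
  · have hx0 := norm_ne_zero_iff.2 hx
    rw [fderiv_fun_mul (h.differentiableAt hx) (h'.differentiableAt hx)]
    refine (norm_add_le _ _).trans ?_
    rw [norm_smul, norm_smul]
    have e1 : ‖x‖ ^ (m - 1) = ‖x‖ ^ m₁ * ‖x‖ ^ (m₂ - 1) := by
      rw [← zpow_add₀ hx0]; congr 1; omega
    have e2 : ‖x‖ ^ (m - 1) = ‖x‖ ^ m₂ * ‖x‖ ^ (m₁ - 1) := by
      rw [← zpow_add₀ hx0]; congr 1; omega
    calc ‖φ x‖ * ‖fderiv ℝ ψ x‖ + ‖ψ x‖ * ‖fderiv ℝ φ x‖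
        ≤ (C * ‖x‖ ^ m₁) * (D' * ‖x‖ ^ (m₂ - 1)) + (C' * ‖x‖ ^ m₂) * (D * ‖x‖ ^ (m₁ - 1)) := by
          refine add_le_add ?_ ?_
          · exact mul_le_mul (hC x hx) (hD' x hx) (norm_nonneg _) ((norm_nonneg _).trans (hC x hx))
          · exact mul_le_mul (hC' x hx) (hD x hx) (norm_nonneg _) ((norm_nonneg _).trans (hC' x hx))
      _ = C * D' * (‖x‖ ^ m₁ * ‖x‖ ^ (m₂ - 1)) + C' * D * (‖x‖ ^ m₂ * ‖x‖ ^ (m₁ - 1)) := by ring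
      _ = _ := by rw [← e1, ← e2]; ring

lemma const (c : ℝ) : IsSymbol 0 (fun _ : 𝔼 => c) :=
  ⟨contDiffOn_const, ⟨|c|, fun x _ => by simp⟩, ⟨0, fun x _ => by simp⟩⟩

lemma coord (i : Fin d) : IsSymbol 1 (fun x : 𝔼 => x i) := by
  have h1 : IsSymbol 1 (fun x : 𝔼 => x) :=
    ⟨contDiffOn_id, ⟨1, fun x _ => by simp⟩, ⟨1, fun x _ => by
      simpa using ContinuousLinearMap.norm_id_le (𝕜 := ℝ) (E := 𝔼)⟩⟩
  exact h1.clm_apply (EuclideanSpace.proj (𝕜 := ℝ) i)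

lemma normSq : IsSymbol 2 (fun x : 𝔼 => ‖x‖ ^ 2) := by
  have : IsSymbol 2 (fun x : 𝔼 => ∑ i, x i * x i) :=
    IsSymbol.sum _ fun i => (coord i).mul (by norm_num) (coord i)
  refine this.congr fun x _ => ?_
  rw [EuclideanSpace.real_norm_sq_eq]
  exact Finset.sum_congr rfl fun i _ => by ring

end IsSymbol

end Symbols

/-! ### Regularity of the matrix `F`. -/

section EikonalGeometry

variable {d : ℕ} {p Q K : EuclideanSpace ℝ (Fin d) → ℝ} {lam δ : ℝ}

local notation "𝔼" => EuclideanSpace ℝ (Fin d)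

lemma contDiffOn_eikonalRatio (hK : IsEikonalSolution p lam K) :
    ContDiffOn ℝ ∞ (eikonalRatio K) {0}ᶜ := by
  intro x hx
  exact ((hK.smooth.contDiffAt_of_ne hx).div (contDiffAt_norm ℝ hx)
    (norm_ne_zero_iff.2 hx)).contDiffWithinAt

/-- A symbol carries a bound on one derivative. Three derivatives of `g` are needed because the
identity differentiates the trace of `F`, which contains `D²g`. -/
lemma isSymbol_eikonalRatio (hK : IsEikonalSolution p lam K) :
    IsSymbol 0 (eikonalRatio K) ∧ IsSymbol (-1) (fderiv ℝ (eikonalRatio K)) ∧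
      IsSymbol (-2) (fderiv ℝ (fderiv ℝ (eikonalRatio K))) := by
  obtain ⟨C0, h0⟩ := hK.bounds 0 (by norm_num)
  obtain ⟨C1, h1⟩ := hK.bounds 1 (by norm_num)
  obtain ⟨C2, h2⟩ := hK.bounds 2 (by norm_num)
  obtain ⟨C3, h3⟩ := hK.bounds 3 (by norm_num)
  set g := eikonalRatio K
  have hg := contDiffOn_eikonalRatio hK
  refine ⟨.of_iteratedFDeriv 0 (by simp) hg h0 h1,
    .of_iteratedFDeriv 1 (C := C1) (C' := C2) (by simp) hg.fderiv_compl_zero (fun x hx => ?_) (fun x hx => ?_),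
    .of_iteratedFDeriv 2 (C := C2) (C' := C3) (by simp) hg.fderiv_compl_zero.fderiv_compl_zero
      (fun x hx => ?_) (fun x hx => ?_)⟩
  · rw [norm_iteratedFDeriv_fderiv]; exact h1 x hx
  · rw [norm_iteratedFDeriv_fderiv]; exact h2 x hx
  · rw [norm_iteratedFDeriv_fderiv, norm_iteratedFDeriv_fderiv]; exact h2 x hx
  · rw [norm_iteratedFDeriv_fderiv, norm_iteratedFDeriv_fderiv]; exact h3 x hx

lemma gradient_gradient_apply {g : 𝔼 → ℝ} (hg : ContDiffOn ℝ ∞ g {0}ᶜ) {x : 𝔼} (hx : x ≠ 0)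
    (i j : Fin d) : ∇ (fun y => ∇ g y j) x i
      = fderiv ℝ (fderiv ℝ g) x (EuclideanSpace.single i 1) (EuclideanSpace.single j 1) := by
  rw [gradient_apply]
  have h1 : (fun y => ∇ g y j) = fun y => fderiv ℝ g y (EuclideanSpace.single j 1) := by
    ext y; exact gradient_apply g y j
  rw [h1, fderiv_clm_apply (hg.fderiv_compl_zero.differentiableAt_of_ne hx)
    (differentiableAt_const _)]
  simp

lemma norm_gradient (g : 𝔼 → ℝ) (x : 𝔼) : ‖∇ g x‖ = ‖fderiv ℝ g x‖ := by
  rw [gradient, LinearIsometryEquiv.norm_map]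

/-- In every term of `F` the powers of `x` equal the number of derivatives falling on `g`, so the
orders add up to zero. -/
lemma isSymbol_eikonalF (hK : IsEikonalSolution p lam K) (i j : Fin d) :
    IsSymbol 0 (eikonalF K i j) := by
  obtain ⟨s0, s1, s2⟩ := isSymbol_eikonalRatio hK
  set g := eikonalRatio K with hg
  have t1 : ∀ j, IsSymbol (-1) (fun x => ∇ g x j) := fun j =>
    (s1.clm_apply (ContinuousLinearMap.apply ℝ ℝ (EuclideanSpace.single j (1 : ℝ)))).congr
      fun x _ => gradient_apply g x j
  have t2 : IsSymbol (-2) (fun x => ∇ (fun y => ∇ g y j) x i) :=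
    ((s2.clm_apply (ContinuousLinearMap.apply ℝ (𝔼 →L[ℝ] ℝ)
      (EuclideanSpace.single i (1 : ℝ)))).clm_apply
      (ContinuousLinearMap.apply ℝ ℝ (EuclideanSpace.single j (1 : ℝ)))).congr
      fun x hx => gradient_gradient_apply s0.smooth hx i j
  have n1 : IsSymbol (-2) (fun x => ‖∇ g x‖ ^ 2) := by
    refine (IsSymbol.sum (m := -2) Finset.univ fun k => (t1 k).mul (by norm_num) (t1 k)).congr
      fun x _ => ?_
    rw [EuclideanSpace.real_norm_sq_eq]
    exact Finset.sum_congr rfl fun k _ => by ring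
  have n2 : IsSymbol 0 (fun x => (inner ℝ x (∇ g x) : ℝ)) := by
    refine (IsSymbol.sum (m := 0) Finset.univ fun k =>
      (IsSymbol.coord k).mul (by norm_num) (t1 k)).congr fun x _ => ?_
    rw [PiLp.inner_apply]
    exact Finset.sum_congr rfl fun k _ => by simp [mul_comm]
  have d1 : IsSymbol 0 (fun x => if i = j then
      ‖x‖ ^ 2 * ‖∇ g x‖ ^ 2 + 2 * g x * inner ℝ x (∇ g x) else 0) := by
    by_cases hij : i = j
    · simp only [hij, if_true]
      exact (IsSymbol.normSq.mul (by norm_num) n1).add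
        (((IsSymbol.const 2).mul (m := 0) (by norm_num) s0).mul (by norm_num) n2)
    · simp only [hij, if_false]
      exact IsSymbol.zero
  have c2 := IsSymbol.const (d := d) 2
  have d2 := (IsSymbol.normSq.mul (m := 1) (by norm_num) (t1 i)).mul (m := 0) (by norm_num) (t1 j)
  have d3 : ∀ i j, IsSymbol 0 (fun x : 𝔼 => 2 * x i * g x * ∇ g x j) := fun i j =>
    (((c2.mul (m := 1) (by norm_num) (IsSymbol.coord i)).mul (m := 1) (by norm_num) s0)).mul
      (by norm_num) (t1 j)
  have d4 := (s0.mul (m := 2) (by norm_num) IsSymbol.normSq).mul (m := 0) (by norm_num) t2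
  have hneg := (IsSymbol.const (-1)).mul (m := 0) (by norm_num) d1
  refine ((((hneg.add d2).add (d3 i j)).add (d3 j i)).add d4).congr fun x _ => ?_
  simp only [eikonalF, ← hg]
  ring

lemma isSymbol_eikonalTraceF (hK : IsEikonalSolution p lam K) : IsSymbol 0 (eikonalTraceF K) :=
  IsSymbol.sum _ fun i => isSymbol_eikonalF hK i i

end EikonalGeometry

/-! ### Size of `K`, and its first and second derivatives. -/

section EikonalGeometry

variable {d : ℕ} {p Q K : EuclideanSpace ℝ (Fin d) → ℝ} {lam δ : ℝ}

local notation "𝔼" => EuclideanSpace ℝ (Fin d)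

lemma exists_bound_of_decay {Y : Type*} [NormedAddCommGroup Y] {φ : 𝔼 → Y} (hφ : Continuous φ)
    {C s : ℝ} (hs : 0 ≤ s) (h : ∀ x, 1 ≤ ‖x‖ → ‖φ x‖ ≤ C * ‖x‖ ^ (-s)) :
    ∃ M, 0 ≤ M ∧ ∀ x, ‖φ x‖ ≤ M := by
  obtain ⟨M, hM⟩ := (isCompact_closedBall (0 : 𝔼) 1).exists_bound_of_continuousOn hφ.continuousOn
  refine ⟨max M |C|, le_max_of_le_right (abs_nonneg _), fun x => ?_⟩
  rcases le_total ‖x‖ 1 with hx | hx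
  · exact (hM x (mem_closedBall_zero_iff.2 hx)).trans (le_max_left _ _)
  · refine (h x hx).trans (le_max_of_le_right ?_)
    calc C * ‖x‖ ^ (-s) ≤ |C| * 1 := by
          gcongr
          · exact le_abs_self C
          · exact Real.rpow_le_one_of_one_le_of_nonpos hx (by linarith)
      _ = |C| := mul_one _

lemma IsAdmissiblePotential.exists_bound (h : IsAdmissiblePotential d p Q δ) (hδ : 0 < δ) :
    ∃ M, 0 ≤ M ∧ (∀ x, |p x| ≤ M) ∧ ∀ x, ‖fderiv ℝ p x‖ ≤ M := by
  obtain ⟨C0, h0⟩ := h.decay 0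
  obtain ⟨C1, h1⟩ := h.decay 1
  obtain ⟨M0, hM0, b0⟩ := exists_bound_of_decay h.smooth.continuous (C := C0)
    (s := 2 + ((0 : ℕ) : ℝ) + δ) (by positivity) fun x hx => by
      simpa only [norm_iteratedFDeriv_zero] using h0 x hx
  obtain ⟨M1, hM1, b1⟩ := exists_bound_of_decay (h.smooth.continuous_fderiv (by simp)) (C := C1)
    (s := 2 + ((1 : ℕ) : ℝ) + δ) (by positivity) fun x hx => by
      simpa only [norm_iteratedFDeriv_one] using h1 x hx
  exact ⟨max M0 M1, le_max_of_le_left hM0, fun x => (b0 x).trans (le_max_left _ _),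
    fun x => (b1 x).trans (le_max_right _ _)⟩

/-- Positivity is assumed only pointwise. It becomes uniform by compactness on a ball and by the
decay of `p` outside it. -/
lemma IsAdmissiblePotential.exists_speed_lower_bound (h : IsAdmissiblePotential d p Q δ)
    (hδ : 0 < δ) (hlam : 0 < lam) (hpos : ∀ x, 0 < 1 + p x / lam) :
    ∃ c, 0 < c ∧ ∀ x, c ≤ 1 + p x / lam := by
  obtain ⟨C0, h0⟩ := h.decay 0
  -- For `‖x‖ ≥ R` the weaker decay `|p x| ≤ |C0| / ‖x‖` already gives `|p x| ≤ lam / 2`.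
  set R := max 1 (2 * |C0| / lam) with hR
  have hcont : Continuous (fun x => 1 + p x / lam) := by
    have := h.smooth.continuous
    fun_prop
  obtain ⟨y, -, hy⟩ := (isCompact_closedBall (0 : 𝔼) R).exists_isMinOn
    ⟨0, Metric.mem_closedBall_self (le_max_of_le_left zero_le_one)⟩ hcont.continuousOn
  refine ⟨min (1 + p y / lam) (1 / 2), lt_min (hpos y) (by norm_num), fun x => ?_⟩
  rcases le_total ‖x‖ R with hx | hx
  · exact (min_le_left _ _).trans (hy (mem_closedBall_zero_iff.2 hx))
  · refine (min_le_right _ _).trans ?_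
    have hx1 : 1 ≤ ‖x‖ := (le_max_left _ _).trans hx
    have hx2 : 2 * |C0| / lam ≤ ‖x‖ := (le_max_right _ _).trans hx
    have hb := h0 x hx1
    rw [norm_iteratedFDeriv_zero, Real.norm_eq_abs] at hb
    have hp : |p x| ≤ |C0| * ‖x‖⁻¹ := by
      refine hb.trans ?_
      rw [← Real.rpow_neg_one]
      have h1 : ‖x‖ ^ (-(2 + ((0 : ℕ) : ℝ) + δ)) ≤ ‖x‖ ^ (-1 : ℝ) :=
        Real.rpow_le_rpow_of_exponent_le hx1 (by push_cast; linarith)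
      exact mul_le_mul (le_abs_self _) h1 (by positivity) (abs_nonneg _)
    have hxpos : 0 < ‖x‖ := by linarith
    have h3 : |C0| * ‖x‖⁻¹ ≤ lam / 2 := by
      rw [← div_eq_mul_inv, div_le_iff₀ hxpos]
      rw [div_le_iff₀ hlam] at hx2
      linarith
    have h4 : -(1 / 2) ≤ p x / lam := by
      rw [le_div_iff₀ hlam]
      linarith [(abs_le.1 (hp.trans h3)).1]
    linarith

lemma eikonalRatio_mul_norm (hK : IsEikonalSolution p lam K) (x : 𝔼) :
    eikonalRatio K x * ‖x‖ = K x := by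
  by_cases hx : x = 0
  · simp [hx, hK.zero]
  · rw [eikonalRatio, div_mul_cancel₀ _ (norm_ne_zero_iff.2 hx)]

lemma IsEikonalSolution.nonneg (hK : IsEikonalSolution p lam K) (x : 𝔼) : 0 ≤ K x := by
  by_cases hx : x = 0
  · rw [hx, hK.zero]
  · exact (hK.pos x hx).le

lemma IsEikonalSolution.exists_upper_bound (hK : IsEikonalSolution p lam K) :
    ∃ C, 0 ≤ C ∧ ∀ x, K x ≤ C * ‖x‖ := by
  obtain ⟨C, hC⟩ := (isSymbol_eikonalRatio hK).1.bound
  refine ⟨|C|, abs_nonneg _, fun x => ?_⟩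
  by_cases hx : x = 0
  · simp [hx, hK.zero]
  · rw [← eikonalRatio_mul_norm hK x]
    have := hC x hx
    rw [zpow_zero, mul_one] at this
    gcongr
    exact (le_abs_self _).trans (this.trans (le_abs_self _))

lemma IsEikonalSolution.differentiableAt (hK : IsEikonalSolution p lam K) {x : 𝔼} (hx : x ≠ 0) :
    DifferentiableAt ℝ K x := hK.smooth.differentiableAt_of_ne hx

lemma IsEikonalSolution.continuous (hK : IsEikonalSolution p lam K) : Continuous K := by
  obtain ⟨C, -, hC⟩ := hK.exists_upper_bound
  rw [continuous_iff_continuousAt]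
  intro x
  by_cases hx : x = 0
  · rw [hx, ContinuousAt, hK.zero]
    have h1 : Tendsto (fun y : 𝔼 => C * ‖y‖) (𝓝 0) (𝓝 0) := by
      have : Continuous fun y : 𝔼 => C * ‖y‖ := by fun_prop
      simpa using this.tendsto 0
    exact tendsto_of_tendsto_of_tendsto_of_le_of_le tendsto_const_nhds h1 hK.nonneg hC
  · exact (hK.differentiableAt hx).continuousAt

/-- In the direction `-∇K` the slope is `-‖∇K‖²`, while the cone below `K` keeps it above `-c ‖∇K‖`.
-/
lemma norm_gradient_le_of_forall_le {c : ℝ} (hc0 : 0 ≤ c) {x : 𝔼} (hd : DifferentiableAt ℝ K x)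
    (h : ∀ y, K x - c * ‖y - x‖ ≤ K y) : ‖∇ K x‖ ≤ c := by
  set v := -∇ K x with hv
  have hl := (hd.hasFDerivAt.hasLineDerivAt v).tendsto_slope_zero_right
  have h1 : -(c * ‖v‖) ≤ fderiv ℝ K x v := by
    refine ge_of_tendsto hl ?_
    filter_upwards [self_mem_nhdsWithin] with t ht
    have ht0 : 0 < t := ht
    have h2 := h (x + t • v)
    rw [add_sub_cancel_left, norm_smul, Real.norm_of_nonneg ht0.le] at h2
    rw [smul_eq_mul, ← div_eq_inv_mul, le_div_iff₀ ht0]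
    linarith
  rw [← inner_gradient, hv, inner_neg_right, real_inner_self_eq_norm_sq, norm_neg] at h1
  by_contra! hc
  nlinarith [hc0.trans_lt hc]

/-- A barrier argument with `b = √c / 2`. If `K x₀ < b ‖x₀‖`, the coercive function `K y + b ‖y -
x₀‖` is smaller at `x₀` than at the origin, so it has a minimum `y ≠ 0`. There a cone of slope `b`
touches `K` from below, so `‖∇K y‖ ≤ b`, contradicting `‖∇K‖² ≥ c = 4 b²`. -/
lemma IsEikonalSolution.exists_lower_bound (hK : IsEikonalSolution p lam K)
    {c : ℝ} (hc : 0 < c) (hp : ∀ x, c ≤ 1 + p x / lam) :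
    ∃ c', 0 < c' ∧ ∀ x, c' * ‖x‖ ≤ K x := by
  refine ⟨√c / 2, by positivity, fun x₀ => ?_⟩
  by_contra! hlt
  set b := √c / 2 with hb
  have hb0 : 0 < b := by positivity
  have hcont : Continuous (fun y => K y + b * ‖y - x₀‖) := by
    have := hK.continuous
    fun_prop
  have htend : Tendsto (fun y => K y + b * ‖y - x₀‖) (cocompact 𝔼) atTop := by
    refine tendsto_atTop_mono (f := fun y => b * (‖y‖ - ‖x₀‖)) (fun y => ?_) ?_
    · have h1 := hK.nonneg y
      have h2 : ‖y‖ - ‖x₀‖ ≤ ‖y - x₀‖ := norm_sub_norm_le _ _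
      nlinarith
    · refine Tendsto.const_mul_atTop hb0 ?_
      exact tendsto_atTop_add_const_right _ _ tendsto_norm_cocompact_atTop
  obtain ⟨y, hy⟩ := hcont.exists_forall_le htend
  have hy0 : y ≠ 0 := by
    rintro rfl
    have h1 := hy x₀
    simp only [hK.zero, zero_sub, norm_neg, sub_self, norm_zero, mul_zero, add_zero,
      zero_add] at h1
    linarith
  have hN : ‖∇ K y‖ ≤ b := by
    refine norm_gradient_le_of_forall_le hb0.le (hK.differentiableAt hy0) fun z => ?_
    have h1 := hy z
    have h2 : ‖z - x₀‖ ≤ ‖z - y‖ + ‖y - x₀‖ := norm_sub_le_norm_sub_add_norm_sub _ _ _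
    nlinarith
  have h3 := hK.eikonal y hy0
  have h4 := hp y
  have h5 : ‖∇ K y‖ ^ 2 ≤ b ^ 2 := by gcongr
  have h6 : b ^ 2 = c / 4 := by rw [hb, div_pow, Real.sq_sqrt hc.le]; norm_num
  linarith

/-- Half the gradient of `K² = g²|x|²`; squaring avoids differentiating the norm. -/
lemma IsEikonalSolution.gradient_formula (hK : IsEikonalSolution p lam K) {x : 𝔼} (hx : x ≠ 0) :
    K x • ∇ K x = (eikonalRatio K x * ‖x‖ ^ 2) • ∇ (eikonalRatio K) x
      + (eikonalRatio K x ^ 2) • x := by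
  set g := eikonalRatio K with hg
  have hgd : DifferentiableAt ℝ g x := (contDiffOn_eikonalRatio hK).differentiableAt_of_ne hx
  have hKd := hK.differentiableAt hx
  have hn : HasFDerivAt (fun y : 𝔼 => ‖y‖ ^ 2) (2 • innerSL ℝ x) x :=
    (hasStrictFDerivAt_norm_sq x).hasFDerivAt
  have h1 : HasFDerivAt (fun y => K y * K y) _ x := hKd.hasFDerivAt.mul hKd.hasFDerivAt
  have h2 : HasFDerivAt (fun y => g y * g y * ‖y‖ ^ 2) _ x :=
    (hgd.hasFDerivAt.mul hgd.hasFDerivAt).mul hn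
  have h3 : (fun y => K y * K y) = fun y => g y * g y * ‖y‖ ^ 2 := by
    ext y; rw [← eikonalRatio_mul_norm hK y]; ring
  rw [h3] at h1
  have h4 := h1.unique h2
  refine ext_inner_right ℝ fun v => ?_
  have h5 := DFunLike.congr_fun h4 v
  simp only [add_apply, smul_apply, smul_eq_mul, innerSL_apply_apply, nsmul_eq_mul,
    Nat.cast_ofNat, Pi.mul_apply] at h5
  rw [inner_add_left, real_inner_smul_left, real_inner_smul_left, real_inner_smul_left,
    inner_gradient, inner_gradient]
  linarith

lemma contDiffOn_gradient {φ : 𝔼 → ℝ} (h : ContDiffOn ℝ ∞ φ {0}ᶜ) :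
    ContDiffOn ℝ ∞ (∇ φ) {0}ᶜ :=
  (InnerProductSpace.toDual ℝ 𝔼).symm.toContinuousLinearEquiv.contDiff.comp_contDiffOn
    h.fderiv_compl_zero

/-- The squared norm of the gradient formula, divided by `K² = g²|x|²`. It identifies the diagonal
part of `F` as `g² - |∇K|²`. -/
lemma IsEikonalSolution.speed_formula (hK : IsEikonalSolution p lam K) {x : 𝔼} (hx : x ≠ 0) :
    ‖∇ K x‖ ^ 2 = ‖x‖ ^ 2 * ‖∇ (eikonalRatio K) x‖ ^ 2
      + 2 * eikonalRatio K x * inner ℝ x (∇ (eikonalRatio K) x) + eikonalRatio K x ^ 2 := by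
  have h1 := congrArg (fun v => ‖v‖ ^ 2) (hK.gradient_formula hx)
  rw [norm_add_sq_real, norm_smul, norm_smul, norm_smul, mul_pow, mul_pow, mul_pow,
    real_inner_smul_left, real_inner_smul_right, real_inner_comm] at h1
  simp only [Real.norm_eq_abs, sq_abs] at h1
  have hK0 := hK.pos x hx
  have h2 := eikonalRatio_mul_norm hK x
  have hg0 : eikonalRatio K x ≠ 0 := by
    intro h0; rw [h0, zero_mul] at h2; exact hK0.ne h2
  have hx0 := norm_ne_zero_iff.2 hx
  rw [← h2] at h1
  have hne : (eikonalRatio K x * ‖x‖) ^ 2 ≠ 0 := by positivity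
  refine mul_left_cancel₀ hne ?_
  rw [h1]
  ring

/-- Differentiating `K ∇K = g|x|²∇g + g²x` gives `K D²K + ∇K ⊗ ∇K` on the left. On the right the
term `g² δ_ij` is `|∇K|² δ_ij` plus the diagonal part of `F`, by `speed_formula`, and the other
terms are those of `F`. -/
lemma IsEikonalSolution.hessian_formula (hK : IsEikonalSolution p lam K) {x : 𝔼} (hx : x ≠ 0)
    (i j : Fin d) : K x * fderiv ℝ (∇ K) x (EuclideanSpace.single i 1) j
      = eikonalF K i j x + (if i = j then ‖∇ K x‖ ^ 2 else 0) - ∇ K x i * ∇ K x j := by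
  set g := eikonalRatio K with hg
  have hgs := contDiffOn_eikonalRatio hK
  have hgd : DifferentiableAt ℝ g x := hgs.differentiableAt_of_ne hx
  have hKd := hK.differentiableAt hx
  have hNd : DifferentiableAt ℝ (∇ K) x := (contDiffOn_gradient hK.smooth).differentiableAt_of_ne hx
  have hGd : DifferentiableAt ℝ (∇ g) x := (contDiffOn_gradient hgs).differentiableAt_of_ne hx
  have hcoord : ∀ {φ : 𝔼 → 𝔼}, DifferentiableAt ℝ φ x → DifferentiableAt ℝ (fun y => φ y j) x :=
    fun h => (EuclideanSpace.proj (𝕜 := ℝ) j).differentiableAt.comp x h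
  have hn : HasFDerivAt (fun y : 𝔼 => ‖y‖ ^ 2) (2 • innerSL ℝ x) x :=
    (hasStrictFDerivAt_norm_sq x).hasFDerivAt
  have hxj : HasFDerivAt (fun y : 𝔼 => y j) (EuclideanSpace.proj (𝕜 := ℝ) j) x :=
    (EuclideanSpace.proj (𝕜 := ℝ) j).hasFDerivAt
  have h1 : HasFDerivAt (fun y => K y * ∇ K y j) _ x := hKd.hasFDerivAt.mul (hcoord hNd).hasFDerivAt
  have h2 : HasFDerivAt (fun y => g y * ‖y‖ ^ 2 * ∇ g y j + g y * g y * y j) _ x :=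
    ((hgd.hasFDerivAt.mul hn).mul (hcoord hGd).hasFDerivAt).add
      ((hgd.hasFDerivAt.mul hgd.hasFDerivAt).mul hxj)
  have h3 : (fun y => K y * ∇ K y j) =ᶠ[𝓝 x]
      fun y => g y * ‖y‖ ^ 2 * ∇ g y j + g y * g y * y j := by
    filter_upwards [compl_zero_mem_nhds hx] with y hy
    have := congrArg (fun v : 𝔼 => v j) (hK.gradient_formula hy)
    simp only [PiLp.smul_apply, PiLp.add_apply, smul_eq_mul] at this
    rw [this, ← hg]; ring
  have h4 := (h1.congr_of_eventuallyEq h3.symm).unique h2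
  have h5 := DFunLike.congr_fun h4 (EuclideanSpace.single i 1)
  simp only [add_apply, smul_apply, smul_eq_mul, innerSL_apply_apply, nsmul_eq_mul,
    Nat.cast_ofNat, Pi.mul_apply, fderiv_coord hNd, ← gradient_apply,
    PiLp.proj_apply, EuclideanSpace.inner_single_right, conj_trivial, one_mul] at h5
  have hsp := hK.speed_formula hx
  rw [← hg] at hsp
  simp only [eikonalF, ← hg]
  by_cases hij : i = j
  · subst hij
    simp only [if_true, PiLp.single_apply] at h5 ⊢
    rw [hsp]
    linarith
  · have hji : j ≠ i := fun h => hij h.symm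
    simp only [hij, hji, if_false, PiLp.single_apply] at h5 ⊢
    linarith

lemma IsEikonalSolution.quadratic_formula (hK : IsEikonalSolution p lam K) {x : 𝔼} (hx : x ≠ 0)
    (v : 𝔼) : K x * inner ℝ (fderiv ℝ (∇ K) x v) v = (∑ i, ∑ j, v i * eikonalF K i j x * v j)
      + ‖∇ K x‖ ^ 2 * inner ℝ v v - (inner ℝ (∇ K x) v) ^ 2 := by
  have h1 : ∀ j, K x * fderiv ℝ (∇ K) x v j = ∑ i, v i * (eikonalF K i j x
      + (if i = j then ‖∇ K x‖ ^ 2 else 0) - ∇ K x i * ∇ K x j) := by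
    intro j
    conv_lhs => rw [← sum_single_eq v, map_sum]
    rw [WithLp.ofLp_sum, Finset.sum_apply, Finset.mul_sum]
    refine Finset.sum_congr rfl fun i _ => ?_
    rw [← hK.hessian_formula hx i j, map_smul, PiLp.smul_apply, smul_eq_mul]
    ring
  have h2 : K x * inner ℝ (fderiv ℝ (∇ K) x v) v = ∑ j, ∑ i, v i * (eikonalF K i j x
      + (if i = j then ‖∇ K x‖ ^ 2 else 0) - ∇ K x i * ∇ K x j) * v j := by
    rw [PiLp.inner_apply, Finset.mul_sum]
    refine Finset.sum_congr rfl fun j _ => ?_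
    rw [← Finset.sum_mul, ← h1 j]
    simp; ring
  have h3 : (inner ℝ (∇ K x) v : ℝ) ^ 2 = ∑ i, ∑ j, v i * (∇ K x i * ∇ K x j) * v j := by
    rw [PiLp.inner_apply, sq, Finset.sum_mul_sum]
    refine Finset.sum_congr rfl fun i _ => Finset.sum_congr rfl fun j _ => ?_
    simp; ring
  have h4 : ‖∇ K x‖ ^ 2 * (inner ℝ v v : ℝ)
      = ∑ i, ∑ j, v i * (if i = j then ‖∇ K x‖ ^ 2 else 0) * v j := by
    rw [PiLp.inner_apply, Finset.mul_sum]
    refine Finset.sum_congr rfl fun i _ => ?_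
    simp only [mul_ite, mul_zero, ite_mul, zero_mul, Finset.sum_ite_eq, Finset.mem_univ, if_true]
    simp; ring
  rw [h2, Finset.sum_comm, h3, h4, ← Finset.sum_add_distrib, ← Finset.sum_sub_distrib]
  refine Finset.sum_congr rfl fun i _ => ?_
  rw [← Finset.sum_add_distrib, ← Finset.sum_sub_distrib]
  exact Finset.sum_congr rfl fun j _ => by ring

/-- The trace of the Hessian formula. It explains the weight `(d - 1)|∇K|²/K + tr F/K` of the
identity: it is `ΔK`. -/
lemma IsEikonalSolution.laplacian_formula (hK : IsEikonalSolution p lam K) {x : 𝔼} (hx : x ≠ 0) :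
    K x * divergence (∇ K) x = ((d : ℝ) - 1) * ‖∇ K x‖ ^ 2 + eikonalTraceF K x := by
  unfold divergence eikonalTraceF
  rw [Finset.mul_sum, Finset.sum_congr rfl fun i _ => hK.hessian_formula hx i i,
    Finset.sum_sub_distrib, Finset.sum_add_distrib]
  have h1 : ∑ i, ∇ K x i * ∇ K x i = ‖∇ K x‖ ^ 2 := by
    rw [EuclideanSpace.real_norm_sq_eq]
    exact Finset.sum_congr rfl fun i _ => by ring
  rw [h1]
  simp
  ring

end EikonalGeometry

/-! ### The profile `h` and the chain rule for `h'(K)`. -/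

section Profile

variable {h : ℝ → ℝ}

/-- Let `s → 0` in the Lipschitz bound for `h'(t) - h'(s)`. Linear vanishing at zero keeps `ψ'/K`
bounded at the origin. -/
lemma IsRegularProfile.exists_deriv_bound (hh : IsRegularProfile h) (T : ℝ) :
    ∃ L, 0 ≤ L ∧ ∀ t, 0 < t → t ≤ T → |deriv h t| ≤ L * t := by
  obtain ⟨L, hL⟩ := hh.lipschitz T
  refine ⟨L, L.2, fun t ht htT => ?_⟩
  have h1 : Tendsto (fun s => |deriv h t - deriv h s|) (𝓝[>] 0) (𝓝 |deriv h t - 0|) :=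
    (tendsto_const_nhds.sub hh.zero).abs
  rw [sub_zero] at h1
  refine le_of_tendsto h1 ?_
  filter_upwards [Ioc_mem_nhdsGT ht] with s hs
  have h2 := hL.dist_le_mul t ⟨ht, htT⟩ s ⟨hs.1, hs.2.trans htT⟩
  rw [Real.dist_eq, Real.dist_eq] at h2
  refine h2.trans ?_
  have h3 : |t - s| ≤ t := by rw [abs_of_nonneg (by linarith [hs.2])]; linarith [hs.1]
  gcongr

lemma IsRegularProfile.exists_deriv_deriv_bound (hh : IsRegularProfile h) (T : ℝ) :
    ∃ L, 0 ≤ L ∧ ∀ t, 0 < t → t < T → |deriv (deriv h) t| ≤ L := by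
  obtain ⟨L, hL⟩ := hh.lipschitz T
  refine ⟨L, L.2, fun t ht htT => ?_⟩
  exact norm_deriv_le_of_lipschitzOn (Ioc_mem_nhds ht htT) hL

lemma IsRegularProfile.differentiableAt (hh : IsRegularProfile h) {t : ℝ} (ht : 0 < t) :
    DifferentiableAt ℝ h t := hh.differentiable.differentiableAt (Ioi_mem_nhds ht)

/-- Polynomial growth of `h''` gives polynomial growth of `h'`. -/
lemma IsRegularProfile.deriv_growth (hh : IsRegularProfile h) {m : ℕ} {C : ℝ}
    (hC : ∀ t, 0 < t → |deriv (deriv h) t| ≤ C * (1 + t) ^ m) {t : ℝ} (ht : 0 < t) :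
    |deriv h t| ≤ C * (1 + t) ^ (m + 1) := by
  have hC0 : 0 ≤ C := by
    have h1 := (abs_nonneg _).trans (hC 1 one_pos)
    exact nonneg_of_mul_nonneg_left h1 (by positivity)
  obtain ⟨L, hL⟩ := hh.lipschitz t
  have key : ∀ s, 0 < s → s ≤ t → |deriv h t - deriv h s| ≤ C * (1 + t) ^ (m + 1) := by
    intro s hs hst
    -- A Lipschitz `h'` is absolutely continuous, hence the integral of its almost everywhere
    -- derivative; the values of `deriv` where `h''` fails to exist play no role.
    have hac : AbsolutelyContinuousOnInterval (deriv h) s t :=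
      (hL.mono (by rw [uIcc_of_le hst]; exact fun r hr =>
        ⟨hs.trans_le hr.1, hr.2⟩)).absolutelyContinuousOnInterval
    rw [← hac.integral_deriv_eq_sub, ← Real.norm_eq_abs]
    have hb := intervalIntegral.norm_integral_le_of_norm_le_const (a := s) (b := t)
      (f := deriv (deriv h)) (C := C * (1 + t) ^ m) fun r hr => by
        rw [uIoc_of_le hst] at hr
        refine (hC r (hs.trans hr.1)).trans ?_
        have : 0 ≤ r := (hs.trans hr.1).le
        gcongr
        exact hr.2
    refine hb.trans ?_
    rw [pow_succ, ← mul_assoc]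
    gcongr
    rw [abs_of_nonneg (by linarith)]; linarith
  have h1 : Tendsto (fun s => |deriv h t - deriv h s|) (𝓝[>] 0) (𝓝 |deriv h t - 0|) :=
    (tendsto_const_nhds.sub hh.zero).abs
  rw [sub_zero] at h1
  refine le_of_tendsto h1 ?_
  filter_upwards [Ioc_mem_nhdsGT ht] with s hs using key s hs.1 hs.2

variable {d : ℕ} {p K : EuclideanSpace ℝ (Fin d) → ℝ} {lam : ℝ}

local notation "𝔼" => EuclideanSpace ℝ (Fin d)

lemma fderiv_profile_comp (hh : IsRegularProfile h) (hK : IsEikonalSolution p lam K) {x : 𝔼}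
    (hx : x ≠ 0) : fderiv ℝ (fun y => h (K y)) x = deriv h (K x) • fderiv ℝ K x :=
  ((hh.differentiableAt (hK.pos x hx)).hasDerivAt.comp_hasFDerivAt x
    (hK.differentiableAt hx).hasFDerivAt).fderiv

lemma gradient_profile_comp (hh : IsRegularProfile h) (hK : IsEikonalSolution p lam K) {x : 𝔼}
    (hx : x ≠ 0) : ∇ (fun y => h (K y)) x = deriv h (K x) • ∇ K x := by
  rw [gradient, fderiv_profile_comp hh hK hx, map_smul]; rfl

lemma IsRegularProfile.exists_lipschitzOnWith_comp (hh : IsRegularProfile h)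
    (hK : IsEikonalSolution p lam K) {x : 𝔼} (hx : x ≠ 0) :
    ∃ L : NNReal, ∃ U ∈ 𝓝 x, LipschitzOnWith L (fun y => deriv h (K y)) U := by
  obtain ⟨L1, hL1⟩ := hh.lipschitz (2 * K x)
  have hKc : ContDiffAt ℝ 1 K x := (hK.smooth.contDiffAt_of_ne hx).of_le (by simp)
  obtain ⟨L2, U, hU, hL2⟩ := hKc.exists_lipschitzOnWith
  have hpos := hK.pos x hx
  have hV : K ⁻¹' Ioc 0 (2 * K x) ∈ 𝓝 x :=
    hK.continuous.continuousAt.preimage_mem_nhds (Ioc_mem_nhds hpos (by linarith))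
  refine ⟨L1 * L2, U ∩ K ⁻¹' Ioc 0 (2 * K x), inter_mem hU hV, ?_⟩
  exact hL1.comp (hL2.mono inter_subset_left) fun y hy => hy.2

/-- The product of `h'(K)` with a smooth function supported away from the origin. -/
lemma IsRegularProfile.locallyLipschitz_smul {Y : Type*} [NormedAddCommGroup Y] [NormedSpace ℝ Y]
    (hh : IsRegularProfile h) (hK : IsEikonalSolution p lam K) {σ : 𝔼 → Y}
    (hσ : ContDiffOn ℝ ∞ σ {0}ᶜ) (h0 : (0 : 𝔼) ∉ tsupport σ) :
    LocallyLipschitz (fun x => deriv h (K x) • σ x) := by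
  intro x
  by_cases hx : x ∈ tsupport σ
  · have hx0 : x ≠ 0 := by rintro rfl; exact h0 hx
    obtain ⟨L1, U1, hU1, hL1⟩ := hh.exists_lipschitzOnWith_comp hK hx0
    obtain ⟨L2, U2, hU2, hL2⟩ :=
      ((hσ.contDiffAt_of_ne hx0).of_le (by simp : (1 : WithTop ℕ∞) ≤ ∞)).exists_lipschitzOnWith
    have hs : ContDiff ℝ 1 (fun z : ℝ × Y => z.1 • z.2) := contDiff_fst.smul contDiff_snd
    obtain ⟨L3, U3, hU3, hL3⟩ := hs.locallyLipschitz (deriv h (K x), σ x)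
    set P : 𝔼 → ℝ × Y := fun y => (deriv h (K y), σ y) with hP
    have hPL : LipschitzOnWith (max L1 L2) P (U1 ∩ U2) :=
      (hL1.mono inter_subset_left).prodMk (hL2.mono inter_subset_right)
    have hPc : ContinuousAt P x := hPL.continuousOn.continuousAt (inter_mem hU1 hU2)
    refine ⟨L3 * max L1 L2, U1 ∩ U2 ∩ P ⁻¹' U3,
      inter_mem (inter_mem hU1 hU2) (hPc.preimage_mem_nhds hU3), ?_⟩
    exact hL3.comp (hPL.mono inter_subset_left) fun y hy => hy.2
  · have h1 : σ =ᶠ[𝓝 x] fun _ => 0 := notMem_tsupport_iff_eventuallyEq.1 hx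
    refine ⟨0, _, h1, ?_⟩
    refine LipschitzOnWith.of_dist_le_mul fun y hy z hz => ?_
    have e1 : σ y = 0 := hy
    have e2 : σ z = 0 := hz
    simp [e1, e2]

/-- At a point of differentiability of `h'(K)`, the chain rule holds. -/
lemma hasFDerivAt_deriv_comp (hK : IsEikonalSolution p lam K) {x : 𝔼} (hx : x ≠ 0)
    (hN : ∇ K x ≠ 0) (hd : DifferentiableAt ℝ (fun y => deriv h (K y)) x) :
    HasFDerivAt (fun y => deriv h (K y)) (deriv (deriv h) (K x) • fderiv ℝ K x) x := by
  -- Along `x + t v` the function `K` has slope one at `t = 0`, so it has a local inverse `m` there.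
  -- Near `K x`, `h'` is then `h'(K)` composed with the curve `s ↦ x + m s • v`, and is
  -- differentiable at `K x`. So differentiability passes from the composition to `h'` itself.
  set v := (‖∇ K x‖ ^ 2)⁻¹ • ∇ K x with hv
  have hv1 : fderiv ℝ K x v = 1 := by
    rw [← inner_gradient, hv, real_inner_smul_right, real_inner_self_eq_norm_sq,
      inv_mul_cancel₀ (by positivity)]
  have hl : HasStrictDerivAt (fun t : ℝ => x + t • v) v 0 := by
    simpa using ((hasStrictDerivAt_id (0 : ℝ)).smul_const v).const_add x
  have hKs : HasStrictFDerivAt K (fderiv ℝ K x) (x + (0 : ℝ) • v) := by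
    rw [zero_smul, add_zero]
    exact (hK.smooth.contDiffAt_of_ne hx).hasStrictFDerivAt (by simp)
  have hk : HasStrictDerivAt (fun t : ℝ => K (x + t • v)) 1 0 := by
    have := hKs.comp_hasStrictDerivAt (0 : ℝ) hl
    rwa [hv1] at this
  set m := hk.localInverse _ _ _ one_ne_zero with hm
  have hmd := (hk.to_localInverse one_ne_zero).hasDerivAt
  have hminv : ∀ᶠ s in 𝓝 (K (x + (0 : ℝ) • v)), K (x + m s • v) = s :=
    (hk.hasStrictFDerivAt_equiv one_ne_zero).eventually_right_inverse
  have hm0 : m (K (x + (0 : ℝ) • v)) = 0 :=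
    (hk.hasStrictFDerivAt_equiv one_ne_zero).localInverse_apply_image
  rw [zero_smul, add_zero] at hminv hm0 hmd
  have hdiff : DifferentiableAt ℝ (fun s => deriv h (K (x + m s • v))) (K x) := by
    have h1 : DifferentiableAt ℝ (fun s => x + m s • v) (K x) :=
      (hmd.differentiableAt.smul_const v).const_add x
    have h2 : DifferentiableAt ℝ (fun y => deriv h (K y)) (x + m (K x) • v) := by
      rw [hm0, zero_smul, add_zero]; exact hd
    exact h2.comp (K x) h1
  have hdiff' : DifferentiableAt ℝ (deriv h) (K x) := by
    refine hdiff.congr_of_eventuallyEq ?_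
    filter_upwards [hminv] with s hs
    rw [hs]
  exact hdiff'.hasDerivAt.comp_hasFDerivAt x (hK.differentiableAt hx).hasFDerivAt

end Profile

/-! ### Cutoffs to annuli, with scale invariant bounds. -/

section Cutoff

variable {d : ℕ}

local notation "𝔼" => EuclideanSpace ℝ (Fin d)

/-- Smooth cutoffs to the annulus of radii `1 / (n + 1)` and `2 (n + 1)`. -/
noncomputable def annulusCutoff (n : ℕ) (x : 𝔼) : ℝ :=
  unitCutoff d (((n : ℝ) + 1)⁻¹ • x) * (1 - unitCutoff d (((n : ℝ) + 1) • x))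

lemma contDiff_annulusCutoff (n : ℕ) : ContDiff ℝ ∞ (annulusCutoff n : 𝔼 → ℝ) :=
  ((unitCutoff d).contDiff.comp (contDiff_id.const_smul _)).mul
    (contDiff_const.sub ((unitCutoff d).contDiff.comp (contDiff_id.const_smul _)))

lemma annulusCutoff_nonneg (n : ℕ) (x : 𝔼) : 0 ≤ annulusCutoff n x :=
  mul_nonneg (unitCutoff d).nonneg (sub_nonneg.2 (unitCutoff d).le_one)

lemma annulusCutoff_le_one (n : ℕ) (x : 𝔼) : annulusCutoff n x ≤ 1 :=
  mul_le_one₀ (unitCutoff d).le_one (sub_nonneg.2 (unitCutoff d).le_one)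
    (by linarith [(unitCutoff d).nonneg (x := ((n : ℝ) + 1) • x)])

lemma zero_notMem_tsupport_annulusCutoff (n : ℕ) :
    (0 : 𝔼) ∉ tsupport (annulusCutoff n : 𝔼 → ℝ) := by
  rw [notMem_tsupport_iff_eventuallyEq]
  have hn : (0 : ℝ) < (n : ℝ) + 1 := by positivity
  filter_upwards [Metric.ball_mem_nhds (0 : 𝔼) (inv_pos.2 hn)] with x hx
  rw [mem_ball_zero_iff] at hx
  have h1 : unitCutoff d (((n : ℝ) + 1) • x) = 1 := by
    refine (unitCutoff d).one_of_mem_closedBall ?_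
    rw [mem_closedBall_zero_iff, norm_smul, Real.norm_of_nonneg hn.le]
    change _ ≤ (1 : ℝ)
    rw [← le_div_iff₀' hn, one_div]
    exact hx.le
  simp [annulusCutoff, h1]

lemma hasCompactSupport_annulusCutoff (n : ℕ) :
    HasCompactSupport (annulusCutoff n : 𝔼 → ℝ) := by
  have hn : (0 : ℝ) < (n : ℝ) + 1 := by positivity
  refine HasCompactSupport.intro (isCompact_closedBall (0 : 𝔼) (2 * ((n : ℝ) + 1))) fun x hx => ?_
  have hx2 : 2 * ((n : ℝ) + 1) < ‖x‖ := by simpa using hx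
  have h1 : unitCutoff d (((n : ℝ) + 1)⁻¹ • x) = 0 := by
    refine (unitCutoff d).zero_of_le_dist ?_
    rw [dist_zero_right, norm_smul, Real.norm_of_nonneg (by positivity)]
    change (2 : ℝ) ≤ _
    rw [← div_eq_inv_mul, le_div_iff₀ hn]
    exact hx2.le
  simp [annulusCutoff, h1]

/-- The derivative has size `c` but vanishes for `c ‖x‖ > 2`, and `c ≤ 2 / ‖x‖` elsewhere. The bound
is therefore independent of the dilation. -/
lemma abs_fderiv_unitCutoff_smul_le {M : ℝ}
    (hM : ∀ x v : 𝔼, |fderiv ℝ (unitCutoff d) x v| ≤ M * ‖v‖) (hM0 : 0 ≤ M) {c : ℝ} (hc : 0 < c)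
    {x : 𝔼} (hx : x ≠ 0) (v : 𝔼) :
    |fderiv ℝ (fun y => unitCutoff d (c • y)) x v| ≤ 2 * M * ‖v‖ / ‖x‖ := by
  have hd : DifferentiableAt ℝ (unitCutoff d) (c • x) :=
    (unitCutoff d).contDiff.differentiable (n := 1) one_ne_zero _
  have hl : HasFDerivAt (fun y : 𝔼 => c • y) (c • ContinuousLinearMap.id ℝ 𝔼) x :=
    (hasFDerivAt_id x).const_smul c
  have h1 : fderiv ℝ (fun y => unitCutoff d (c • y)) x v = c * fderiv ℝ (unitCutoff d) (c • x) v := by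
    have := (hd.hasFDerivAt.comp x hl).fderiv
    change fderiv ℝ (unitCutoff d ∘ fun y => c • y) x v = _
    rw [this]; simp
  have hx0 := norm_pos_iff.2 hx
  rw [h1]
  rcases le_or_gt ‖c • x‖ 2 with h2 | h2
  · rw [norm_smul, Real.norm_of_nonneg hc.le] at h2
    rw [abs_mul, abs_of_pos hc, le_div_iff₀ hx0]
    calc c * |fderiv ℝ (unitCutoff d) (c • x) v| * ‖x‖ ≤ c * (M * ‖v‖) * ‖x‖ := by
          gcongr; exact hM _ _
      _ = (c * ‖x‖) * (M * ‖v‖) := by ring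
      _ ≤ 2 * (M * ‖v‖) := by gcongr
      _ = _ := by ring
  · rw [fderiv_unitCutoff_of_gt h2]
    simp only [zero_apply, mul_zero, abs_zero]
    positivity

lemma exists_fderiv_annulusCutoff_bound (d : ℕ) : ∃ M : ℝ, 0 ≤ M ∧
    ∀ (n : ℕ) (x : EuclideanSpace ℝ (Fin d)), x ≠ 0 →
      ‖fderiv ℝ (annulusCutoff n) x‖ ≤ M / ‖x‖ := by
  obtain ⟨M, hM0, hM⟩ := exists_fderiv_unitCutoff_bound d
  refine ⟨4 * M, by positivity, fun n x hx => ?_⟩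
  refine ContinuousLinearMap.opNorm_le_bound _ (by positivity) fun v => ?_
  have hn : (0 : ℝ) < (n : ℝ) + 1 := by positivity
  have hs : ∀ c : ℝ, DifferentiableAt ℝ (fun y : EuclideanSpace ℝ (Fin d) =>
      unitCutoff d (c • y)) x := fun c =>
    ((unitCutoff d).contDiff (n := 1).comp (contDiff_id.const_smul c)).differentiable one_ne_zero x
  have e : fderiv ℝ (annulusCutoff n) x v
      = unitCutoff d (((n : ℝ) + 1)⁻¹ • x) *
          -(fderiv ℝ (fun y => unitCutoff d (((n : ℝ) + 1) • y)) x v)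
        + (1 - unitCutoff d (((n : ℝ) + 1) • x)) *
          fderiv ℝ (fun y => unitCutoff d (((n : ℝ) + 1)⁻¹ • y)) x v := by
    have h2 := (hs (((n : ℝ) + 1)⁻¹)).hasFDerivAt.mul
      ((hasFDerivAt_const (1 : ℝ) x).sub (hs ((n : ℝ) + 1)).hasFDerivAt)
    have h3 : HasFDerivAt (annulusCutoff n) _ x := h2
    rw [h3.fderiv]
    simp
  have b1 := abs_fderiv_unitCutoff_smul_le hM hM0 hn hx v
  have b2 := abs_fderiv_unitCutoff_smul_le hM hM0 (inv_pos.2 hn) hx v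
  have c1 : |unitCutoff d (((n : ℝ) + 1)⁻¹ • x)| ≤ 1 := by
    rw [abs_of_nonneg (unitCutoff d).nonneg]; exact (unitCutoff d).le_one
  have c2 : |1 - unitCutoff d (((n : ℝ) + 1) • x)| ≤ 1 := by
    rw [abs_of_nonneg (sub_nonneg.2 (unitCutoff d).le_one)]
    linarith [(unitCutoff d).nonneg (x := ((n : ℝ) + 1) • x)]
  rw [e, Real.norm_eq_abs]
  refine (abs_add_le _ _).trans ?_
  rw [abs_mul, abs_mul, abs_neg]
  calc _ ≤ 1 * (2 * M * ‖v‖ / ‖x‖) + 1 * (2 * M * ‖v‖ / ‖x‖) := by gcongr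
    _ = _ := by ring

/-- Equality holds on a neighbourhood of `x`, so the differential of the cutoff at `x` is eventually
zero as well. -/
lemma eventually_annulusCutoff_eq_one {x : 𝔼} (hx : x ≠ 0) :
    ∀ᶠ n : ℕ in atTop, annulusCutoff n =ᶠ[𝓝 x] fun _ => (1 : ℝ) := by
  have hx0 := norm_pos_iff.2 hx
  obtain ⟨N1, hN1⟩ := exists_nat_gt ‖x‖
  obtain ⟨N2, hN2⟩ := exists_nat_gt (2 / ‖x‖)
  filter_upwards [eventually_ge_atTop (max N1 N2)] with n hn
  have hn1 : ‖x‖ < (n : ℝ) + 1 := by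
    have : (N1 : ℝ) ≤ n := by exact_mod_cast (le_max_left _ _).trans hn
    linarith
  have hn2 : 2 / ((n : ℝ) + 1) < ‖x‖ := by
    have : (N2 : ℝ) ≤ n := by exact_mod_cast (le_max_right _ _).trans hn
    rw [div_lt_iff₀ (by positivity)]
    rw [div_lt_iff₀ hx0] at hN2
    nlinarith
  have hpos : (0 : ℝ) < (n : ℝ) + 1 := by positivity
  have o1 : {y : 𝔼 | ‖y‖ < (n : ℝ) + 1} ∈ 𝓝 x :=
    (isOpen_lt continuous_norm continuous_const).mem_nhds hn1
  have o2 : {y : 𝔼 | 2 / ((n : ℝ) + 1) < ‖y‖} ∈ 𝓝 x :=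
    (isOpen_lt continuous_const continuous_norm).mem_nhds hn2
  filter_upwards [o1, o2] with y hy1 hy2
  have h1 : unitCutoff d (((n : ℝ) + 1)⁻¹ • y) = 1 := by
    refine (unitCutoff d).one_of_mem_closedBall ?_
    rw [mem_closedBall_zero_iff, norm_smul, Real.norm_of_nonneg (by positivity), ← div_eq_inv_mul]
    change _ ≤ (1 : ℝ)
    rw [div_le_one hpos]
    exact le_of_lt hy1
  have h2 : unitCutoff d (((n : ℝ) + 1) • y) = 0 := by
    refine (unitCutoff d).zero_of_le_dist ?_
    rw [dist_zero_right, norm_smul, Real.norm_of_nonneg hpos.le]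
    change (2 : ℝ) ≤ _
    have h3 : 2 / ((n : ℝ) + 1) < ‖y‖ := hy2
    rw [div_lt_iff₀ hpos] at h3
    linarith
  simp [annulusCutoff, h1, h2]

lemma contDiff_annulusCutoff_smul {Y : Type*} [NormedAddCommGroup Y] [NormedSpace ℝ Y] {σ : 𝔼 → Y}
    (hσ : ContDiffOn ℝ ∞ σ {0}ᶜ) (n : ℕ) :
    ContDiffOn ℝ ∞ (fun x => annulusCutoff n x • σ x) {0}ᶜ :=
  (contDiff_annulusCutoff n).contDiffOn.smul hσ

lemma tsupport_annulusCutoff_smul_subset {Y : Type*} [NormedAddCommGroup Y] [NormedSpace ℝ Y]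
    (σ : 𝔼 → Y) (n : ℕ) :
    tsupport (fun x => annulusCutoff n x • σ x) ⊆ tsupport (annulusCutoff n : 𝔼 → ℝ) :=
  closure_mono fun x hx h => hx (by simp only [h, zero_smul])

end Cutoff

/-! ### Almost everywhere differentiability of `h'(K)`. -/

section AeDifferentiable

variable {d : ℕ} {h : ℝ → ℝ} {p K : EuclideanSpace ℝ (Fin d) → ℝ} {lam : ℝ}

local notation "𝔼" => EuclideanSpace ℝ (Fin d)

lemma ae_ne_zero (hd : 3 ≤ d) : ∀ᵐ x : 𝔼, x ≠ 0 := by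
  have hd0 : Nonempty (Fin d) := ⟨⟨0, by omega⟩⟩
  simp [ae_iff, measure_singleton]

/-- Rademacher's theorem for the product with each annulus cutoff. The exceptional sets are
countably many, and near any `x ≠ 0` some cutoff is one. -/
lemma ae_differentiableAt_deriv_comp (hd : 3 ≤ d) (hh : IsRegularProfile h)
    (hK : IsEikonalSolution p lam K) :
    ∀ᵐ x : 𝔼, DifferentiableAt ℝ (fun y => deriv h (K y)) x := by
  have h1 : ∀ n : ℕ, ∀ᵐ x : 𝔼,
      DifferentiableAt ℝ (fun y => deriv h (K y) • annulusCutoff n y) x := fun n =>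
    (hh.locallyLipschitz_smul hK (contDiff_annulusCutoff n).contDiffOn
      (zero_notMem_tsupport_annulusCutoff n)).ae_differentiableAt
      ((hasCompactSupport_annulusCutoff n).mono fun x hx h0 => hx (by simp only [h0, smul_zero]))
  filter_upwards [ae_all_iff.2 h1, ae_ne_zero hd] with x hx hx0
  obtain ⟨n, hn⟩ := (eventually_annulusCutoff_eq_one hx0).exists
  refine (hx n).congr_of_eventuallyEq ?_
  filter_upwards [hn] with y hy
  simp [hy]

end AeDifferentiable

/-! ### The equation for the real and imaginary parts of `u`. -/

section ComplexToReal

variable {d : ℕ}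

local notation "𝔼" => EuclideanSpace ℝ (Fin d)
local notation "𝔼ℂ" => EuclideanSpace ℂ (Fin d)

/-- The real part of a complex vector. -/
noncomputable def reVec (z : 𝔼ℂ) : 𝔼 := WithLp.toLp 2 fun i => (z i).re

/-- The imaginary part of a complex vector. -/
noncomputable def imVec (z : 𝔼ℂ) : 𝔼 := WithLp.toLp 2 fun i => (z i).im

@[simp] lemma reVec_apply (z : 𝔼ℂ) (i : Fin d) : reVec z i = (z i).re := rfl

@[simp] lemma imVec_apply (z : 𝔼ℂ) (i : Fin d) : imVec z i = (z i).im := rfl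

lemma rdot_re (v : 𝔼) (z : 𝔼ℂ) : (rdot v z).re = inner ℝ v (reVec z) := by
  rw [rdot, Complex.re_sum, PiLp.inner_apply]
  exact Finset.sum_congr rfl fun i _ => by simp [mul_comm]

lemma rdot_im (v : 𝔼) (z : 𝔼ℂ) : (rdot v z).im = inner ℝ v (imVec z) := by
  rw [rdot, Complex.im_sum, PiLp.inner_apply]
  exact Finset.sum_congr rfl fun i _ => by simp [mul_comm]

lemma norm_sq_eq_reVec_imVec (z : 𝔼ℂ) : ‖z‖ ^ 2 = ‖reVec z‖ ^ 2 + ‖imVec z‖ ^ 2 := by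
  rw [EuclideanSpace.norm_sq_eq, EuclideanSpace.real_norm_sq_eq, EuclideanSpace.real_norm_sq_eq,
    ← Finset.sum_add_distrib]
  refine Finset.sum_congr rfl fun i _ => ?_
  rw [Complex.sq_norm, Complex.normSq_apply, reVec_apply, imVec_apply]
  ring

lemma norm_reVec_le (z : 𝔼ℂ) : ‖reVec z‖ ≤ ‖z‖ := by
  have := norm_sq_eq_reVec_imVec z
  exact (pow_le_pow_iff_left₀ (norm_nonneg _) (norm_nonneg _) two_ne_zero).1
    (by linarith [sq_nonneg ‖imVec z‖])

lemma norm_imVec_le (z : 𝔼ℂ) : ‖imVec z‖ ≤ ‖z‖ := by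
  have := norm_sq_eq_reVec_imVec z
  exact (pow_le_pow_iff_left₀ (norm_nonneg _) (norm_nonneg _) two_ne_zero).1
    (by linarith [sq_nonneg ‖reVec z‖])

lemma continuous_reVec : Continuous (reVec : 𝔼ℂ → 𝔼) := by
  unfold reVec
  fun_prop

lemma continuous_imVec : Continuous (imVec : 𝔼ℂ → 𝔼) := by
  unfold imVec
  fun_prop

lemma memLp_two_of_locallyIntegrable_sq {Y : Type*} [NormedAddCommGroup Y] {y : 𝔼 → Y}
    (hy : AEStronglyMeasurable y volume) (h : LocallyIntegrable (fun x => ‖y x‖ ^ 2) volume)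
    {T : Set 𝔼} (hT : IsCompact T) : MemLp y 2 (volume.restrict T) :=
  (memLp_two_iff_integrable_sq_norm hy.restrict).2 (h.integrableOn_isCompact hT)

lemma integrable_mul_of_memLp {y : 𝔼 → ℂ} {φ : 𝔼 → ℝ} {T : Set 𝔼} (hT : IsCompact T)
    (hy : MemLp y 2 (volume.restrict T)) (hφ : Continuous φ) (hs : tsupport φ ⊆ T) :
    Integrable (fun x => y x * (φ x : ℂ)) := by
  have hfin : IsFiniteMeasure (volume.restrict T) := ⟨by
    rw [Measure.restrict_apply_univ]; exact hT.measure_lt_top⟩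
  have hc : HasCompactSupport φ := hT.of_isClosed_subset (isClosed_tsupport φ) hs
  obtain ⟨M, hM⟩ := hc.exists_bound_of_continuous hφ
  have h1 : IntegrableOn (fun x => y x * (φ x : ℂ)) T :=
    (hy.integrable (by norm_num)).mul_bdd (c := M)
      (Complex.continuous_ofReal.comp hφ).aestronglyMeasurable
      (Eventually.of_forall fun x => by simpa using hM x)
  refine h1.integrable_of_forall_notMem_eq_zero fun x hx => ?_
  simp [image_eq_zero_of_notMem_tsupport fun h => hx (hs h)]

lemma contDiff_fderiv_apply {φ : 𝔼 → ℝ} (hφ : ContDiff ℝ ∞ φ) (v : 𝔼) :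
    Continuous fun x => fderiv ℝ φ x v := by
  have := hφ.continuous_fderiv (by simp)
  fun_prop

lemma tsupport_fderiv_apply_subset' (φ : 𝔼 → ℝ) (v : 𝔼) :
    tsupport (fun x => fderiv ℝ φ x v) ⊆ tsupport φ :=
  tsupport_fderiv_apply_subset ℝ v

lemma IsH1LocWithGradient.memLp {u : 𝔼 → ℂ} {G : 𝔼 → 𝔼ℂ} (hu : IsH1LocWithGradient u G)
    {T : Set 𝔼} (hT : IsCompact T) : MemLp u 2 (volume.restrict T) :=
  memLp_two_of_locallyIntegrable_sq hu.meas hu.sq hT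

lemma IsH1LocWithGradient.memLp_grad {u : 𝔼 → ℂ} {G : 𝔼 → 𝔼ℂ} (hu : IsH1LocWithGradient u G)
    {T : Set 𝔼} (hT : IsCompact T) : MemLp G 2 (volume.restrict T) :=
  memLp_two_of_locallyIntegrable_sq hu.meas_grad hu.sq_grad hT

lemma IsH1LocWithGradient.memLp_coord {u : 𝔼 → ℂ} {G : 𝔼 → 𝔼ℂ} (hu : IsH1LocWithGradient u G)
    {T : Set 𝔼} (hT : IsCompact T) (i : Fin d) :
    MemLp (fun x => G x i) 2 (volume.restrict T) :=
  (hu.memLp_grad hT).mono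
    ((EuclideanSpace.proj (𝕜 := ℂ) i).continuous.comp_aestronglyMeasurable hu.meas_grad.restrict)
    (Eventually.of_forall fun x => PiLp.norm_apply_le (p := 2) (G x) i)

lemma IsH1LocWithGradient.hasWeakGradient_re {u : 𝔼 → ℂ} {G : 𝔼 → 𝔼ℂ}
    (hu : IsH1LocWithGradient u G) :
    HasWeakGradient (fun x => (u x).re) (fun x => reVec (G x)) := by
  refine ⟨fun T hT => (hu.memLp hT).re, fun T hT => ?_, fun φ hφ hc i => ?_⟩
  · exact (hu.memLp_grad hT).mono
      (continuous_reVec.comp_aestronglyMeasurable hu.meas_grad.restrict)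
      (Eventually.of_forall fun x => norm_reVec_le _)
  · have h1 := congrArg Complex.re (hu.weak φ hφ hc i)
    have i1 := integrable_mul_of_memLp hc.isCompact (hu.memLp hc.isCompact)
      (contDiff_fderiv_apply hφ (EuclideanSpace.single i 1))
      (tsupport_fderiv_apply_subset' φ _)
    have i2 := integrable_mul_of_memLp hc.isCompact (hu.memLp_coord hc.isCompact i)
      hφ.continuous subset_rfl
    simp only [gradient_apply] at h1
    rw [Complex.neg_re, ← RCLike.re_eq_complex_re, ← integral_re i1, ← integral_re i2] at h1
    simpa using h1

lemma IsH1LocWithGradient.hasWeakGradient_im {u : 𝔼 → ℂ} {G : 𝔼 → 𝔼ℂ}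
    (hu : IsH1LocWithGradient u G) :
    HasWeakGradient (fun x => (u x).im) (fun x => imVec (G x)) := by
  refine ⟨fun T hT => (hu.memLp hT).im, fun T hT => ?_, fun φ hφ hc i => ?_⟩
  · exact (hu.memLp_grad hT).mono
      (continuous_imVec.comp_aestronglyMeasurable hu.meas_grad.restrict)
      (Eventually.of_forall fun x => norm_imVec_le _)
  · have h1 := congrArg Complex.im (hu.weak φ hφ hc i)
    have i1 := integrable_mul_of_memLp hc.isCompact (hu.memLp hc.isCompact)
      (contDiff_fderiv_apply hφ (EuclideanSpace.single i 1))
      (tsupport_fderiv_apply_subset' φ _)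
    have i2 := integrable_mul_of_memLp hc.isCompact (hu.memLp_coord hc.isCompact i)
      hφ.continuous subset_rfl
    simp only [gradient_apply] at h1
    rw [Complex.neg_im, ← RCLike.im_eq_complex_im, ← integral_im i1, ← integral_im i2] at h1
    simpa using h1

/-- The weight that measures the singularity at the origin. -/
noncomputable def singularWeight (x : 𝔼) : ℝ := max 1 ‖x‖⁻¹

lemma one_le_singularWeight (x : 𝔼) : 1 ≤ singularWeight x := le_max_left _ _

lemma inv_norm_le_singularWeight (x : 𝔼) : ‖x‖⁻¹ ≤ singularWeight x := le_max_right _ _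

lemma singularWeight_of_one_le {x : 𝔼} (hx : 1 ≤ ‖x‖) : singularWeight x = 1 :=
  max_eq_left (inv_le_one_of_one_le₀ hx)

lemma singularWeight_of_le_one {x : 𝔼} (hx : x ≠ 0) (h1 : ‖x‖ ≤ 1) : singularWeight x = ‖x‖⁻¹ :=
  max_eq_right ((one_le_inv₀ (norm_pos_iff.2 hx)).2 h1)

/-- In both cases `Q` is at most of size `|x|⁻²` near the origin, the singularity that Hardy's
inequality absorbs against `|u|²`; for `d = 3` this uses `‖x‖ ≤ 1`. -/
lemma IsAdmissiblePotential.exists_singular_bound {p Q : 𝔼 → ℝ} {δ : ℝ} (hd : 3 ≤ d)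
    (h : IsAdmissiblePotential d p Q δ) (hδ : 0 < δ) :
    ∃ C, 0 ≤ C ∧ ∀ x, x ≠ 0 → |Q x| ≤ C * singularWeight x ^ 2 := by
  obtain ⟨C1, hC1⟩ := h.far
  have hnear : ∃ C2, ∀ x, x ≠ 0 → ‖x‖ ≤ 1 → |Q x| ≤ C2 * ‖x‖ ^ (-2 : ℝ) := by
    rcases hd.eq_or_lt with h3 | h3
    · obtain ⟨C, hC⟩ := h.near_three h3.symm
      refine ⟨|C|, fun x hx hx1 => (hC x hx hx1).trans ?_⟩
      have h4 : ‖x‖ ^ (-(2 - δ)) ≤ ‖x‖ ^ (-2 : ℝ) :=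
        Real.rpow_le_rpow_of_exponent_ge (norm_pos_iff.2 hx) hx1 (by linarith)
      exact mul_le_mul (le_abs_self _) h4 (by positivity) (abs_nonneg _)
    · exact h.near h3
  obtain ⟨C2, hC2⟩ := hnear
  refine ⟨max |C1| |C2|, le_max_of_le_left (abs_nonneg _), fun x hx => ?_⟩
  rcases le_total ‖x‖ 1 with h1 | h1
  · rw [singularWeight_of_le_one hx h1]
    have h2 : ‖x‖ ^ (-2 : ℝ) = ‖x‖⁻¹ ^ 2 := by
      rw [Real.rpow_neg (norm_nonneg _), inv_pow]; norm_num
    refine (hC2 x hx h1).trans ?_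
    rw [h2]
    gcongr
    exact (le_abs_self _).trans (le_max_right _ _)
  · rw [singularWeight_of_one_le h1]
    refine (hC1 x h1).trans ?_
    have h2 : ‖x‖ ^ (-(3 + δ)) ≤ 1 := Real.rpow_le_one_of_one_le_of_nonpos h1 (by linarith)
    calc C1 * ‖x‖ ^ (-(3 + δ)) ≤ |C1| * 1 := by
          gcongr; exact le_abs_self _
      _ ≤ max |C1| |C2| * 1 ^ 2 := by
          rw [one_pow]; gcongr; exact le_max_left _ _

/-- The right-hand side of `Δu = f - (p + Q + λ + iε) u`. -/
noncomputable def helmholtzSource (p Q : 𝔼 → ℝ) (lam ε : ℝ) (f u : 𝔼 → ℂ) (x : 𝔼) : ℂ :=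
  f x - ((p x : ℂ) + (Q x : ℂ) + (lam : ℂ) + Complex.I * (ε : ℂ)) * u x

section

variable {p Q : EuclideanSpace ℝ (Fin d) → ℝ} {lam ε δ : ℝ} {f u : EuclideanSpace ℝ (Fin d) → ℂ}
  {G : EuclideanSpace ℝ (Fin d) → EuclideanSpace ℂ (Fin d)}

/-- On a compact set missing the origin the potential is bounded. At the origin `Q u` need not be
square integrable, which is why the divergence of `∇u` is considered only off the origin. -/
lemma memLp_potential_mul (hd : 3 ≤ d) (hpQ : IsAdmissiblePotential d p Q δ) (hδ : 0 < δ)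
    (lam ε : ℝ) (hu : IsH1LocWithGradient u G) {T : Set 𝔼} (hT : IsCompact T)
    (h0 : (0 : 𝔼) ∉ T) :
    MemLp (fun x => ((p x : ℂ) + (Q x : ℂ) + (lam : ℂ) + Complex.I * (ε : ℂ)) * u x) 2
      (volume.restrict T) := by
  obtain ⟨M, hM0, hM, -⟩ := hpQ.exists_bound hδ
  obtain ⟨C, hC0, hC⟩ := hpQ.exists_singular_bound hd hδ
  have hcont : ContinuousOn (singularWeight : 𝔼 → ℝ) T := by
    refine continuousOn_const.sup (continuous_norm.continuousOn.inv₀ fun x hx => ?_)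
    rw [norm_ne_zero_iff]; rintro rfl; exact h0 hx
  obtain ⟨W, hW⟩ := hT.exists_bound_of_continuousOn hcont
  have hm : AEStronglyMeasurable
      (fun x => ((p x : ℂ) + (Q x : ℂ) + (lam : ℂ) + Complex.I * (ε : ℂ)) * u x)
      (volume.restrict T) := by
    have h1 : AEStronglyMeasurable (fun x => (p x : ℂ)) volume :=
      (Complex.continuous_ofReal.comp hpQ.smooth.continuous).aestronglyMeasurable
    have h2 : AEStronglyMeasurable (fun x => (Q x : ℂ)) volume :=
      Complex.continuous_ofReal.comp_aestronglyMeasurable hpQ.measurable.aestronglyMeasurable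
    have h3 := ((h1.add h2).add (aestronglyMeasurable_const (b := (lam : ℂ)))).add
      (aestronglyMeasurable_const (b := Complex.I * (ε : ℂ)))
    exact (h3.mul hu.meas).restrict
  refine ((hu.memLp hT).norm.const_mul (M + C * W ^ 2 + |lam| + |ε|)).mono hm ?_
  refine (ae_restrict_iff' hT.measurableSet).2 (Eventually.of_forall fun x hx => ?_)
  have hx0 : x ≠ 0 := by rintro rfl; exact h0 hx
  have hWx : singularWeight x ≤ W := (le_abs_self _).trans (hW x hx)
  have hs0 : 0 ≤ singularWeight x := zero_le_one.trans (one_le_singularWeight x)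
  have hW0 : 0 ≤ W := hs0.trans hWx
  have hQ : |Q x| ≤ C * W ^ 2 := (hC x hx0).trans (by gcongr)
  rw [norm_mul, norm_mul, norm_norm, Real.norm_of_nonneg (by positivity)]
  gcongr
  refine (norm_add_le _ _).trans (add_le_add ((norm_add_le _ _).trans (add_le_add
    ((norm_add_le _ _).trans (add_le_add ?_ ?_)) ?_)) ?_)
  · simpa using hM x
  · simpa using hQ
  · simp
  · simp

lemma memLp_helmholtzSource (hd : 3 ≤ d) (hpQ : IsAdmissiblePotential d p Q δ) (hδ : 0 < δ)
    (lam ε : ℝ) (hf : AEStronglyMeasurable f volume)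
    (hf2 : LocallyIntegrable (fun x => ‖f x‖ ^ 2) volume) (hu : IsH1LocWithGradient u G)
    {T : Set 𝔼} (hT : IsCompact T) (h0 : (0 : 𝔼) ∉ T) :
    MemLp (helmholtzSource p Q lam ε f u) 2 (volume.restrict T) :=
  (memLp_two_of_locallyIntegrable_sq hf hf2 hT).sub
    (memLp_potential_mul hd hpQ hδ lam ε hu hT h0)

lemma IsHelmholtzSolution.integral_rdot (hd : 3 ≤ d) (hpQ : IsAdmissiblePotential d p Q δ)
    (hδ : 0 < δ) (hf : AEStronglyMeasurable f volume)
    (hf2 : LocallyIntegrable (fun x => ‖f x‖ ^ 2) volume) (hu : IsH1LocWithGradient u G)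
    (hsol : IsHelmholtzSolution p Q lam ε f u G) {φ : 𝔼 → ℝ} (hφ : ContDiff ℝ ∞ φ)
    (hc : HasCompactSupport φ) (h0 : (0 : 𝔼) ∉ tsupport φ) :
    ∫ x, rdot (∇ φ x) (G x) = -∫ x, helmholtzSource p Q lam ε f u x * (φ x : ℂ) := by
  have i1 := integrable_mul_of_memLp hc.isCompact
    (memLp_two_of_locallyIntegrable_sq hf hf2 hc.isCompact) hφ.continuous subset_rfl
  have i2 := integrable_mul_of_memLp hc.isCompact
    (memLp_potential_mul hd hpQ hδ lam ε hu hc.isCompact h0) hφ.continuous subset_rfl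
  have h1 := hsol φ hφ hc
  have h2 : ∫ x, helmholtzSource p Q lam ε f u x * (φ x : ℂ) = (∫ x, f x * (φ x : ℂ))
      - ∫ x, ((p x : ℂ) + (Q x : ℂ) + (lam : ℂ) + Complex.I * (ε : ℂ)) * u x * (φ x : ℂ) := by
    rw [← integral_sub i1 i2]
    exact integral_congr_ae (Eventually.of_forall fun x => by
      simp only [helmholtzSource]; ring)
  rw [h2, ← h1]
  ring

lemma integrable_rdot_gradient (hu : IsH1LocWithGradient u G) {φ : 𝔼 → ℝ} (hφ : ContDiff ℝ ∞ φ)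
    (hc : HasCompactSupport φ) : Integrable (fun x => rdot (∇ φ x) (G x)) := by
  unfold rdot
  refine integrable_finsetSum _ fun i _ => ?_
  have := integrable_mul_of_memLp hc.isCompact (hu.memLp_coord hc.isCompact i)
    (contDiff_fderiv_apply hφ (EuclideanSpace.single i 1)) (tsupport_fderiv_apply_subset' φ _)
  simpa only [gradient_apply, mul_comm] using this

lemma IsHelmholtzSolution.hasWeakDivergence (hd : 3 ≤ d) (hpQ : IsAdmissiblePotential d p Q δ)
    (hδ : 0 < δ) (hf : AEStronglyMeasurable f volume)
    (hf2 : LocallyIntegrable (fun x => ‖f x‖ ^ 2) volume) (hu : IsH1LocWithGradient u G)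
    (hsol : IsHelmholtzSolution p Q lam ε f u G) :
    HasWeakDivergence (fun x => reVec (G x)) (fun x => (helmholtzSource p Q lam ε f u x).re) ∧
    HasWeakDivergence (fun x => imVec (G x)) (fun x => (helmholtzSource p Q lam ε f u x).im) := by
  have hm : ∀ T : Set 𝔼, IsCompact T → (0 : 𝔼) ∉ T →
      MemLp (helmholtzSource p Q lam ε f u) 2 (volume.restrict T) := fun T hT h0 =>
    memLp_helmholtzSource hd hpQ hδ lam ε hf hf2 hu hT h0
  refine ⟨⟨fun T hT h0 => (hm T hT h0).re, fun φ hφ hc h0 => ?_⟩,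
    ⟨fun T hT h0 => (hm T hT h0).im, fun φ hφ hc h0 => ?_⟩⟩
  · have h1 := congrArg Complex.re (hsol.integral_rdot hd hpQ hδ hf hf2 hu hφ hc h0)
    have i1 := integrable_mul_of_memLp hc.isCompact (hm _ hc.isCompact h0) hφ.continuous subset_rfl
    rw [Complex.neg_re, ← RCLike.re_eq_complex_re, ← integral_re i1,
      ← integral_re (integrable_rdot_gradient hu hφ hc)] at h1
    simpa [rdot_re, inner_gradient] using h1
  · have h1 := congrArg Complex.im (hsol.integral_rdot hd hpQ hδ hf hf2 hu hφ hc h0)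
    have i1 := integrable_mul_of_memLp hc.isCompact (hm _ hc.isCompact h0) hφ.continuous subset_rfl
    rw [Complex.neg_im, ← RCLike.im_eq_complex_im, ← integral_im i1,
      ← integral_im (integrable_rdot_gradient hu hφ hc)] at h1
    simpa [rdot_im, inner_gradient] using h1

end

end ComplexToReal

/-! ### Energy identities, and decay of the solution under absorption. -/

section WeightedEstimates

variable {d : ℕ} {p Q : EuclideanSpace ℝ (Fin d) → ℝ} {lam ε δ : ℝ}
  {f u : EuclideanSpace ℝ (Fin d) → ℂ} {G : EuclideanSpace ℝ (Fin d) → EuclideanSpace ℂ (Fin d)}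

local notation "𝔼" => EuclideanSpace ℝ (Fin d)

lemma sq_norm_eq_re_im (z : ℂ) : ‖z‖ ^ 2 = z.re ^ 2 + z.im ^ 2 := by
  rw [Complex.sq_norm, Complex.normSq_apply]; ring

lemma helmholtzSource_re (x : 𝔼) : (helmholtzSource p Q lam ε f u x).re
    = (f x).re - (p x + Q x + lam) * (u x).re + ε * (u x).im := by
  simp [helmholtzSource]; ring

lemma helmholtzSource_im (x : 𝔼) : (helmholtzSource p Q lam ε f u x).im
    = (f x).im - (p x + Q x + lam) * (u x).im - ε * (u x).re := by
  simp [helmholtzSource]; ring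

/-- The real part of the equation tested against `w ū`. -/
theorem IsHelmholtzSolution.integral_mul_conj_re (hd : 3 ≤ d)
    (hpQ : IsAdmissiblePotential d p Q δ) (hδ : 0 < δ) (hf : AEStronglyMeasurable f volume)
    (hf2 : LocallyIntegrable (fun x => ‖f x‖ ^ 2) volume) (hu : IsH1LocWithGradient u G)
    (hsol : IsHelmholtzSolution p Q lam ε f u G) {w : 𝔼 → ℝ} (hw : LocallyLipschitz w)
    (hc : HasCompactSupport w) (h0 : (0 : 𝔼) ∉ tsupport w) :
    Integrable (fun x => w x * ((f x).re * (u x).re + (f x).im * (u x).im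
        - (p x + Q x + lam) * ‖u x‖ ^ 2 + ‖G x‖ ^ 2)
      + (fderiv ℝ w x (reVec (G x)) * (u x).re + fderiv ℝ w x (imVec (G x)) * (u x).im)) ∧
    ∫ x, (w x * ((f x).re * (u x).re + (f x).im * (u x).im
        - (p x + Q x + lam) * ‖u x‖ ^ 2 + ‖G x‖ ^ 2)
      + (fderiv ℝ w x (reVec (G x)) * (u x).re + fderiv ℝ w x (imVec (G x)) * (u x).im)) = 0 := by
  obtain ⟨h1, h2⟩ := hsol.hasWeakDivergence hd hpQ hδ hf hf2 hu
  obtain ⟨i1, e1⟩ := hu.hasWeakGradient_re.greens_identity hu.hasWeakGradient_re h1 hw hc h0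
  obtain ⟨i2, e2⟩ := hu.hasWeakGradient_im.greens_identity hu.hasWeakGradient_im h2 hw hc h0
  have e3 := integral_add i1 i2
  rw [e1, e2, add_zero] at e3
  have key : ∀ x, w x * ((f x).re * (u x).re + (f x).im * (u x).im
        - (p x + Q x + lam) * ‖u x‖ ^ 2 + ‖G x‖ ^ 2)
      + (fderiv ℝ w x (reVec (G x)) * (u x).re + fderiv ℝ w x (imVec (G x)) * (u x).im)
      = (w x * (helmholtzSource p Q lam ε f u x).re * (u x).re
        + w x * inner ℝ (reVec (G x)) (reVec (G x)) + fderiv ℝ w x (reVec (G x)) * (u x).re)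
      + (w x * (helmholtzSource p Q lam ε f u x).im * (u x).im
        + w x * inner ℝ (imVec (G x)) (imVec (G x)) + fderiv ℝ w x (imVec (G x)) * (u x).im) := by
    intro x
    rw [helmholtzSource_re, helmholtzSource_im, sq_norm_eq_re_im, norm_sq_eq_reVec_imVec,
      real_inner_self_eq_norm_sq, real_inner_self_eq_norm_sq]
    ring
  simp only [key]
  exact ⟨i1.add i2, e3⟩

/-- The imaginary part of the equation tested against `w ū`, with the sign reversed. -/
theorem IsHelmholtzSolution.integral_mul_conj_im (hd : 3 ≤ d)
    (hpQ : IsAdmissiblePotential d p Q δ) (hδ : 0 < δ) (hf : AEStronglyMeasurable f volume)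
    (hf2 : LocallyIntegrable (fun x => ‖f x‖ ^ 2) volume) (hu : IsH1LocWithGradient u G)
    (hsol : IsHelmholtzSolution p Q lam ε f u G) {w : 𝔼 → ℝ} (hw : LocallyLipschitz w)
    (hc : HasCompactSupport w) (h0 : (0 : 𝔼) ∉ tsupport w) :
    Integrable (fun x => w x * ((f x).re * (u x).im - (f x).im * (u x).re + ε * ‖u x‖ ^ 2)
      + (fderiv ℝ w x (reVec (G x)) * (u x).im - fderiv ℝ w x (imVec (G x)) * (u x).re)) ∧
    ∫ x, (w x * ((f x).re * (u x).im - (f x).im * (u x).re + ε * ‖u x‖ ^ 2)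
      + (fderiv ℝ w x (reVec (G x)) * (u x).im - fderiv ℝ w x (imVec (G x)) * (u x).re)) = 0 := by
  obtain ⟨h1, h2⟩ := hsol.hasWeakDivergence hd hpQ hδ hf hf2 hu
  -- The equation for the real part is tested against the imaginary part and conversely. In the
  -- difference the products of the two gradients cancel.
  obtain ⟨i1, e1⟩ := hu.hasWeakGradient_re.greens_identity hu.hasWeakGradient_im h1 hw hc h0
  obtain ⟨i2, e2⟩ := hu.hasWeakGradient_im.greens_identity hu.hasWeakGradient_re h2 hw hc h0
  have e3 := integral_sub i1 i2
  rw [e1, e2, sub_zero] at e3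
  have key : ∀ x, w x * ((f x).re * (u x).im - (f x).im * (u x).re + ε * ‖u x‖ ^ 2)
      + (fderiv ℝ w x (reVec (G x)) * (u x).im - fderiv ℝ w x (imVec (G x)) * (u x).re)
      = (w x * (helmholtzSource p Q lam ε f u x).re * (u x).im
        + w x * inner ℝ (reVec (G x)) (imVec (G x)) + fderiv ℝ w x (reVec (G x)) * (u x).im)
      - (w x * (helmholtzSource p Q lam ε f u x).im * (u x).re
        + w x * inner ℝ (imVec (G x)) (reVec (G x)) + fderiv ℝ w x (imVec (G x)) * (u x).re) := by
    intro x
    rw [helmholtzSource_re, helmholtzSource_im, sq_norm_eq_re_im,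
      real_inner_comm (reVec (G x)) (imVec (G x))]
    ring
  simp only [key]
  exact ⟨i1.sub i2, e3⟩

lemma singularWeight_sq_le (x : 𝔼) (hx : x ≠ 0) :
    singularWeight x ^ 2 ≤ 1 + (Metric.closedBall (0 : 𝔼) 1).indicator (fun y => 1 / ‖y‖ ^ 2) x := by
  rcases le_total ‖x‖ 1 with h1 | h1
  · rw [singularWeight_of_le_one hx h1, indicator_of_mem (by simpa using h1), inv_pow, one_div]
    linarith
  · rw [singularWeight_of_one_le h1]
    have : 0 ≤ (Metric.closedBall (0 : 𝔼) 1).indicator (fun y => 1 / ‖y‖ ^ 2) x :=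
      indicator_nonneg (fun y _ => by positivity) x
    linarith

lemma measurable_singularWeight : Measurable (singularWeight : 𝔼 → ℝ) :=
  measurable_const.max measurable_norm.inv

/-- Outside the unit ball the singular weight is one. Inside, `g ≤ M` and Hardy's inequality applies
to the real and imaginary parts. -/
lemma IsH1LocWithGradient.integrable_mul_singularWeight_sq (hd : 3 ≤ d)
    (hu : IsH1LocWithGradient u G) {g : 𝔼 → ℝ} {M : ℝ} (hg0 : ∀ x, 0 ≤ g x)
    (hgM : ∀ x, ‖x‖ ≤ 1 → g x ≤ M) (hgm : AEStronglyMeasurable g volume)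
    (hi : Integrable (fun x => g x * ‖u x‖ ^ 2)) :
    Integrable (fun x => g x * (singularWeight x ^ 2 * ‖u x‖ ^ 2)) := by
  have h1 : IntegrableOn (fun x => M * ((u x).re ^ 2 / ‖x‖ ^ 2 + (u x).im ^ 2 / ‖x‖ ^ 2))
      (Metric.closedBall 0 1) :=
    ((hu.hasWeakGradient_re.integrableOn_hardy hd).add
      (hu.hasWeakGradient_im.integrableOn_hardy hd)).const_mul M
  have h2 := (integrable_indicator_iff Metric.isClosed_closedBall.measurableSet).2 h1
  refine (hi.add h2).mono' (hgm.mul ((measurable_singularWeight.pow_const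
    2).aestronglyMeasurable.mul (hu.meas.norm.pow 2))) ?_
  filter_upwards [ae_ne_zero hd] with x hx
  rw [Real.norm_of_nonneg (mul_nonneg (hg0 x) (by positivity))]
  have h3 := singularWeight_sq_le x hx
  simp only [Pi.add_apply]
  by_cases hxb : x ∈ Metric.closedBall (0 : 𝔼) 1
  · rw [indicator_of_mem hxb] at h3 ⊢
    have h4 := hgM x (by simpa using hxb)
    calc g x * (singularWeight x ^ 2 * ‖u x‖ ^ 2)
        ≤ g x * ((1 + 1 / ‖x‖ ^ 2) * ‖u x‖ ^ 2) := by gcongr; exact hg0 x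
      _ = g x * ‖u x‖ ^ 2 + g x * ((u x).re ^ 2 / ‖x‖ ^ 2 + (u x).im ^ 2 / ‖x‖ ^ 2) := by
        rw [sq_norm_eq_re_im (u x)]; ring
      _ ≤ _ := by gcongr
  · rw [indicator_of_notMem hxb] at h3 ⊢
    rw [add_zero] at h3 ⊢
    have := hg0 x
    calc g x * (singularWeight x ^ 2 * ‖u x‖ ^ 2) ≤ g x * (1 * ‖u x‖ ^ 2) := by gcongr
      _ = g x * ‖u x‖ ^ 2 := by ring

/-- A power weight, cut off near the origin and near infinity. -/
noncomputable def powerCutoff (k n : ℕ) (x : 𝔼) : ℝ := annulusCutoff n x * ‖x‖ ^ k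

lemma tsupport_powerCutoff_subset (k n : ℕ) :
    tsupport (powerCutoff k n : 𝔼 → ℝ) ⊆ tsupport (annulusCutoff n : 𝔼 → ℝ) :=
  tsupport_annulusCutoff_smul_subset (fun x : 𝔼 => ‖x‖ ^ k) n

lemma hasCompactSupport_powerCutoff (k n : ℕ) :
    HasCompactSupport (powerCutoff k n : 𝔼 → ℝ) :=
  (hasCompactSupport_annulusCutoff n).of_isClosed_subset (isClosed_tsupport _)
    (tsupport_powerCutoff_subset k n)

lemma zero_notMem_tsupport_powerCutoff (k n : ℕ) :
    (0 : 𝔼) ∉ tsupport (powerCutoff k n : 𝔼 → ℝ) :=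
  fun h => zero_notMem_tsupport_annulusCutoff n (tsupport_powerCutoff_subset k n h)

lemma contDiff_powerCutoff (k n : ℕ) : ContDiff ℝ ∞ (powerCutoff k n : 𝔼 → ℝ) := by
  rw [contDiff_iff_contDiffAt]
  intro x
  by_cases hx : x = 0
  · subst hx
    refine contDiffAt_const (c := (0 : ℝ)).congr_of_eventuallyEq ?_
    exact notMem_tsupport_iff_eventuallyEq.1 (zero_notMem_tsupport_powerCutoff k n)
  · exact (contDiff_annulusCutoff n).contDiffAt.mul ((contDiffAt_norm ℝ hx).pow k)

lemma powerCutoff_nonneg (k n : ℕ) (x : 𝔼) : 0 ≤ powerCutoff k n x :=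
  mul_nonneg (annulusCutoff_nonneg n x) (by positivity)

lemma powerCutoff_le (k n : ℕ) (x : 𝔼) : powerCutoff k n x ≤ ‖x‖ ^ k :=
  mul_le_of_le_one_left (by positivity) (annulusCutoff_le_one n x)

lemma tendsto_powerCutoff (k : ℕ) {x : 𝔼} (hx : x ≠ 0) :
    Tendsto (fun n => powerCutoff k n x) atTop (𝓝 (‖x‖ ^ k)) := by
  refine tendsto_const_nhds.congr' ?_
  filter_upwards [eventually_annulusCutoff_eq_one hx] with n hn
  rw [powerCutoff, hn.self_of_nhds, one_mul]

/-- Differentiating either factor costs one power of `‖x‖`, uniformly in `n`. This loss of one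
degree is what drives the induction on the weight. -/
lemma exists_fderiv_powerCutoff_bound (d k : ℕ) : ∃ M : ℝ, 0 ≤ M ∧
    ∀ (n : ℕ) (x : EuclideanSpace ℝ (Fin d)), x ≠ 0 →
      ‖fderiv ℝ (powerCutoff (k + 1) n) x‖ ≤ M * ‖x‖ ^ k := by
  obtain ⟨M, hM0, hM⟩ := exists_fderiv_annulusCutoff_bound d
  refine ⟨M + (k + 1), by positivity, fun n x hx => ?_⟩
  have hx0 := norm_pos_iff.2 hx
  have hn : HasFDerivAt (fun y : EuclideanSpace ℝ (Fin d) => ‖y‖) (fderiv ℝ (fun y => ‖y‖) x) x :=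
    ((contDiffAt_norm ℝ hx (n := 1)).differentiableAt (by simp)).hasFDerivAt
  have hn1 : ‖fderiv ℝ (fun y : EuclideanSpace ℝ (Fin d) => ‖y‖) x‖ ≤ 1 := by
    simpa using norm_fderiv_le_of_lipschitz ℝ (lipschitzWith_one_norm (E := EuclideanSpace ℝ (Fin d)))
      (x₀ := x)
  have hχ : HasFDerivAt (annulusCutoff n) (fderiv ℝ (annulusCutoff n) x) x :=
    ((contDiff_annulusCutoff n).differentiable (by simp)).differentiableAt.hasFDerivAt
  have h1 := (hχ.mul (hn.pow (k + 1))).fderiv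
  have h2 : fderiv ℝ (powerCutoff (k + 1) n) x = _ := h1
  rw [h2]
  refine (norm_add_le _ _).trans ?_
  have h3 : ‖annulusCutoff n x • ((k + 1) • ‖x‖ ^ (k + 1 - 1)) •
      fderiv ℝ (fun y : EuclideanSpace ℝ (Fin d) => ‖y‖) x‖ ≤ 1 * (((k : ℝ) + 1) * ‖x‖ ^ k * 1) := by
    have : ‖((k + 1) • ‖x‖ ^ (k + 1 - 1) : ℝ)‖ = ((k : ℝ) + 1) * ‖x‖ ^ k := by
      rw [nsmul_eq_mul, Real.norm_of_nonneg (by positivity)]; simp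
    rw [norm_smul, norm_smul, this, Real.norm_of_nonneg (annulusCutoff_nonneg n x)]
    gcongr
    exact annulusCutoff_le_one n x
  have h4 : ‖‖x‖ ^ (k + 1) • fderiv ℝ (annulusCutoff n) x‖ ≤ ‖x‖ ^ (k + 1) * (M / ‖x‖) := by
    rw [norm_smul, norm_pow, norm_norm]
    gcongr; exact hM n x hx
  have h5 : ‖x‖ ^ (k + 1) * (M / ‖x‖) = M * ‖x‖ ^ k := by field_simp; ring
  linarith

lemma abs_apply_mul_le {L : 𝔼 →L[ℝ] ℝ} {m : ℝ} (hL : ‖L‖ ≤ m) (v : 𝔼) (b : ℝ) :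
    |L v * b| ≤ m * ((‖v‖ ^ 2 + b ^ 2) / 2) := by
  have h1 : |L v| ≤ m * ‖v‖ := L.le_of_opNorm_le hL v
  have hm : 0 ≤ m := (norm_nonneg _).trans hL
  rw [abs_mul]
  calc |L v| * |b| ≤ m * ‖v‖ * |b| := by gcongr
    _ = m * (‖v‖ * |b|) := by ring
    _ ≤ _ := by
      gcongr
      nlinarith [sq_nonneg (‖v‖ - |b|), sq_abs b]

/-- One step of a bootstrap. The imaginary part, tested with a weight of degree `k + 1`, bounds `ε ∫
w |u|²` by `f` and by `∫ |∇w| |∇u| |u|`, which has degree `k`. The real part then bounds `∫ w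
|∇u|²`, with `Q |u|²` controlled by Hardy's inequality. Fatou's lemma removes the cutoff in both
steps. -/
theorem IsHelmholtzSolution.integrable_norm_pow_succ (hd : 3 ≤ d)
    (hpQ : IsAdmissiblePotential d p Q δ) (hδ : 0 < δ) (hf : AEStronglyMeasurable f volume)
    (hf2 : LocallyIntegrable (fun x => ‖f x‖ ^ 2) volume) (hu : IsH1LocWithGradient u G)
    (hsol : IsHelmholtzSolution p Q lam ε f u G) (hε : 0 < ε) (k : ℕ)
    (hk : Integrable (fun x => ‖x‖ ^ k * (‖u x‖ ^ 2 + ‖G x‖ ^ 2)))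
    (hfk : Integrable (fun x => ‖x‖ ^ (k + 1) * ‖f x‖ ^ 2)) :
    Integrable (fun x => ‖x‖ ^ (k + 1) * (‖u x‖ ^ 2 + ‖G x‖ ^ 2)) := by
  obtain ⟨M, hM0, hM⟩ := exists_fderiv_powerCutoff_bound d k
  obtain ⟨P, hP0, hP, -⟩ := hpQ.exists_bound hδ
  obtain ⟨C, hC0, hC⟩ := hpQ.exists_singular_bound hd hδ
  have hw := fun n => (contDiff_powerCutoff (d := d) (k + 1) n)
  have hwl : ∀ n, LocallyLipschitz (powerCutoff (k + 1) n : 𝔼 → ℝ) :=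
    fun n => ((hw n).of_le (by simp)).locallyLipschitz
  have hwm : ∀ n, AEStronglyMeasurable (powerCutoff (k + 1) n : 𝔼 → ℝ) volume :=
    fun n => (hw n).continuous.aestronglyMeasurable
  have hre := fun n => hsol.integral_mul_conj_re hd hpQ hδ hf hf2 hu (hwl n)
    (hasCompactSupport_powerCutoff _ n) (zero_notMem_tsupport_powerCutoff _ n)
  have him := fun n => hsol.integral_mul_conj_im hd hpQ hδ hf hf2 hu (hwl n)
    (hasCompactSupport_powerCutoff _ n) (zero_notMem_tsupport_powerCutoff _ n)
  have hU : Integrable (fun x => ‖x‖ ^ (k + 1) * ‖u x‖ ^ 2) := by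
    set H : 𝔼 → ℝ := fun x => 1 / (2 * ε) * (‖x‖ ^ (k + 1) * ‖f x‖ ^ 2)
      + M * (‖x‖ ^ k * (‖u x‖ ^ 2 + ‖G x‖ ^ 2)) with hH
    have hHi : Integrable H := (hfk.const_mul _).add (hk.const_mul _)
    have hle : ∀ n, ∀ᵐ x, powerCutoff (k + 1) n x * ‖u x‖ ^ 2 ≤ 2 / ε *
        ((powerCutoff (k + 1) n x * ((f x).re * (u x).im - (f x).im * (u x).re + ε * ‖u x‖ ^ 2)
        + (fderiv ℝ (powerCutoff (k + 1) n) x (reVec (G x)) * (u x).im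
        - fderiv ℝ (powerCutoff (k + 1) n) x (imVec (G x)) * (u x).re)) + H x) := by
      intro n
      filter_upwards [ae_ne_zero hd] with x hx
      have h1 := abs_apply_mul_le (hM n x hx) (reVec (G x)) (u x).im
      have h2 := abs_apply_mul_le (hM n x hx) (imVec (G x)) (u x).re
      have h3 := powerCutoff_nonneg (k + 1) n x
      have h4 := powerCutoff_le (k + 1) n x
      -- The weights in Young's inequality are chosen so that half of the absorption term `ε |u|²`
      -- survives.
      have h5 : -(1 / (2 * ε) * ‖f x‖ ^ 2 + ε / 2 * ‖u x‖ ^ 2)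
          ≤ (f x).re * (u x).im - (f x).im * (u x).re := by
        have : 1 / (2 * ε) * ‖f x‖ ^ 2 + ε / 2 * ‖u x‖ ^ 2
            + ((f x).re * (u x).im - (f x).im * (u x).re) = 1 / (2 * ε) *
            (((f x).re + ε * (u x).im) ^ 2 + ((f x).im - ε * (u x).re) ^ 2) := by
          rw [sq_norm_eq_re_im, sq_norm_eq_re_im]; field_simp; ring
        have h6 : 0 ≤ 1 / (2 * ε) *
            (((f x).re + ε * (u x).im) ^ 2 + ((f x).im - ε * (u x).re) ^ 2) := by positivity
        linarith
      have h6 := mul_le_mul_of_nonneg_left h5 h3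
      have h7 : powerCutoff (k + 1) n x * (1 / (2 * ε) * ‖f x‖ ^ 2)
          ≤ ‖x‖ ^ (k + 1) * (1 / (2 * ε) * ‖f x‖ ^ 2) := by gcongr
      have h8 : M * (‖x‖ ^ k * (‖u x‖ ^ 2 + ‖G x‖ ^ 2))
          = 2 * (M * ‖x‖ ^ k * ((‖reVec (G x)‖ ^ 2 + (u x).im ^ 2) / 2)
            + M * ‖x‖ ^ k * ((‖imVec (G x)‖ ^ 2 + (u x).re ^ 2) / 2)) := by
        rw [sq_norm_eq_re_im, norm_sq_eq_reVec_imVec]; ring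
      have h9 : 0 ≤ M * ‖x‖ ^ k * ((‖reVec (G x)‖ ^ 2 + (u x).im ^ 2) / 2)
            + M * ‖x‖ ^ k * ((‖imVec (G x)‖ ^ 2 + (u x).re ^ 2) / 2) := by positivity
      have h10 : ε / 2 * (powerCutoff (k + 1) n x * ‖u x‖ ^ 2) ≤
          (powerCutoff (k + 1) n x * ((f x).re * (u x).im - (f x).im * (u x).re + ε * ‖u x‖ ^ 2)
        + (fderiv ℝ (powerCutoff (k + 1) n) x (reVec (G x)) * (u x).im
        - fderiv ℝ (powerCutoff (k + 1) n) x (imVec (G x)) * (u x).re)) + H x := by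
        simp only [hH]
        linarith [neg_abs_le (fderiv ℝ (powerCutoff (k + 1) n) x (reVec (G x)) * (u x).im),
          le_abs_self (fderiv ℝ (powerCutoff (k + 1) n) x (imVec (G x)) * (u x).re)]
      calc powerCutoff (k + 1) n x * ‖u x‖ ^ 2
          = 2 / ε * (ε / 2 * (powerCutoff (k + 1) n x * ‖u x‖ ^ 2)) := by field_simp
        _ ≤ _ := by gcongr
    have hnn : ∀ n (x : 𝔼), 0 ≤ powerCutoff (k + 1) n x * ‖u x‖ ^ 2 :=
      fun n x => mul_nonneg (powerCutoff_nonneg _ n x) (sq_nonneg _)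
    have hint := fun n => ((him n).1.add hHi).const_mul (2 / ε)
    refine integrable_of_tendsto_of_integral_le (g := fun n x => powerCutoff (k + 1) n x * ‖u x‖ ^ 2)
      (C := 2 / ε * ∫ x, H x) (fun n => (hint n).mono' ((hwm n).mul (hu.meas.norm.pow 2)) ?_)
      hnn (fun n => ?_) ?_
    · filter_upwards [hle n] with x hx
      rw [Real.norm_of_nonneg (hnn n x)]
      exact hx
    · refine (integral_mono_of_nonneg (Eventually.of_forall (hnn n)) (hint n) (hle n)).trans ?_
      simp only [Pi.add_apply]
      rw [integral_const_mul, integral_add (him n).1 hHi, (him n).2, zero_add]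
    · filter_upwards [ae_ne_zero hd] with x hx
      exact (tendsto_powerCutoff (k + 1) hx).mul_const _
  have hUs := hu.integrable_mul_singularWeight_sq hd (g := fun x => ‖x‖ ^ (k + 1)) (M := 1)
    (fun x => by positivity) (fun x hx => pow_le_one₀ (norm_nonneg _) hx)
    (continuous_norm.pow _).aestronglyMeasurable hU
  have hG : Integrable (fun x => ‖x‖ ^ (k + 1) * ‖G x‖ ^ 2) := by
    set H : 𝔼 → ℝ := fun x => ‖x‖ ^ (k + 1) * ‖f x‖ ^ 2
      + (1 + P + |lam|) * (‖x‖ ^ (k + 1) * ‖u x‖ ^ 2)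
      + C * (‖x‖ ^ (k + 1) * (singularWeight x ^ 2 * ‖u x‖ ^ 2))
      + M * (‖x‖ ^ k * (‖u x‖ ^ 2 + ‖G x‖ ^ 2)) with hH
    have hHi : Integrable H :=
      ((hfk.add (hU.const_mul _)).add (hUs.const_mul _)).add (hk.const_mul _)
    have hle : ∀ n, ∀ᵐ x, powerCutoff (k + 1) n x * ‖G x‖ ^ 2 ≤
        (powerCutoff (k + 1) n x * ((f x).re * (u x).re + (f x).im * (u x).im
        - (p x + Q x + lam) * ‖u x‖ ^ 2 + ‖G x‖ ^ 2)
        + (fderiv ℝ (powerCutoff (k + 1) n) x (reVec (G x)) * (u x).re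
        + fderiv ℝ (powerCutoff (k + 1) n) x (imVec (G x)) * (u x).im)) + H x := by
      intro n
      filter_upwards [ae_ne_zero hd] with x hx
      have h1 := abs_apply_mul_le (hM n x hx) (reVec (G x)) (u x).re
      have h2 := abs_apply_mul_le (hM n x hx) (imVec (G x)) (u x).im
      have h3 := powerCutoff_nonneg (k + 1) n x
      have h4 := powerCutoff_le (k + 1) n x
      have h5 : (p x + Q x + lam) * ‖u x‖ ^ 2 - ((f x).re * (u x).re + (f x).im * (u x).im)
          ≤ ‖f x‖ ^ 2 + (1 + P + |lam| + C * singularWeight x ^ 2) * ‖u x‖ ^ 2 := by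
        have h6 : p x + Q x + lam ≤ P + |lam| + C * singularWeight x ^ 2 := by
          linarith [le_abs_self (p x), hP x, le_abs_self (Q x), hC x hx, le_abs_self lam]
        have h7 := mul_le_mul_of_nonneg_right h6 (sq_nonneg ‖u x‖)
        have h8 : -((f x).re * (u x).re + (f x).im * (u x).im) ≤ ‖f x‖ ^ 2 + ‖u x‖ ^ 2 := by
          rw [sq_norm_eq_re_im, sq_norm_eq_re_im]
          nlinarith [sq_nonneg ((f x).re + (u x).re), sq_nonneg ((f x).im + (u x).im),
            sq_nonneg (f x).re, sq_nonneg (f x).im, sq_nonneg (u x).re, sq_nonneg (u x).im]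
        linarith
      have h6 := mul_le_mul_of_nonneg_left h5 h3
      have h7 : powerCutoff (k + 1) n x * (‖f x‖ ^ 2 + (1 + P + |lam| + C * singularWeight x ^ 2)
          * ‖u x‖ ^ 2) ≤ ‖x‖ ^ (k + 1) * (‖f x‖ ^ 2 + (1 + P + |lam| + C * singularWeight x ^ 2)
          * ‖u x‖ ^ 2) := by gcongr
      have h8 : M * (‖x‖ ^ k * (‖u x‖ ^ 2 + ‖G x‖ ^ 2))
          = 2 * (M * ‖x‖ ^ k * ((‖reVec (G x)‖ ^ 2 + (u x).re ^ 2) / 2)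
            + M * ‖x‖ ^ k * ((‖imVec (G x)‖ ^ 2 + (u x).im ^ 2) / 2)) := by
        rw [sq_norm_eq_re_im, norm_sq_eq_reVec_imVec]; ring
      have h9 : 0 ≤ M * ‖x‖ ^ k * ((‖reVec (G x)‖ ^ 2 + (u x).re ^ 2) / 2)
            + M * ‖x‖ ^ k * ((‖imVec (G x)‖ ^ 2 + (u x).im ^ 2) / 2) := by positivity
      simp only [hH]
      linarith [neg_abs_le (fderiv ℝ (powerCutoff (k + 1) n) x (reVec (G x)) * (u x).re),
          neg_abs_le (fderiv ℝ (powerCutoff (k + 1) n) x (imVec (G x)) * (u x).im)]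
    have hnn : ∀ n (x : 𝔼), 0 ≤ powerCutoff (k + 1) n x * ‖G x‖ ^ 2 :=
      fun n x => mul_nonneg (powerCutoff_nonneg _ n x) (sq_nonneg _)
    have hint := fun n => (hre n).1.add hHi
    refine integrable_of_tendsto_of_integral_le (g := fun n x => powerCutoff (k + 1) n x * ‖G x‖ ^ 2)
      (C := ∫ x, H x) (fun n => (hint n).mono' ((hwm n).mul (hu.meas_grad.norm.pow 2)) ?_)
      hnn (fun n => ?_) ?_
    · filter_upwards [hle n] with x hx
      rw [Real.norm_of_nonneg (hnn n x)]
      exact hx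
    · refine (integral_mono_of_nonneg (Eventually.of_forall (hnn n)) (hint n) (hle n)).trans ?_
      simp only [Pi.add_apply]
      rw [integral_add (hre n).1 hHi, (hre n).2, zero_add]
    · filter_upwards [ae_ne_zero hd] with x hx
      exact (tendsto_powerCutoff (k + 1) hx).mul_const _
  simp only [mul_add]
  exact hU.add hG

lemma one_add_pow_le_two_pow_mul {t : ℝ} (ht : 0 ≤ t) (n : ℕ) :
    (1 + t) ^ n ≤ 2 ^ n * (1 + t ^ n) := by
  rcases le_total t 1 with h1 | h1
  · calc (1 + t) ^ n ≤ 2 ^ n := by gcongr; linarith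
      _ ≤ 2 ^ n * (1 + t ^ n) := le_mul_of_one_le_right (by positivity) (by
        linarith [pow_nonneg ht n])
  · calc (1 + t) ^ n ≤ (2 * t) ^ n := by gcongr; linarith
      _ = 2 ^ n * t ^ n := mul_pow _ _ _
      _ ≤ 2 ^ n * (1 + t ^ n) := by gcongr; linarith

/-- For positive absorption and polynomially growing profiles, the decay of the source gives
the decay of the solution. -/
theorem IsHelmholtzSolution.integrable_of_absorption {K : 𝔼 → ℝ} {h : ℝ → ℝ} (hd : 3 ≤ d)
    (hpQ : IsAdmissiblePotential d p Q δ) (hδ : 0 < δ) (hf : AEStronglyMeasurable f volume)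
    (hf2 : LocallyIntegrable (fun x => ‖f x‖ ^ 2) volume) (hu : IsH1LocWithGradient u G)
    (hsol : IsHelmholtzSolution p Q lam ε f u G) (hε : 0 < ε) (hK : IsEikonalSolution p lam K)
    (hh : IsRegularProfile h) (hu2 : MemLp u 2 volume) (hG2 : MemLp G 2 volume) {m : ℕ} {C : ℝ}
    (hC : ∀ t, 0 < t → |deriv (deriv h) t| ≤ C * (1 + t) ^ m)
    (hfm : Integrable (fun x => (1 + ‖x‖) ^ (m + 1) * ‖f x‖ ^ 2) volume) :
    Integrable (fun x => (|deriv h (K x)| + |deriv (deriv h) (K x)|) *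
        (‖u x‖ ^ 2 + ‖G x‖ ^ 2) + |deriv h (K x)| * ‖f x‖ ^ 2) volume := by
  have hfk : ∀ k, k ≤ m + 1 → Integrable (fun x => ‖x‖ ^ k * ‖f x‖ ^ 2) := fun k hk => by
    refine hfm.mono' ((continuous_norm.pow k).aestronglyMeasurable.mul (hf.norm.pow 2))
      (Eventually.of_forall fun x => ?_)
    rw [Real.norm_of_nonneg (by positivity)]
    gcongr
    calc ‖x‖ ^ k ≤ (1 + ‖x‖) ^ k := by gcongr; linarith
      _ ≤ (1 + ‖x‖) ^ (m + 1) := pow_le_pow_right₀ (by linarith [norm_nonneg x]) hk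
  have h0 : Integrable (fun x => ‖u x‖ ^ 2 + ‖G x‖ ^ 2) :=
    ((memLp_two_iff_integrable_sq_norm hu2.1).1 hu2).add
      ((memLp_two_iff_integrable_sq_norm hG2.1).1 hG2)
  -- The induction starts from `u ∈ H¹` and stops at degree `m + 1`, the growth of `h'` when `h''`
  -- grows with degree `m`.
  have hk : ∀ k, k ≤ m + 1 → Integrable (fun x => ‖x‖ ^ k * (‖u x‖ ^ 2 + ‖G x‖ ^ 2)) := by
    intro k
    induction k with
    | zero => intro _; simpa using h0
    | succ k ih =>
      exact fun hk => hsol.integrable_norm_pow_succ hd hpQ hδ hf hf2 hu hε k (ih (by omega))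
        (hfk _ hk)
  obtain ⟨C1, hC10, hC1⟩ := hK.exists_upper_bound
  have hC0 : 0 ≤ C := by
    have h1 := (abs_nonneg _).trans (hC 1 one_pos)
    exact nonneg_of_mul_nonneg_left h1 (by positivity)
  set C2 := (1 + C1) ^ (m + 1) with hC2
  have hmain : Integrable (fun x => 2 * C * C2 * (2 ^ (m + 1) * ((‖u x‖ ^ 2 + ‖G x‖ ^ 2)
      + ‖x‖ ^ (m + 1) * (‖u x‖ ^ 2 + ‖G x‖ ^ 2)))
      + C * C2 * ((1 + ‖x‖) ^ (m + 1) * ‖f x‖ ^ 2)) :=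
    (((h0.add (hk _ le_rfl)).const_mul _).const_mul _).add (hfm.const_mul _)
  have hKm := hK.continuous.measurable
  refine hmain.mono' ?_ ?_
  · have hq : AEStronglyMeasurable (fun x => |deriv h (K x)|) volume :=
      ((measurable_deriv h).comp hKm).abs.aestronglyMeasurable
    have hr : AEStronglyMeasurable (fun x => |deriv (deriv h) (K x)|) volume :=
      ((measurable_deriv _).comp hKm).abs.aestronglyMeasurable
    exact ((hq.add hr).mul ((hu.meas.norm.pow 2).add (hu.meas_grad.norm.pow 2))).add
      (hq.mul (hf.norm.pow 2))
  · filter_upwards [ae_ne_zero hd] with x hx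
    have hKx := hK.pos x hx
    have hb : (1 + K x) ^ (m + 1) ≤ C2 * (1 + ‖x‖) ^ (m + 1) := by
      rw [hC2, ← mul_pow]
      gcongr
      nlinarith [hC1 x, norm_nonneg x]
    have hq : |deriv h (K x)| ≤ C * C2 * (1 + ‖x‖) ^ (m + 1) := by
      refine (hh.deriv_growth hC hKx).trans ?_
      rw [mul_assoc]
      gcongr
    have hr : |deriv (deriv h) (K x)| ≤ C * C2 * (1 + ‖x‖) ^ (m + 1) := by
      refine (hC _ hKx).trans ?_
      rw [mul_assoc]
      gcongr
      exact (pow_le_pow_right₀ (by linarith) (Nat.le_succ m)).trans hb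
    rw [Real.norm_of_nonneg (by positivity)]
    have h3 := one_add_pow_le_two_pow_mul (norm_nonneg x) (m + 1)
    have hC20 : 0 ≤ C2 := by positivity
    calc (|deriv h (K x)| + |deriv (deriv h) (K x)|) * (‖u x‖ ^ 2 + ‖G x‖ ^ 2)
          + |deriv h (K x)| * ‖f x‖ ^ 2
        ≤ (C * C2 * (1 + ‖x‖) ^ (m + 1) + C * C2 * (1 + ‖x‖) ^ (m + 1)) *
          (‖u x‖ ^ 2 + ‖G x‖ ^ 2) + C * C2 * (1 + ‖x‖) ^ (m + 1) * ‖f x‖ ^ 2 := by gcongr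
      _ = 2 * C * C2 * ((1 + ‖x‖) ^ (m + 1) * (‖u x‖ ^ 2 + ‖G x‖ ^ 2))
          + C * C2 * ((1 + ‖x‖) ^ (m + 1) * ‖f x‖ ^ 2) := by ring
      _ ≤ 2 * C * C2 * ((2 ^ (m + 1) * (1 + ‖x‖ ^ (m + 1))) * (‖u x‖ ^ 2 + ‖G x‖ ^ 2))
          + C * C2 * ((1 + ‖x‖) ^ (m + 1) * ‖f x‖ ^ 2) := by gcongr
      _ = _ := by ring

end WeightedEstimates

/-! ### The integrands in terms of real and imaginary parts. -/

section RealForms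

variable {d : ℕ} (lam : ℝ) (K : EuclideanSpace ℝ (Fin d) → ℝ) (h : ℝ → ℝ)
  (p Q : EuclideanSpace ℝ (Fin d) → ℝ) (f u : EuclideanSpace ℝ (Fin d) → ℂ)
  (G : EuclideanSpace ℝ (Fin d) → EuclideanSpace ℂ (Fin d)) (x : EuclideanSpace ℝ (Fin d))

local notation "𝔼" => EuclideanSpace ℝ (Fin d)
local notation "𝔼ℂ" => EuclideanSpace ℂ (Fin d)

lemma rdot_smul (c : ℝ) (v : 𝔼) (z : 𝔼ℂ) : rdot (c • v) z = c * rdot v z := by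
  simp only [rdot, PiLp.smul_apply, smul_eq_mul, Complex.ofReal_mul, Finset.mul_sum, mul_assoc]

lemma norm_rdot_le (v : 𝔼) (z : 𝔼ℂ) : ‖rdot v z‖ ≤ ‖v‖ * ‖z‖ := by
  refine le_of_sq_le_sq ?_ (by positivity)
  rw [sq_norm_eq_re_im, rdot_re, rdot_im, mul_pow, norm_sq_eq_reVec_imVec, mul_add, ← mul_pow,
    ← mul_pow]
  exact add_le_add (sq_le_sq.2 ((abs_real_inner_le_norm _ _).trans (le_abs_self _)))
    (sq_le_sq.2 ((abs_real_inner_le_norm _ _).trans (le_abs_self _)))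

lemma norm_toComplexVec (v : 𝔼) : ‖toComplexVec v‖ = ‖v‖ := by
  rw [EuclideanSpace.norm_eq, EuclideanSpace.norm_eq]
  simp [toComplexVec]

lemma reVec_sub_smul (z : 𝔼ℂ) (c : ℂ) (v : 𝔼) :
    reVec (z - c • toComplexVec v) = reVec z - c.re • v := by
  ext i
  simp [toComplexVec]

lemma imVec_sub_smul (z : 𝔼ℂ) (c : ℂ) (v : 𝔼) :
    imVec (z - c • toComplexVec v) = imVec z - c.im • v := by
  ext i
  simp [toComplexVec]

lemma norm_sq_sub_smul (y v : 𝔼) (c : ℝ) :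
    ‖y - c • v‖ ^ 2 = ‖y‖ ^ 2 - 2 * c * inner ℝ v y + c ^ 2 * ‖v‖ ^ 2 := by
  rw [norm_sub_sq_real, real_inner_smul_right, real_inner_comm, norm_smul, mul_pow,
    Real.norm_eq_abs, sq_abs]
  ring

lemma radialDeriv_re : (radialDeriv K G x).re = ‖∇ K x‖⁻¹ * inner ℝ (∇ K x) (reVec (G x)) := by
  rw [radialDeriv, rdot_re, real_inner_smul_left]

lemma radialDeriv_im : (radialDeriv K G x).im = ‖∇ K x‖⁻¹ * inner ℝ (∇ K x) (imVec (G x)) := by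
  rw [radialDeriv, rdot_im, real_inner_smul_left]

variable {K x} in
-- Pythagoras in the direction `∇K`, multiplied by `|∇K|²` to clear the normalisation.
lemma norm_angularGrad_sq (hN : ‖∇ K x‖ ≠ 0) : ‖∇ K x‖ ^ 2 * ‖angularGrad K G x‖ ^ 2
    = ‖∇ K x‖ ^ 2 * ‖G x‖ ^ 2 - (inner ℝ (∇ K x) (reVec (G x)) ^ 2
      + inner ℝ (∇ K x) (imVec (G x)) ^ 2) := by
  rw [norm_sq_eq_reVec_imVec, norm_sq_eq_reVec_imVec (G x), angularGrad, reVec_sub_smul,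
    imVec_sub_smul, radialDeriv_re, radialDeriv_im, smul_smul, smul_smul, norm_sq_sub_smul,
    norm_sq_sub_smul]
  field_simp
  ring

variable {K x} in
lemma radialTerm_eq (hN : ‖∇ K x‖ ≠ 0) : radialTerm lam K h u G x = deriv (deriv h) (K x) *
    ((inner ℝ (∇ K x) (reVec (G x)) + √lam * ‖∇ K x‖ ^ 2 * (u x).im) ^ 2
      + (inner ℝ (∇ K x) (imVec (G x)) - √lam * ‖∇ K x‖ ^ 2 * (u x).re) ^ 2) := by
  have h1 : (radialDeriv K G x - Complex.I * (√lam : ℂ) * (‖∇ K x‖ : ℂ) * u x).re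
      = ‖∇ K x‖⁻¹ * inner ℝ (∇ K x) (reVec (G x)) + √lam * ‖∇ K x‖ * (u x).im := by
    rw [Complex.sub_re, radialDeriv_re]; simp
  have h2 : (radialDeriv K G x - Complex.I * (√lam : ℂ) * (‖∇ K x‖ : ℂ) * u x).im
      = ‖∇ K x‖⁻¹ * inner ℝ (∇ K x) (imVec (G x)) - √lam * ‖∇ K x‖ * (u x).re := by
    rw [Complex.sub_im, radialDeriv_im]; simp
  rw [radialTerm, sq_norm_eq_re_im, h1, h2]
  field_simp

variable {K x} in
lemma angularTerm_eq (hN : ‖∇ K x‖ ≠ 0) : angularTerm K h G x =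
    (deriv h (K x) / K x - deriv (deriv h) (K x) / 2) * (‖∇ K x‖ ^ 2 * ‖G x‖ ^ 2
      - (inner ℝ (∇ K x) (reVec (G x)) ^ 2 + inner ℝ (∇ K x) (imVec (G x)) ^ 2)) := by
  rw [angularTerm, mul_assoc, norm_angularGrad_sq G hN]

lemma rdot_gradient_mul_conj_re (w : 𝔼 → ℝ) (y : ℂ) :
    (rdot (∇ w x) (G x) * conj y).re
      = fderiv ℝ w x (reVec (G x)) * y.re + fderiv ℝ w x (imVec (G x)) * y.im := by
  rw [Complex.mul_re, Complex.conj_re, Complex.conj_im, rdot_re, rdot_im, inner_gradient,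
    inner_gradient]
  ring

lemma rdot_gradient_mul_conj_im (w : 𝔼 → ℝ) (y : ℂ) :
    (rdot (∇ w x) (G x) * conj y).im
      = fderiv ℝ w x (imVec (G x)) * y.re - fderiv ℝ w x (reVec (G x)) * y.im := by
  rw [Complex.mul_im, Complex.conj_re, Complex.conj_im, rdot_re, rdot_im, inner_gradient,
    inner_gradient]
  ring

lemma gradSpeedTerm_im : (gradSpeedTerm K h u G x).im = deriv h (K x) *
    (fderiv ℝ (fun y => ‖∇ K y‖ ^ 2) x (imVec (G x)) * (u x).re
      - fderiv ℝ (fun y => ‖∇ K y‖ ^ 2) x (reVec (G x)) * (u x).im) := by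
  rw [gradSpeedTerm, mul_right_comm, Complex.im_mul_ofReal, rdot_gradient_mul_conj_im, mul_comm]

/-- The angular and radial parts add up to `∇ū`, so the two `F` terms together are the full form on
`∇u`. -/
lemma matrixFTerm_eq : matrixFTerm K h G x = ((deriv h (K x) / K x : ℝ) : ℂ) *
    ∑ i, ∑ j, G x i * (eikonalF K i j x : ℂ) * conj (G x j) := by
  rw [matrixFTerm, ← Finset.sum_add_distrib]
  congr 1
  refine Finset.sum_congr rfl fun i _ => ?_
  rw [← Finset.sum_add_distrib]
  refine Finset.sum_congr rfl fun j _ => ?_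
  simp only [angularGrad, PiLp.sub_apply, PiLp.smul_apply, toComplexVec, smul_eq_mul, map_sub,
    map_mul, Complex.conj_ofReal]
  ring

lemma matrixFTerm_re : (matrixFTerm K h G x).re = deriv h (K x) / K x *
    ((∑ i, ∑ j, reVec (G x) i * eikonalF K i j x * reVec (G x) j)
      + ∑ i, ∑ j, imVec (G x) i * eikonalF K i j x * imVec (G x) j) := by
  rw [matrixFTerm_eq, Complex.re_ofReal_mul, Complex.re_sum, ← Finset.sum_add_distrib]
  congr 1
  refine Finset.sum_congr rfl fun i _ => ?_
  rw [Complex.re_sum, ← Finset.sum_add_distrib]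
  refine Finset.sum_congr rfl fun j _ => ?_
  simp

lemma sommerfeldTerm_eq : sommerfeldTerm lam K h u G x = deriv h (K x) * (‖G x‖ ^ 2
    + 2 * √lam * (inner ℝ (∇ K x) (reVec (G x)) * (u x).im
      - inner ℝ (∇ K x) (imVec (G x)) * (u x).re) + √lam ^ 2 * ‖∇ K x‖ ^ 2 * ‖u x‖ ^ 2) := by
  rw [sommerfeldTerm, norm_sq_eq_reVec_imVec, norm_sq_eq_reVec_imVec (G x), reVec_sub_smul,
    imVec_sub_smul, norm_sq_sub_smul, norm_sq_sub_smul, sq_norm_eq_re_im]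
  simp only [Complex.mul_re, Complex.mul_im, Complex.I_re, Complex.I_im, Complex.ofReal_re,
    Complex.ofReal_im]
  ring

end RealForms

/-! ### Measurability of the integrands. -/

section Measurability

variable {d : ℕ}

local notation "𝔼" => EuclideanSpace ℝ (Fin d)

lemma measurable_gradient (φ : 𝔼 → ℝ) : Measurable (∇ φ) :=
  (InnerProductSpace.toDual ℝ 𝔼).symm.continuous.measurable.comp (measurable_fderiv ℝ φ)
lemma measurable_eikonalF {K : 𝔼 → ℝ} (hK : Measurable K) (i j : Fin d) :
    Measurable (eikonalF K i j) := by
  have h0 : Measurable (eikonalRatio K) := hK.div measurable_norm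
  have hc : ∀ (φ : 𝔼 → ℝ) (i : Fin d), Measurable fun x => ∇ φ x i := fun φ i =>
    (EuclideanSpace.proj (𝕜 := ℝ) i).continuous.measurable.comp (measurable_gradient φ)
  have h1 := hc (eikonalRatio K)
  have h2 := hc (fun y => ∇ (eikonalRatio K) y j) i
  have h3 := measurable_gradient (eikonalRatio K)
  have hx : ∀ i : Fin d, Measurable fun x : 𝔼 => x i := fun i =>
    (EuclideanSpace.proj (𝕜 := ℝ) i).continuous.measurable
  have h4 : Measurable fun x : 𝔼 => ‖x‖ ^ 2 := measurable_norm.pow_const 2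
  have h5 : Measurable fun x : 𝔼 => if i = j then ‖x‖ ^ 2 * ‖∇ (eikonalRatio K) x‖ ^ 2
      + 2 * eikonalRatio K x * inner ℝ x (∇ (eikonalRatio K) x) else 0 :=
    Measurable.ite (MeasurableSet.const _) ((h4.mul (h3.norm.pow_const 2)).add
      ((h0.const_mul 2).mul (measurable_id.inner h3))) measurable_const
  exact ((((h5.neg.add ((h4.mul (h1 i)).mul (h1 j))).add
    ((((hx i).const_mul 2).mul h0).mul (h1 j))).add
    ((((hx j).const_mul 2).mul h0).mul (h1 i))).add ((h0.mul h4).mul h2))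

variable {lam : ℝ} {K : EuclideanSpace ℝ (Fin d) → ℝ} {h : ℝ → ℝ}
  {p Q : EuclideanSpace ℝ (Fin d) → ℝ} {f u : EuclideanSpace ℝ (Fin d) → ℂ}
  {G : EuclideanSpace ℝ (Fin d) → EuclideanSpace ℂ (Fin d)}

lemma measurable_eikonalTraceF (hK : Measurable K) : Measurable (eikonalTraceF K) :=
  Finset.measurable_sum _ fun i _ => measurable_eikonalF hK i i

lemma aemeasurable_rdot {v : 𝔼 → 𝔼} (hv : Measurable v) (hG : AEMeasurable G volume) :
    AEMeasurable (fun x => rdot (v x) (G x)) volume := by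
  unfold rdot
  fun_prop

lemma aemeasurable_radialDeriv (hG : AEMeasurable G volume) :
    AEMeasurable (radialDeriv K G) volume :=
  aemeasurable_rdot ((measurable_gradient K).norm.inv.smul (measurable_gradient K)) hG

lemma measurable_toComplexVec : Measurable (toComplexVec : 𝔼 → EuclideanSpace ℂ (Fin d)) := by
  have : Continuous (toComplexVec : 𝔼 → EuclideanSpace ℂ (Fin d)) := by
    unfold toComplexVec
    fun_prop
  exact this.measurable

lemma aemeasurable_angularGrad (hG : AEMeasurable G volume) :
    AEMeasurable (angularGrad K G) volume :=
  hG.sub ((aemeasurable_radialDeriv hG).smul (measurable_toComplexVec.comp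
    ((measurable_gradient K).norm.inv.smul (measurable_gradient K))).aemeasurable)

lemma aemeasurable_radialTerm (hK : Measurable K) (hu : AEMeasurable u volume) (hG : AEMeasurable G volume) :
    AEMeasurable (radialTerm lam K h u G) volume := by
  have hN := measurable_gradient K
  have hr := (measurable_deriv (deriv h)).comp hK
  have hR := aemeasurable_radialDeriv (K := K) hG
  unfold radialTerm
  fun_prop

lemma aemeasurable_angularTerm (hK : Measurable K) (hG : AEMeasurable G volume) :
    AEMeasurable (angularTerm K h G) volume := by
  have hN := measurable_gradient K
  have hq : Measurable fun x => deriv h (K x) := (measurable_deriv h).comp hK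
  have hr := (measurable_deriv (deriv h)).comp hK
  have hA := aemeasurable_angularGrad (K := K) hG
  unfold angularTerm
  fun_prop

lemma aemeasurable_gradWeightTerm (hu : AEMeasurable u volume) (hG : AEMeasurable G volume) :
    AEMeasurable (gradWeightTerm K h u G) volume := by
  have hw := aemeasurable_rdot (measurable_gradient (fun y => deriv h (K y) / K y * ‖∇ K y‖ ^ 2)) hG
  unfold gradWeightTerm
  fun_prop

lemma aemeasurable_weightQTerm (hK : Measurable K) (hu : AEMeasurable u volume) (hQ : AEMeasurable Q volume) :
    AEMeasurable (weightQTerm K h Q u) volume := by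
  have hN := measurable_gradient K
  have hq : Measurable fun x => deriv h (K x) := (measurable_deriv h).comp hK
  unfold weightQTerm
  fun_prop

lemma aemeasurable_gradPsiQTerm (hu : AEMeasurable u volume) (hG : AEMeasurable G volume) (hQ : AEMeasurable Q volume) :
    AEMeasurable (gradPsiQTerm K h Q u G) volume := by
  have hw := aemeasurable_rdot (measurable_gradient (fun y => h (K y))) hG
  unfold gradPsiQTerm
  fun_prop

lemma aemeasurable_gradSpeedTerm (hK : Measurable K) (hu : AEMeasurable u volume) (hG : AEMeasurable G volume) :
    AEMeasurable (gradSpeedTerm K h u G) volume := by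
  have hq : Measurable fun x => deriv h (K x) := (measurable_deriv h).comp hK
  have hw := aemeasurable_rdot (measurable_gradient (fun y => ‖∇ K y‖ ^ 2)) hG
  unfold gradSpeedTerm
  fun_prop

lemma aemeasurable_gradPTerm (hu : AEMeasurable u volume) :
    AEMeasurable (gradPTerm K h p u) volume := by
  have hg1 := measurable_gradient (fun y => h (K y))
  have hg2 := measurable_gradient p
  unfold gradPTerm
  fun_prop

lemma aemeasurable_matrixFTerm (hK : Measurable K) (hG : AEMeasurable G volume) :
    AEMeasurable (matrixFTerm K h G) volume := by
  have hq : Measurable fun x => deriv h (K x) := (measurable_deriv h).comp hK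
  have hF := measurable_eikonalF hK
  have hM : matrixFTerm K h G = _ := funext fun x => matrixFTerm_eq K h G x
  rw [hM]
  fun_prop

lemma aemeasurable_gradTraceFTerm (hu : AEMeasurable u volume) (hG : AEMeasurable G volume) :
    AEMeasurable (gradTraceFTerm K h u G) volume := by
  have hw := aemeasurable_rdot (measurable_gradient (fun y => deriv h (K y) / K y * eikonalTraceF K y)) hG
  unfold gradTraceFTerm
  fun_prop

lemma aemeasurable_traceFQTerm (hK : Measurable K) (hu : AEMeasurable u volume) (hQ : AEMeasurable Q volume) :
    AEMeasurable (traceFQTerm K h Q u) volume := by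
  have hq : Measurable fun x => deriv h (K x) := (measurable_deriv h).comp hK
  have hT := measurable_eikonalTraceF hK
  unfold traceFQTerm
  fun_prop

lemma aemeasurable_sommerfeldTerm (hK : Measurable K) (hu : AEMeasurable u volume) (hG : AEMeasurable G volume) :
    AEMeasurable (sommerfeldTerm lam K h u G) volume := by
  have hN := measurable_gradient K
  have hq : Measurable fun x => deriv h (K x) := (measurable_deriv h).comp hK
  have hc : AEMeasurable (fun x => toComplexVec (∇ K x)) volume :=
    (measurable_toComplexVec.comp hN).aemeasurable
  exact hq.aemeasurable.mul ((hG.sub ((hu.const_mul _).smul hc)).norm.pow_const 2)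

lemma aemeasurable_psiQTerm (hK : Measurable K) (hu : AEMeasurable u volume) (hQ : AEMeasurable Q volume) :
    AEMeasurable (psiQTerm K h Q u) volume := by
  have hq : Measurable fun x => deriv h (K x) := (measurable_deriv h).comp hK
  unfold psiQTerm
  fun_prop

lemma aemeasurable_gradPsiPrimeTerm (hu : AEMeasurable u volume) (hG : AEMeasurable G volume) :
    AEMeasurable (gradPsiPrimeTerm K h u G) volume := by
  have hw := aemeasurable_rdot (measurable_gradient (fun y => deriv h (K y))) hG
  unfold gradPsiPrimeTerm
  fun_prop

lemma aemeasurable_sourceGradTerm (hG : AEMeasurable G volume) (hf : AEMeasurable f volume) :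
    AEMeasurable (sourceGradTerm K h f G) volume := by
  have hw := aemeasurable_rdot (measurable_gradient (fun y => h (K y))) hG
  unfold sourceGradTerm
  fun_prop

lemma aemeasurable_sourceWeightTerm (hK : Measurable K) (hu : AEMeasurable u volume) (hf : AEMeasurable f volume) :
    AEMeasurable (sourceWeightTerm K h f u) volume := by
  have hN := measurable_gradient K
  have hq : Measurable fun x => deriv h (K x) := (measurable_deriv h).comp hK
  have hT := measurable_eikonalTraceF hK
  unfold sourceWeightTerm
  fun_prop

lemma aemeasurable_sourceSpeedTerm (hK : Measurable K) (hu : AEMeasurable u volume) (hf : AEMeasurable f volume) :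
    AEMeasurable (sourceSpeedTerm K h f u) volume := by
  have hN := measurable_gradient K
  have hq : Measurable fun x => deriv h (K x) := (measurable_deriv h).comp hK
  unfold sourceSpeedTerm
  fun_prop

lemma aemeasurable_sourcePsiTerm (hK : Measurable K) (hu : AEMeasurable u volume) (hf : AEMeasurable f volume) :
    AEMeasurable (sourcePsiTerm K h f u) volume := by
  have hq : Measurable fun x => deriv h (K x) := (measurable_deriv h).comp hK
  unfold sourcePsiTerm
  fun_prop

end Measurability

/-! ### The dominating density and the bounds on the coefficients. -/

section Domination

variable {d : ℕ}

local notation "𝔼" => EuclideanSpace ℝ (Fin d)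

/-- The weight `|ψ'|`, replaced by one on the unit ball. -/
noncomputable def sourceWeight (K : 𝔼 → ℝ) (h : ℝ → ℝ) (x : 𝔼) : ℝ :=
  if ‖x‖ ≤ 1 then 1 else |deriv h (K x)|

/-- The weight `|ψ'| + |ψ''|`, replaced by one on the unit ball. -/
noncomputable def energyWeight (K : 𝔼 → ℝ) (h : ℝ → ℝ) (x : 𝔼) : ℝ :=
  if ‖x‖ ≤ 1 then 1 else |deriv h (K x)| + |deriv (deriv h) (K x)|

/-- The density that dominates all the integrands of the identity. -/
noncomputable def dominant (K : 𝔼 → ℝ) (h : ℝ → ℝ) (f u : 𝔼 → ℂ)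
    (G : 𝔼 → EuclideanSpace ℂ (Fin d)) (x : 𝔼) : ℝ :=
  energyWeight K h x * (‖G x‖ ^ 2 + singularWeight x ^ 2 * ‖u x‖ ^ 2)
    + sourceWeight K h x * ‖f x‖ ^ 2

variable {lam δ : ℝ} {K : EuclideanSpace ℝ (Fin d) → ℝ} {h : ℝ → ℝ}
  {p Q : EuclideanSpace ℝ (Fin d) → ℝ} {f u : EuclideanSpace ℝ (Fin d) → ℂ}
  {G : EuclideanSpace ℝ (Fin d) → EuclideanSpace ℂ (Fin d)}

lemma sourceWeight_nonneg (x : 𝔼) : 0 ≤ sourceWeight K h x := by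
  unfold sourceWeight; split_ifs <;> positivity

lemma energyWeight_nonneg (x : 𝔼) : 0 ≤ energyWeight K h x := by
  unfold energyWeight; split_ifs <;> positivity

lemma sourceWeight_le_energyWeight (x : 𝔼) : sourceWeight K h x ≤ energyWeight K h x := by
  unfold sourceWeight energyWeight
  split_ifs
  · exact le_rfl
  · linarith [abs_nonneg (deriv (deriv h) (K x))]

lemma measurable_sourceWeight (hK : Measurable K) : Measurable (sourceWeight K h) :=
  Measurable.ite (measurableSet_le measurable_norm measurable_const) measurable_const
    ((measurable_deriv h).comp hK).abs

lemma measurable_energyWeight (hK : Measurable K) : Measurable (energyWeight K h) :=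
  Measurable.ite (measurableSet_le measurable_norm measurable_const) measurable_const
    (((measurable_deriv h).comp hK).abs.add ((measurable_deriv (deriv h)).comp hK).abs)

/-- On the unit ball the weights are one and local square integrability of `u`, `∇u` and `f`
suffices; outside they are the weights of the decay hypothesis. Hardy's inequality adds the singular
factor on `|u|²`. -/
lemma integrable_dominant (hd : 3 ≤ d) (hK : Measurable K) (hf : AEStronglyMeasurable f volume)
    (hf2 : LocallyIntegrable (fun x => ‖f x‖ ^ 2) volume) (hu : IsH1LocWithGradient u G)
    (ha : Integrable (fun x => (|deriv h (K x)| + |deriv (deriv h) (K x)|) *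
        (‖u x‖ ^ 2 + ‖G x‖ ^ 2) + |deriv h (K x)| * ‖f x‖ ^ 2) volume) :
    Integrable (dominant K h f u G) := by
  have hB : IsCompact (Metric.closedBall (0 : 𝔼) 1) := isCompact_closedBall _ _
  have hloc : IntegrableOn (fun x => ‖u x‖ ^ 2 + ‖G x‖ ^ 2 + ‖f x‖ ^ 2)
      (Metric.closedBall 0 1) :=
    ((hu.sq.integrableOn_isCompact hB).add (hu.sq_grad.integrableOn_isCompact hB)).add
      (hf2.integrableOn_isCompact hB)
  have hloc' := (integrable_indicator_iff hB.measurableSet).2 hloc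
  have hμ : AEStronglyMeasurable (energyWeight K h) volume :=
    (measurable_energyWeight hK).aestronglyMeasurable
  have hφ : AEStronglyMeasurable (sourceWeight K h) volume :=
    (measurable_sourceWeight hK).aestronglyMeasurable
  have h1 : Integrable (fun x => energyWeight K h x * (‖u x‖ ^ 2 + ‖G x‖ ^ 2)
      + sourceWeight K h x * ‖f x‖ ^ 2) := by
    refine (ha.add hloc').mono' ((hμ.mul ((hu.meas.norm.pow 2).add
      (hu.meas_grad.norm.pow 2))).add (hφ.mul (hf.norm.pow 2))) (Eventually.of_forall fun x => ?_)
    have e1 := energyWeight_nonneg (K := K) (h := h) x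
    have e2 := sourceWeight_nonneg (K := K) (h := h) x
    rw [Real.norm_of_nonneg (by positivity), Pi.add_apply]
    by_cases hx : ‖x‖ ≤ 1
    · rw [indicator_of_mem (by simpa using hx), energyWeight, sourceWeight, if_pos hx, if_pos hx]
      have : 0 ≤ (|deriv h (K x)| + |deriv (deriv h) (K x)|) *
        (‖u x‖ ^ 2 + ‖G x‖ ^ 2) + |deriv h (K x)| * ‖f x‖ ^ 2 := by positivity
      linarith
    · rw [indicator_of_notMem (by simpa using hx), energyWeight, sourceWeight, if_neg hx,
        if_neg hx, add_zero]
  have hle : ∀ x, energyWeight K h x * ‖u x‖ ^ 2 ≤ energyWeight K h x * (‖u x‖ ^ 2 + ‖G x‖ ^ 2)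
      + sourceWeight K h x * ‖f x‖ ^ 2 := fun x => by
    have e1 := energyWeight_nonneg (K := K) (h := h) x
    have e2 := sourceWeight_nonneg (K := K) (h := h) x
    nlinarith [mul_nonneg e1 (sq_nonneg ‖G x‖), mul_nonneg e2 (sq_nonneg ‖f x‖)]
  have hU : Integrable (fun x => energyWeight K h x * ‖u x‖ ^ 2) := by
    refine h1.mono' (hμ.mul (hu.meas.norm.pow 2)) (Eventually.of_forall fun x => ?_)
    have e1 := energyWeight_nonneg (K := K) (h := h) x
    rw [Real.norm_of_nonneg (by positivity)]
    exact hle x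
  have hUs := hu.integrable_mul_singularWeight_sq hd (M := 1) energyWeight_nonneg
    (fun x hx => by rw [energyWeight, if_pos hx]) hμ hU
  refine (h1.add hUs).mono' ((hμ.mul ((hu.meas_grad.norm.pow 2).add
    ((measurable_singularWeight.pow_const 2).aestronglyMeasurable.mul
    (hu.meas.norm.pow 2)))).add (hφ.mul (hf.norm.pow 2))) (Eventually.of_forall fun x => ?_)
  have e1 := energyWeight_nonneg (K := K) (h := h) x
  have e2 := sourceWeight_nonneg (K := K) (h := h) x
  have e3 : 0 ≤ energyWeight K h x * ‖u x‖ ^ 2 := by positivity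
  rw [Real.norm_of_nonneg (by unfold dominant; positivity), Pi.add_apply, dominant]
  linarith

/-- The pointwise bounds for the coefficients of the identity. -/
structure CoefficientBounds (lam : ℝ) (p Q K : 𝔼 → ℝ) (h : ℝ → ℝ) (C : ℝ) (x : 𝔼) : Prop where
  one_le : 1 ≤ C
  ne_zero : x ≠ 0
  pos : 0 < K x
  gradient_ne : ‖∇ K x‖ ≠ 0
  sqrt_le : √lam ≤ C
  dim_le : (d : ℝ) ≤ C
  profile_div : |deriv h (K x)| / K x ≤ C * sourceWeight K h x
  profile_mul : |deriv h (K x)| * singularWeight x ≤ C * sourceWeight K h x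
  profile_deriv : |deriv (deriv h) (K x)| ≤ C * energyWeight K h x
  inv_le : (K x)⁻¹ ≤ C * singularWeight x
  potential : |Q x| ≤ C * singularWeight x ^ 2
  gradient_le : ‖∇ K x‖ ≤ C
  gradient_potential : ‖∇ p x‖ ≤ C
  entry_le : ∀ i j, |eikonalF K i j x| ≤ C
  trace_le : |eikonalTraceF K x| ≤ C
  fderiv_trace_le : ‖fderiv ℝ (eikonalTraceF K) x‖ ≤ C * singularWeight x
  fderiv_speed_le : ‖fderiv ℝ (fun y => ‖∇ K y‖ ^ 2) x‖ ≤ C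

/-- Off the origin `|∇K|²` is `1 + p/λ`, so its derivative stays bounded near the origin even though
`D²K` may be of size `1/|x|`. -/
lemma IsEikonalSolution.hasFDerivAt_speed (hK : IsEikonalSolution p lam K)
    (hp : ContDiff ℝ ∞ p) {x : 𝔼} (hx : x ≠ 0) :
    HasFDerivAt (fun y => ‖∇ K y‖ ^ 2) (lam⁻¹ • fderiv ℝ p x) x := by
  have h1 : HasFDerivAt (fun y => 1 + lam⁻¹ * p y) (lam⁻¹ • fderiv ℝ p x) x :=
    ((hp.differentiable (by simp)).differentiableAt.hasFDerivAt.const_mul lam⁻¹).const_add 1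
  refine h1.congr_of_eventuallyEq ?_
  filter_upwards [compl_zero_mem_nhds hx] with y hy
  rw [hK.eikonal y hy]
  ring

lemma IsEikonalSolution.exists_coefficientBounds (hd : 3 ≤ d) (hlam : 0 < lam) (hδ : 0 < δ)
    (hpQ : IsAdmissiblePotential d p Q δ) (hpos : ∀ x, 0 < 1 + p x / lam)
    (hK : IsEikonalSolution p lam K) (hh : IsRegularProfile h) :
    ∃ C, ∀ x, x ≠ 0 → CoefficientBounds lam p Q K h C x := by
  obtain ⟨M, hM0, hM, hM'⟩ := hpQ.exists_bound hδ
  obtain ⟨c, hc, hcp⟩ := hpQ.exists_speed_lower_bound hδ hlam hpos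
  obtain ⟨C1, hC10, hC1⟩ := hK.exists_upper_bound
  obtain ⟨c', hc', hcK⟩ := hK.exists_lower_bound hc hcp
  obtain ⟨C2, hC20, hC2⟩ := hpQ.exists_singular_bound hd hδ
  -- On the unit ball `K ≤ C1`; the extra one gives the strict inequality required by the bound on
  -- `h''`.
  obtain ⟨L, hL0, hL⟩ := hh.exists_deriv_bound (C1 + 1)
  obtain ⟨L', hL'0, hL'⟩ := hh.exists_deriv_deriv_bound (C1 + 1)
  choose E hE using fun i j => (isSymbol_eikonalF hK i j).bound
  obtain ⟨T, hT⟩ := (isSymbol_eikonalTraceF hK).bound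
  obtain ⟨T', hT'⟩ := (isSymbol_eikonalTraceF hK).bound_fderiv
  set Et := ∑ i, ∑ j, |E i j| with hEt
  have hEt0 : 0 ≤ Et := by positivity
  -- A sum of nonnegative terms, so that each constant is at most `C`.
  set C := 1 + √lam + d + L + L * C1 + c'⁻¹ + L' + C2 + (1 + M / lam) + M + Et + |T| + |T'|
    with hC
  have hlM : 0 ≤ M / lam := by positivity
  have hs0 : 0 ≤ √lam := Real.sqrt_nonneg _
  have hd0 : (0 : ℝ) ≤ d := Nat.cast_nonneg _
  have hLC : 0 ≤ L * C1 := by positivity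
  have hci : 0 < c'⁻¹ := by positivity
  have hT0 := abs_nonneg T
  have hT'0 := abs_nonneg T'
  have hC1' : 1 ≤ C := by rw [hC]; linarith
  refine ⟨C, fun x hx => ?_⟩
  have hKx := hK.pos x hx
  have hx0 := norm_pos_iff.2 hx
  have hω := one_le_singularWeight x
  have hωi := inv_norm_le_singularWeight x
  have hKi : (K x)⁻¹ ≤ c'⁻¹ * ‖x‖⁻¹ := by
    rw [← mul_inv]
    exact inv_anti₀ (by positivity) (hcK x)
  have hsp := hK.eikonal x hx
  have hsp1 : ‖∇ K x‖ ^ 2 ≤ 1 + M / lam := by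
    rw [hsp]
    have := (le_abs_self _).trans (hM x)
    gcongr
  refine ⟨hC1', hx, hKx, ?_, by rw [hC]; linarith, by rw [hC]; linarith, ?_, ?_, ?_, ?_, ?_, ?_,
    ?_, ?_, ?_, ?_, ?_⟩
  · intro h0
    rw [h0] at hsp
    have := hpos x
    norm_num at hsp
    linarith
  · rw [sourceWeight]
    split_ifs with h1
    · rw [div_le_iff₀ hKx]
      have hKC : K x ≤ C1 + 1 := by 
        linarith [hC1 x, mul_le_of_le_one_right hC10 h1]
      refine (hL _ hKx hKC).trans ?_
      gcongr
      rw [hC]; linarith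
    · push Not at h1
      rw [div_eq_mul_inv, mul_comm]
      gcongr
      refine hKi.trans ?_
      have h2 : ‖x‖⁻¹ ≤ 1 := inv_le_one_of_one_le₀ h1.le
      calc c'⁻¹ * ‖x‖⁻¹ ≤ c'⁻¹ * 1 := by gcongr
        _ ≤ C := by rw [hC]; linarith
  · rw [sourceWeight]
    split_ifs with h1
    · rw [singularWeight_of_le_one hx h1]
      have hKC : K x ≤ C1 + 1 := by 
        linarith [hC1 x, mul_le_of_le_one_right hC10 h1]
      calc |deriv h (K x)| * ‖x‖⁻¹ ≤ L * (C1 * ‖x‖) * ‖x‖⁻¹ := by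
            gcongr
            exact (hL _ hKx hKC).trans (by gcongr; exact hC1 x)
        _ = L * C1 := by field_simp
        _ ≤ C * 1 := by rw [hC]; linarith
    · push Not at h1
      rw [singularWeight_of_one_le h1.le, mul_one]
      exact le_mul_of_one_le_left (abs_nonneg _) hC1'
  · rw [energyWeight]
    split_ifs with h1
    · have hKC : K x < C1 + 1 := by 
        linarith [hC1 x, mul_le_of_le_one_right hC10 h1]
      refine (hL' _ hKx hKC).trans ?_
      rw [hC]; linarith
    · refine le_trans ?_ (le_mul_of_one_le_left (by positivity) hC1')
      linarith [abs_nonneg (deriv h (K x))]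
  · refine hKi.trans ?_
    gcongr
    rw [hC]; linarith
  · refine (hC2 x hx).trans ?_
    gcongr
    rw [hC]; linarith
  · refine le_of_sq_le_sq ?_ (by linarith)
    have h1 : 1 + M / lam ≤ C := by rw [hC]; linarith
    exact hsp1.trans (h1.trans (le_self_pow₀ hC1' two_ne_zero))
  · rw [norm_gradient]
    refine (hM' x).trans ?_
    rw [hC]; linarith
  · intro i j
    have h1 := hE i j x hx
    rw [zpow_zero, mul_one, Real.norm_eq_abs] at h1
    have h2 : |E i j| ≤ Et := by
      refine le_trans ?_ (Finset.single_le_sum (f := fun i => ∑ j, |E i j|)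
        (fun i _ => by positivity) (Finset.mem_univ i))
      exact Finset.single_le_sum (f := fun j => |E i j|) (fun j _ => abs_nonneg _)
        (Finset.mem_univ j)
    have := le_abs_self (E i j)
    rw [hC]; linarith
  · have h1 := hT x hx
    rw [zpow_zero, mul_one, Real.norm_eq_abs] at h1
    have := le_abs_self T
    rw [hC]; linarith
  · have h1 := hT' x hx
    rw [zero_sub, zpow_neg_one] at h1
    calc _ ≤ T' * ‖x‖⁻¹ := h1
      _ ≤ |T'| * singularWeight x := by gcongr; exact le_abs_self _
      _ ≤ _ := by gcongr; rw [hC]; linarith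
  · rw [(hK.hasFDerivAt_speed hpQ.smooth hx).fderiv, norm_smul, norm_inv,
      Real.norm_of_nonneg hlam.le]
    calc lam⁻¹ * ‖fderiv ℝ p x‖ ≤ lam⁻¹ * M := by gcongr; exact hM' x
      _ = M / lam := by ring
      _ ≤ C := by rw [hC]; linarith

end Domination

/-! ### Domination of each integrand. -/

section TermBounds

variable {d : ℕ} {lam δ C : ℝ} {K : EuclideanSpace ℝ (Fin d) → ℝ} {h : ℝ → ℝ}
  {p Q : EuclideanSpace ℝ (Fin d) → ℝ} {f u : EuclideanSpace ℝ (Fin d) → ℂ}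
  {G : EuclideanSpace ℝ (Fin d) → EuclideanSpace ℂ (Fin d)} {x : EuclideanSpace ℝ (Fin d)}

local notation "𝔼" => EuclideanSpace ℝ (Fin d)

/-- This lemma and the next four fix what a coefficient may contain. With `∇u` and `u` alone, each
factor `u` tolerates one power of the singular weight and `∇u` none. In products with `f`, the
coefficient is bounded by `sourceWeight`, because `|f|²` is controlled only against `ψ'` and not
against `ψ''`. -/
lemma mul_sq_norm_gradient_le_dominant {c M : ℝ} (hM : 0 ≤ M)
    (hc : c ≤ M * energyWeight K h x) : c * ‖G x‖ ^ 2 ≤ M * dominant K h f u G x := by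
  have e1 := energyWeight_nonneg (K := K) (h := h) x
  have e2 := sourceWeight_nonneg (K := K) (h := h) x
  calc c * ‖G x‖ ^ 2 ≤ M * energyWeight K h x * ‖G x‖ ^ 2 := by gcongr
    _ = M * (energyWeight K h x * (‖G x‖ ^ 2 + 0) + 0) := by ring
    _ ≤ _ := by unfold dominant; gcongr <;> positivity

lemma mul_sq_norm_le_dominant {c M : ℝ} (hM : 0 ≤ M)
    (hc : c ≤ M * (energyWeight K h x * singularWeight x ^ 2)) :
    c * ‖u x‖ ^ 2 ≤ M * dominant K h f u G x := by
  have e1 := energyWeight_nonneg (K := K) (h := h) x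
  have e2 := sourceWeight_nonneg (K := K) (h := h) x
  calc c * ‖u x‖ ^ 2 ≤ M * (energyWeight K h x * singularWeight x ^ 2) * ‖u x‖ ^ 2 := by gcongr
    _ = M * (energyWeight K h x * (0 + singularWeight x ^ 2 * ‖u x‖ ^ 2) + 0) := by ring
    _ ≤ _ := by unfold dominant; gcongr <;> positivity

lemma mul_norm_gradient_mul_norm_le_dominant {c M : ℝ} (hM : 0 ≤ M)
    (hc : c ≤ M * (energyWeight K h x * singularWeight x)) :
    c * (‖G x‖ * ‖u x‖) ≤ M * dominant K h f u G x := by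
  have e1 := energyWeight_nonneg (K := K) (h := h) x
  have e2 := sourceWeight_nonneg (K := K) (h := h) x
  have h1 : ‖G x‖ * (singularWeight x * ‖u x‖)
      ≤ ‖G x‖ ^ 2 + singularWeight x ^ 2 * ‖u x‖ ^ 2 := by
    nlinarith [sq_nonneg (‖G x‖ - singularWeight x * ‖u x‖), sq_nonneg ‖G x‖,
      sq_nonneg (singularWeight x * ‖u x‖)]
  calc c * (‖G x‖ * ‖u x‖)
      ≤ M * (energyWeight K h x * singularWeight x) * (‖G x‖ * ‖u x‖) := by gcongr
    _ = M * (energyWeight K h x * (‖G x‖ * (singularWeight x * ‖u x‖)) + 0) := by ring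
    _ ≤ _ := by unfold dominant; gcongr; positivity

lemma mul_norm_mul_norm_gradient_le_dominant {c M : ℝ} (hM : 0 ≤ M)
    (hc : c ≤ M * sourceWeight K h x) : c * (‖f x‖ * ‖G x‖) ≤ M * dominant K h f u G x := by
  have e1 := energyWeight_nonneg (K := K) (h := h) x
  have e2 := sourceWeight_nonneg (K := K) (h := h) x
  have e3 := sourceWeight_le_energyWeight (K := K) (h := h) x
  have h1 : ‖f x‖ * ‖G x‖ ≤ ‖G x‖ ^ 2 + ‖f x‖ ^ 2 := by
    nlinarith [sq_nonneg (‖f x‖ - ‖G x‖), sq_nonneg ‖f x‖, sq_nonneg ‖G x‖]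
  calc c * (‖f x‖ * ‖G x‖) ≤ M * sourceWeight K h x * (‖G x‖ ^ 2 + ‖f x‖ ^ 2) := by gcongr
    _ = M * (sourceWeight K h x * (‖G x‖ ^ 2 + 0) + sourceWeight K h x * ‖f x‖ ^ 2) := by ring
    _ ≤ _ := by unfold dominant; gcongr; positivity

lemma mul_norm_mul_norm_le_dominant {c M : ℝ} (hM : 0 ≤ M)
    (hc : c ≤ M * sourceWeight K h x) : c * (‖f x‖ * ‖u x‖) ≤ M * dominant K h f u G x := by
  have e1 := energyWeight_nonneg (K := K) (h := h) x
  have e2 := sourceWeight_nonneg (K := K) (h := h) x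
  have e3 := sourceWeight_le_energyWeight (K := K) (h := h) x
  have h1 : ‖f x‖ * ‖u x‖ ≤ ‖u x‖ ^ 2 + ‖f x‖ ^ 2 := by
    nlinarith [sq_nonneg (‖f x‖ - ‖u x‖), sq_nonneg ‖f x‖, sq_nonneg ‖u x‖]
  have h2 : ‖u x‖ ^ 2 ≤ singularWeight x ^ 2 * ‖u x‖ ^ 2 :=
    le_mul_of_one_le_left (sq_nonneg _) (one_le_pow₀ (one_le_singularWeight x))
  calc c * (‖f x‖ * ‖u x‖)
      ≤ M * sourceWeight K h x * (singularWeight x ^ 2 * ‖u x‖ ^ 2 + ‖f x‖ ^ 2) := by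
        gcongr; linarith
    _ = M * (sourceWeight K h x * (0 + singularWeight x ^ 2 * ‖u x‖ ^ 2)
        + sourceWeight K h x * ‖f x‖ ^ 2) := by ring
    _ ≤ _ := by unfold dominant; gcongr; positivity

namespace CoefficientBounds

lemma nonneg (b : CoefficientBounds lam p Q K h C x) : 0 ≤ C := zero_le_one.trans b.one_le

lemma profile_le_source (b : CoefficientBounds lam p Q K h C x) :
    |deriv h (K x)| ≤ C * sourceWeight K h x :=
  (le_mul_of_one_le_right (abs_nonneg _) (one_le_singularWeight x)).trans b.profile_mul

lemma profile_le (b : CoefficientBounds lam p Q K h C x) :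
    |deriv h (K x)| ≤ C * energyWeight K h x :=
  b.profile_le_source.trans
    (mul_le_mul_of_nonneg_left (sourceWeight_le_energyWeight x) b.nonneg)

lemma profile_div_le (b : CoefficientBounds lam p Q K h C x) :
    |deriv h (K x)| / K x ≤ C * energyWeight K h x :=
  b.profile_div.trans (mul_le_mul_of_nonneg_left (sourceWeight_le_energyWeight x) b.nonneg)

lemma profile_mul_le (b : CoefficientBounds lam p Q K h C x) :
    |deriv h (K x)| * singularWeight x ≤ C * energyWeight K h x :=
  b.profile_mul.trans (mul_le_mul_of_nonneg_left (sourceWeight_le_energyWeight x) b.nonneg)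

lemma abs_profile_div (b : CoefficientBounds lam p Q K h C x) :
    |deriv h (K x) / K x| = |deriv h (K x)| / K x := by
  rw [abs_div, abs_of_pos b.pos]

lemma speed_le (b : CoefficientBounds lam p Q K h C x) : ‖∇ K x‖ ^ 2 ≤ C ^ 2 := by
  have := b.gradient_le
  gcongr

lemma norm_radialTerm_le (b : CoefficientBounds lam p Q K h C x) :
    ‖radialTerm lam K h u G x‖ ≤ (2 * C ^ 3 + 2 * C ^ 7) * dominant K h f u G x := by
  have hC := b.nonneg
  have e1 := energyWeight_nonneg (K := K) (h := h) x
  have hω := one_le_singularWeight x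
  have hs := b.sqrt_le
  have hn := b.speed_le
  have hr := b.profile_deriv
  have hα := pow_le_pow_left₀ (abs_nonneg _) (abs_real_inner_le_norm (∇ K x) (reVec (G x))) 2
  have hβ := pow_le_pow_left₀ (abs_nonneg _) (abs_real_inner_le_norm (∇ K x) (imVec (G x))) 2
  rw [sq_abs, mul_pow] at hα hβ
  set α : ℝ := inner ℝ (∇ K x) (reVec (G x))
  set β : ℝ := inner ℝ (∇ K x) (imVec (G x))
  have h1 : (α + √lam * ‖∇ K x‖ ^ 2 * (u x).im) ^ 2 + (β - √lam * ‖∇ K x‖ ^ 2 * (u x).re) ^ 2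
      ≤ 2 * (C ^ 2 * ‖G x‖ ^ 2) + 2 * ((C * C ^ 2) ^ 2 * ‖u x‖ ^ 2) := by
    have h2 : (√lam * ‖∇ K x‖ ^ 2) ^ 2 * ‖u x‖ ^ 2 ≤ (C * C ^ 2) ^ 2 * ‖u x‖ ^ 2 := by gcongr
    have h3 : ‖∇ K x‖ ^ 2 * ‖G x‖ ^ 2 ≤ C ^ 2 * ‖G x‖ ^ 2 := by gcongr
    rw [norm_sq_eq_reVec_imVec] at h3 ⊢
    rw [sq_norm_eq_re_im] at h2 ⊢
    nlinarith [sq_nonneg (α - √lam * ‖∇ K x‖ ^ 2 * (u x).im),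
      sq_nonneg (β + √lam * ‖∇ K x‖ ^ 2 * (u x).re)]
  rw [radialTerm_eq lam h u G b.gradient_ne, Real.norm_eq_abs, abs_mul,
    abs_of_nonneg (a := _ + _) (add_nonneg (sq_nonneg _) (sq_nonneg _))]
  have h4 := mul_sq_norm_gradient_le_dominant (K := K) (h := h) (x := x) (G := G) (f := f) (u := u)
    (c := 2 * C ^ 2 * |deriv (deriv h) (K x)|) (M := 2 * C ^ 3) (by positivity)
    (by calc _ ≤ 2 * C ^ 2 * (C * energyWeight K h x) := by gcongr
          _ = _ := by ring)
  have h5 := mul_sq_norm_le_dominant (K := K) (h := h) (x := x) (G := G) (f := f) (u := u)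
    (c := 2 * C ^ 6 * |deriv (deriv h) (K x)|) (M := 2 * C ^ 7) (by positivity)
    (by calc _ ≤ 2 * C ^ 6 * (C * energyWeight K h x) := by gcongr
          _ = 2 * C ^ 7 * (energyWeight K h x * 1 ^ 2) := by ring
          _ ≤ _ := by gcongr)
  calc _ ≤ |deriv (deriv h) (K x)| *
        (2 * (C ^ 2 * ‖G x‖ ^ 2) + 2 * ((C * C ^ 2) ^ 2 * ‖u x‖ ^ 2)) := by gcongr
    _ = 2 * C ^ 2 * |deriv (deriv h) (K x)| * ‖G x‖ ^ 2
        + 2 * C ^ 6 * |deriv (deriv h) (K x)| * ‖u x‖ ^ 2 := by ring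
    _ ≤ _ := by linarith

lemma norm_angularTerm_le (b : CoefficientBounds lam p Q K h C x) :
    ‖angularTerm K h G x‖ ≤ 2 * C ^ 3 * dominant K h f u G x := by
  have hC := b.nonneg
  have e1 := energyWeight_nonneg (K := K) (h := h) x
  have hn := b.speed_le
  have h1 := norm_angularGrad_sq G b.gradient_ne
  have h2 : ‖∇ K x‖ ^ 2 * ‖angularGrad K G x‖ ^ 2 ≤ C ^ 2 * ‖G x‖ ^ 2 := by
    have : ‖∇ K x‖ ^ 2 * ‖G x‖ ^ 2 ≤ C ^ 2 * ‖G x‖ ^ 2 := by gcongr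
    nlinarith [sq_nonneg (inner ℝ (∇ K x) (reVec (G x))),
      sq_nonneg (inner ℝ (∇ K x) (imVec (G x)))]
  have h3 : |deriv h (K x) / K x - deriv (deriv h) (K x) / 2| ≤ 2 * (C * energyWeight K h x) := by
    refine (abs_sub _ _).trans ?_
    rw [b.abs_profile_div, abs_div, abs_two]
    linarith [b.profile_div_le, b.profile_deriv, abs_nonneg (deriv (deriv h) (K x))]
  rw [angularTerm, mul_assoc, Real.norm_eq_abs, abs_mul,
    abs_of_nonneg (a := ‖∇ K x‖ ^ 2 * _) (mul_nonneg (sq_nonneg _) (sq_nonneg _))]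
  calc _ ≤ 2 * (C * energyWeight K h x) * (C ^ 2 * ‖G x‖ ^ 2) := by gcongr
    _ = 2 * C ^ 3 * energyWeight K h x * ‖G x‖ ^ 2 := by ring
    _ ≤ _ := mul_sq_norm_gradient_le_dominant (by positivity) le_rfl

lemma norm_rdot_mul_conj_le (w : 𝔼 → ℝ) {M : ℝ} (hM : 0 ≤ M)
    (hw : ‖fderiv ℝ w x‖ ≤ M * (energyWeight K h x * singularWeight x)) :
    ‖rdot (∇ w x) (G x) * conj (u x)‖ ≤ M * dominant K h f u G x := by
  rw [norm_mul, RCLike.norm_conj]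
  calc _ ≤ ‖∇ w x‖ * ‖G x‖ * ‖u x‖ := by gcongr; exact norm_rdot_le _ _
    _ = ‖fderiv ℝ w x‖ * (‖G x‖ * ‖u x‖) := by rw [norm_gradient, mul_assoc]
    _ ≤ _ := mul_norm_gradient_mul_norm_le_dominant hM hw

lemma hasFDerivAt_profile (hK : IsEikonalSolution p lam K)
    (b : CoefficientBounds lam p Q K h C x)
    (hdiff : DifferentiableAt ℝ (fun y => deriv h (K y)) x) :
    HasFDerivAt (fun y => deriv h (K y)) (deriv (deriv h) (K x) • fderiv ℝ K x) x :=
  hasFDerivAt_deriv_comp hK b.ne_zero (norm_ne_zero_iff.1 b.gradient_ne) hdiff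

lemma hasFDerivAt_profile_div_mul (hK : IsEikonalSolution p lam K)
    (b : CoefficientBounds lam p Q K h C x)
    (hdiff : DifferentiableAt ℝ (fun y => deriv h (K y)) x) {m : 𝔼 → ℝ}
    (hm : DifferentiableAt ℝ m x) :
    HasFDerivAt (fun y => deriv h (K y) / K y * m y)
      ((deriv h (K x) / K x) • fderiv ℝ m x + (m x * (deriv (deriv h) (K x) * (K x)⁻¹
        - deriv h (K x) / K x * (K x)⁻¹)) • fderiv ℝ K x) x := by
  have h1 := b.hasFDerivAt_profile hK hdiff
  have h2 := (hK.differentiableAt b.ne_zero).hasFDerivAt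
  have h3 := ((h1.mul ((hasDerivAt_inv b.pos.ne').comp_hasFDerivAt x h2)).mul hm.hasFDerivAt)
  refine (h3.congr_fderiv ?_).congr_of_eventuallyEq (Eventually.of_forall fun y => ?_)
  · ext v
    simp
    field_simp
    ring
  · simp [div_eq_mul_inv]

/-- The gradient of `ψ'/K` is `(ψ''/K - ψ'/K²) ∇K`. Since `ψ'/K` and `ψ''` are both controlled by
the energy weight, it costs a single factor `1/K`, the one power of the singular weight that a
factor `u` can take. -/
lemma norm_fderiv_profile_div_mul_le (hK : IsEikonalSolution p lam K)
    (b : CoefficientBounds lam p Q K h C x)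
    (hdiff : DifferentiableAt ℝ (fun y => deriv h (K y)) x) {m : 𝔼 → ℝ}
    (hm : DifferentiableAt ℝ m x) (hm1 : |m x| ≤ C ^ 2)
    (hm2 : ‖fderiv ℝ m x‖ ≤ C * singularWeight x) :
    ‖fderiv ℝ (fun y => deriv h (K y) / K y * m y) x‖
      ≤ (C ^ 2 + 2 * C ^ 5) * (energyWeight K h x * singularWeight x) := by
  have hC := b.nonneg
  have e1 := energyWeight_nonneg (K := K) (h := h) x
  have hω0 : 0 ≤ singularWeight x := zero_le_one.trans (one_le_singularWeight x)
  have hi : 0 ≤ (K x)⁻¹ := inv_nonneg.2 b.pos.le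
  have hi1 := b.inv_le
  have hr := b.profile_deriv
  have hq := b.profile_div_le
  have hg := b.gradient_le
  rw [(b.hasFDerivAt_profile_div_mul hK hdiff hm).fderiv]
  refine (norm_add_le _ _).trans ?_
  rw [norm_smul, norm_smul, Real.norm_eq_abs, Real.norm_eq_abs, b.abs_profile_div, abs_mul,
    ← norm_gradient K x]
  have h1 : |deriv (deriv h) (K x) * (K x)⁻¹ - deriv h (K x) / K x * (K x)⁻¹|
      ≤ 2 * (C * energyWeight K h x) * (C * singularWeight x) := by
    rw [← sub_mul, abs_mul, abs_of_nonneg hi]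
    gcongr
    refine (abs_sub _ _).trans ?_
    rw [b.abs_profile_div]
    linarith
  calc _ ≤ C * energyWeight K h x * (C * singularWeight x)
        + C ^ 2 * (2 * (C * energyWeight K h x) * (C * singularWeight x)) * C := by gcongr
    _ = _ := by ring

lemma norm_gradWeightTerm_le (hK : IsEikonalSolution p lam K) (hp : ContDiff ℝ ∞ p)
    (b : CoefficientBounds lam p Q K h C x)
    (hdiff : DifferentiableAt ℝ (fun y => deriv h (K y)) x) :
    ‖gradWeightTerm K h u G x‖ ≤ (C ^ 2 + 2 * C ^ 5) * dominant K h f u G x := by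
  have hC := b.nonneg
  refine norm_rdot_mul_conj_le _ (by positivity) (b.norm_fderiv_profile_div_mul_le hK hdiff
    (hK.hasFDerivAt_speed hp b.ne_zero).differentiableAt ?_ ?_)
  · rw [abs_of_nonneg (sq_nonneg _)]; exact b.speed_le
  · exact b.fderiv_speed_le.trans (le_mul_of_one_le_right hC (one_le_singularWeight x))

lemma norm_gradTraceFTerm_le (hK : IsEikonalSolution p lam K)
    (b : CoefficientBounds lam p Q K h C x)
    (hdiff : DifferentiableAt ℝ (fun y => deriv h (K y)) x) :
    ‖gradTraceFTerm K h u G x‖ ≤ (C ^ 2 + 2 * C ^ 5) * dominant K h f u G x := by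
  have hC := b.nonneg
  refine norm_rdot_mul_conj_le _ (by positivity) (b.norm_fderiv_profile_div_mul_le hK hdiff
    ((isSymbol_eikonalTraceF hK).smooth.differentiableAt_of_ne b.ne_zero) ?_ b.fderiv_trace_le)
  exact b.trace_le.trans (le_self_pow₀ b.one_le two_ne_zero)

lemma norm_gradPsiPrimeTerm_le (hK : IsEikonalSolution p lam K)
    (b : CoefficientBounds lam p Q K h C x)
    (hdiff : DifferentiableAt ℝ (fun y => deriv h (K y)) x) :
    ‖gradPsiPrimeTerm K h u G x‖ ≤ C ^ 2 * dominant K h f u G x := by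
  have hC := b.nonneg
  have e1 := energyWeight_nonneg (K := K) (h := h) x
  refine norm_rdot_mul_conj_le _ (by positivity) ?_
  have h1 := b.profile_deriv
  have h2 := b.gradient_le
  have hω := one_le_singularWeight x
  rw [(b.hasFDerivAt_profile hK hdiff).fderiv, norm_smul, ← norm_gradient K x, Real.norm_eq_abs]
  calc _ ≤ C * energyWeight K h x * C := by gcongr
    _ = C ^ 2 * (energyWeight K h x * 1) := by ring
    _ ≤ _ := by gcongr

lemma norm_gradSpeedTerm_le (b : CoefficientBounds lam p Q K h C x) :
    ‖gradSpeedTerm K h u G x‖ ≤ C ^ 2 * dominant K h f u G x := by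
  have hC := b.nonneg
  have e1 := energyWeight_nonneg (K := K) (h := h) x
  have h1 := b.profile_le
  have h2 := b.fderiv_speed_le
  have hω := one_le_singularWeight x
  rw [gradSpeedTerm, norm_mul, norm_mul, RCLike.norm_conj, Complex.norm_real, Real.norm_eq_abs]
  calc _ ≤ ‖∇ (fun y => ‖∇ K y‖ ^ 2) x‖ * ‖G x‖ * |deriv h (K x)| * ‖u x‖ := by
        gcongr; exact norm_rdot_le _ _
    _ = ‖fderiv ℝ (fun y => ‖∇ K y‖ ^ 2) x‖ * |deriv h (K x)| * (‖G x‖ * ‖u x‖) := by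
        rw [norm_gradient]; ring
    _ ≤ _ := mul_norm_gradient_mul_norm_le_dominant (by positivity) (by
        calc _ ≤ C * (C * energyWeight K h x) := by gcongr
          _ = C ^ 2 * (energyWeight K h x * 1) := by ring
          _ ≤ _ := by gcongr)

lemma norm_weightQTerm_le (b : CoefficientBounds lam p Q K h C x) :
    ‖weightQTerm K h Q u x‖ ≤ C ^ 4 * dominant K h f u G x := by
  have hC := b.nonneg
  have h1 := b.profile_div_le
  have h2 := b.speed_le
  have h3 := b.potential
  have e1 := energyWeight_nonneg (K := K) (h := h) x
  rw [weightQTerm, norm_mul, norm_pow, norm_norm, Real.norm_eq_abs, abs_mul, abs_mul,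
    b.abs_profile_div, abs_of_nonneg (sq_nonneg ‖∇ K x‖)]
  exact mul_sq_norm_le_dominant (by positivity) (by
    calc _ ≤ C * energyWeight K h x * C ^ 2 * (C * singularWeight x ^ 2) := by gcongr
      _ = _ := by ring)

lemma norm_traceFQTerm_le (b : CoefficientBounds lam p Q K h C x) :
    ‖traceFQTerm K h Q u x‖ ≤ C ^ 3 * dominant K h f u G x := by
  have hC := b.nonneg
  have h1 := b.profile_div_le
  have h2 := b.trace_le
  have h3 := b.potential
  have e1 := energyWeight_nonneg (K := K) (h := h) x
  rw [traceFQTerm, norm_mul, norm_pow, norm_norm, Real.norm_eq_abs, abs_mul, abs_mul,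
    b.abs_profile_div]
  exact mul_sq_norm_le_dominant (by positivity) (by
    calc _ ≤ C * energyWeight K h x * C * (C * singularWeight x ^ 2) := by gcongr
      _ = _ := by ring)

lemma norm_psiQTerm_le (b : CoefficientBounds lam p Q K h C x) :
    ‖psiQTerm K h Q u x‖ ≤ C ^ 2 * dominant K h f u G x := by
  have hC := b.nonneg
  have h1 := b.profile_le
  have h3 := b.potential
  have e1 := energyWeight_nonneg (K := K) (h := h) x
  rw [psiQTerm, norm_mul, norm_pow, norm_norm, Real.norm_eq_abs, abs_mul]
  exact mul_sq_norm_le_dominant (by positivity) (by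
    calc _ ≤ C * energyWeight K h x * (C * singularWeight x ^ 2) := by gcongr
      _ = _ := by ring)

lemma gradient_profile (hh : IsRegularProfile h) (hK : IsEikonalSolution p lam K)
    (b : CoefficientBounds lam p Q K h C x) :
    ‖∇ (fun y => h (K y)) x‖ ≤ |deriv h (K x)| * C := by
  rw [gradient_profile_comp hh hK b.ne_zero, norm_smul, Real.norm_eq_abs]
  have := b.gradient_le
  gcongr

/-- Here `Q` brings two powers of the singular weight. The factor `u` absorbs one and `ψ'`, which
vanishes linearly at the origin, absorbs the other. -/
lemma norm_gradPsiQTerm_le (hh : IsRegularProfile h) (hK : IsEikonalSolution p lam K)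
    (b : CoefficientBounds lam p Q K h C x) :
    ‖gradPsiQTerm K h Q u G x‖ ≤ C ^ 3 * dominant K h f u G x := by
  have hC := b.nonneg
  have h1 := b.gradient_profile hh hK
  have h2 := b.profile_mul_le
  have h3 := b.potential
  have e1 := energyWeight_nonneg (K := K) (h := h) x
  have hω0 : 0 ≤ singularWeight x := zero_le_one.trans (one_le_singularWeight x)
  rw [gradPsiQTerm, norm_mul, norm_mul, RCLike.norm_conj, Complex.norm_real, Real.norm_eq_abs]
  calc _ ≤ |Q x| * (‖∇ (fun y => h (K y)) x‖ * ‖G x‖) * ‖u x‖ := by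
        gcongr; exact norm_rdot_le _ _
    _ = |Q x| * ‖∇ (fun y => h (K y)) x‖ * (‖G x‖ * ‖u x‖) := by ring
    _ ≤ _ := mul_norm_gradient_mul_norm_le_dominant (by positivity) (by
        calc _ ≤ (C * singularWeight x ^ 2) * (|deriv h (K x)| * C) := by gcongr
          _ = C ^ 2 * (|deriv h (K x)| * singularWeight x) * singularWeight x := by ring
          _ ≤ C ^ 2 * (C * energyWeight K h x) * singularWeight x := by gcongr
          _ = _ := by ring)

lemma norm_gradPTerm_le (hh : IsRegularProfile h) (hK : IsEikonalSolution p lam K)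
    (b : CoefficientBounds lam p Q K h C x) :
    ‖gradPTerm K h p u x‖ ≤ C ^ 3 * dominant K h f u G x := by
  have hC := b.nonneg
  have h1 := b.gradient_profile hh hK
  have h2 := b.profile_le
  have h3 := b.gradient_potential
  have e1 := energyWeight_nonneg (K := K) (h := h) x
  have hω := one_le_singularWeight x
  rw [gradPTerm, norm_mul, norm_pow, norm_norm]
  exact mul_sq_norm_le_dominant (by positivity) (by
    calc _ ≤ ‖∇ (fun y => h (K y)) x‖ * ‖∇ p x‖ := norm_inner_le_norm _ _
      _ ≤ C * energyWeight K h x * C * C := by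
        gcongr
        exact h1.trans (by gcongr)
      _ = C ^ 3 * (energyWeight K h x * 1 ^ 2) := by ring
      _ ≤ _ := by gcongr)

lemma norm_matrixFTerm_le (b : CoefficientBounds lam p Q K h C x) :
    ‖matrixFTerm K h G x‖ ≤ C ^ 4 * dominant K h f u G x := by
  have hC := b.nonneg
  have h1 := b.profile_div_le
  have h2 := b.dim_le
  have e1 := energyWeight_nonneg (K := K) (h := h) x
  have h3 : ‖∑ i, ∑ j, G x i * (eikonalF K i j x : ℂ) * conj (G x j)‖
      ≤ ∑ _i : Fin d, ∑ _j : Fin d, C * ‖G x‖ ^ 2 := by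
    refine norm_sum_le_of_le _ fun i _ => norm_sum_le_of_le _ fun j _ => ?_
    have h4 := b.entry_le i j
    have h5 := PiLp.norm_apply_le (p := 2) (G x) i
    have h6 := PiLp.norm_apply_le (p := 2) (G x) j
    rw [norm_mul, norm_mul, RCLike.norm_conj, Complex.norm_real, Real.norm_eq_abs]
    calc _ ≤ ‖G x‖ * C * ‖G x‖ := by gcongr
      _ = _ := by ring
  rw [matrixFTerm_eq, norm_mul, Complex.norm_real, Real.norm_eq_abs, b.abs_profile_div]
  simp only [Finset.sum_const, Finset.card_univ, Fintype.card_fin, nsmul_eq_mul] at h3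
  calc _ ≤ C * energyWeight K h x * (C * (C * (C * ‖G x‖ ^ 2))) := by
        gcongr
        exact h3.trans (by gcongr)
    _ = C ^ 4 * energyWeight K h x * ‖G x‖ ^ 2 := by ring
    _ ≤ _ := mul_sq_norm_gradient_le_dominant (by positivity) le_rfl

lemma norm_sommerfeldTerm_le (b : CoefficientBounds lam p Q K h C x) :
    ‖sommerfeldTerm lam K h u G x‖ ≤ (2 * C + 2 * C ^ 5) * dominant K h f u G x := by
  have hC := b.nonneg
  have e1 := energyWeight_nonneg (K := K) (h := h) x
  have hω := one_le_singularWeight x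
  have hs := b.sqrt_le
  have hn := b.gradient_le
  have hq := b.profile_le
  have h1 : ‖G x - (Complex.I * (√lam : ℂ) * u x) • toComplexVec (∇ K x)‖ ^ 2
      ≤ 2 * ‖G x‖ ^ 2 + 2 * (C ^ 4 * ‖u x‖ ^ 2) := by
    have h2 : ‖(Complex.I * (√lam : ℂ) * u x) • toComplexVec (∇ K x)‖ ≤ C * ‖u x‖ * C := by
      rw [norm_smul, norm_mul, norm_mul, Complex.norm_I, one_mul, Complex.norm_real,
        Real.norm_of_nonneg (Real.sqrt_nonneg _), norm_toComplexVec]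
      gcongr
    have h3 := (norm_sub_le (G x) ((Complex.I * (√lam : ℂ) * u x) • toComplexVec (∇ K x))).trans
      (add_le_add_right h2 ‖G x‖)
    calc _ ≤ (‖G x‖ + C * ‖u x‖ * C) ^ 2 := by gcongr
      _ ≤ _ := by nlinarith [sq_nonneg (‖G x‖ - C * ‖u x‖ * C)]
  have h4 := mul_sq_norm_gradient_le_dominant (K := K) (h := h) (x := x) (G := G) (f := f) (u := u)
    (c := 2 * |deriv h (K x)|) (M := 2 * C) (by positivity) (by linarith)
  have h5 := mul_sq_norm_le_dominant (K := K) (h := h) (x := x) (G := G) (f := f) (u := u)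
    (c := 2 * C ^ 4 * |deriv h (K x)|) (M := 2 * C ^ 5) (by positivity)
    (by calc _ ≤ 2 * C ^ 4 * (C * energyWeight K h x) := by gcongr
          _ = 2 * C ^ 5 * (energyWeight K h x * 1 ^ 2) := by ring
          _ ≤ _ := by gcongr)
  rw [sommerfeldTerm, Real.norm_eq_abs, abs_mul, abs_of_nonneg (a := ‖_‖ ^ 2) (sq_nonneg _)]
  calc _ ≤ |deriv h (K x)| * (2 * ‖G x‖ ^ 2 + 2 * (C ^ 4 * ‖u x‖ ^ 2)) := by gcongr
    _ = 2 * |deriv h (K x)| * ‖G x‖ ^ 2 + 2 * C ^ 4 * |deriv h (K x)| * ‖u x‖ ^ 2 := by ring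
    _ ≤ _ := by linarith

lemma norm_sourceGradTerm_le (hh : IsRegularProfile h) (hK : IsEikonalSolution p lam K)
    (b : CoefficientBounds lam p Q K h C x) :
    ‖sourceGradTerm K h f G x‖ ≤ C ^ 2 * dominant K h f u G x := by
  have hC := b.nonneg
  have h1 := b.gradient_profile hh hK
  have h2 := b.profile_le_source
  rw [sourceGradTerm, norm_mul, RCLike.norm_conj]
  calc _ ≤ ‖f x‖ * (‖∇ (fun y => h (K y)) x‖ * ‖G x‖) := by gcongr; exact norm_rdot_le _ _
    _ = ‖∇ (fun y => h (K y)) x‖ * (‖f x‖ * ‖G x‖) := by ring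
    _ ≤ _ := mul_norm_mul_norm_gradient_le_dominant (by positivity) (by
      calc _ ≤ |deriv h (K x)| * C := h1
        _ ≤ C * sourceWeight K h x * C := by gcongr
        _ = _ := by ring)

lemma norm_sourceWeightTerm_le (hd : 3 ≤ d) (b : CoefficientBounds lam p Q K h C x) :
    ‖sourceWeightTerm K h f u x‖ ≤ (C ^ 4 + C ^ 2) * dominant K h f u G x := by
  have hC := b.nonneg
  have h1 := b.profile_div
  have h2 := b.speed_le
  have h3 := b.trace_le
  have e2 := sourceWeight_nonneg (K := K) (h := h) x
  have hd1 : (3 : ℝ) ≤ d := by exact_mod_cast hd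
  have h4 : |((d : ℝ) - 1) * ‖∇ K x‖ ^ 2 + eikonalTraceF K x| ≤ C * C ^ 2 + C := by
    refine (abs_add_le _ _).trans (add_le_add ?_ h3)
    rw [abs_of_nonneg (mul_nonneg (by linarith) (sq_nonneg _))]
    gcongr
    linarith [b.dim_le]
  have h5 : deriv h (K x) * (((d : ℝ) - 1) / K x * ‖∇ K x‖ ^ 2 + 1 / K x * eikonalTraceF K x)
      = deriv h (K x) / K x * (((d : ℝ) - 1) * ‖∇ K x‖ ^ 2 + eikonalTraceF K x) := by ring
  rw [sourceWeightTerm, h5, norm_mul, norm_mul, RCLike.norm_conj, Complex.norm_real,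
    Real.norm_eq_abs, abs_mul, b.abs_profile_div]
  calc _ = |deriv h (K x)| / K x * |((d : ℝ) - 1) * ‖∇ K x‖ ^ 2 + eikonalTraceF K x|
        * (‖f x‖ * ‖u x‖) := by ring
    _ ≤ _ := mul_norm_mul_norm_le_dominant (by positivity) (by
      calc _ ≤ C * sourceWeight K h x * (C * C ^ 2 + C) := by gcongr
        _ = _ := by ring)

lemma norm_sourceSpeedTerm_le (b : CoefficientBounds lam p Q K h C x) :
    ‖sourceSpeedTerm K h f u x‖ ≤ C ^ 3 * dominant K h f u G x := by
  have hC := b.nonneg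
  have h1 := b.profile_le_source
  have h2 := b.speed_le
  rw [sourceSpeedTerm, norm_mul, norm_mul, RCLike.norm_conj, Complex.norm_real,
    Real.norm_eq_abs, abs_mul, abs_of_nonneg (sq_nonneg _), mul_assoc _ ‖f x‖]
  exact mul_norm_mul_norm_le_dominant (by positivity) (by
    calc _ ≤ C ^ 2 * (C * sourceWeight K h x) := by gcongr
      _ = _ := by ring)

lemma norm_sourcePsiTerm_le (b : CoefficientBounds lam p Q K h C x) :
    ‖sourcePsiTerm K h f u x‖ ≤ C * dominant K h f u G x := by
  rw [sourcePsiTerm, norm_mul, norm_mul, RCLike.norm_conj, Complex.norm_real,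
    Real.norm_eq_abs, mul_assoc _ ‖f x‖]
  exact mul_norm_mul_norm_le_dominant b.nonneg b.profile_le_source

end CoefficientBounds

end TermBounds

/-! ### The pointwise multiplier identity. -/

section PointwiseIdentity

variable {d : ℕ} {lam ε δ C : ℝ} {K : EuclideanSpace ℝ (Fin d) → ℝ} {h : ℝ → ℝ}
  {p Q : EuclideanSpace ℝ (Fin d) → ℝ} {f u : EuclideanSpace ℝ (Fin d) → ℂ}
  {G : EuclideanSpace ℝ (Fin d) → EuclideanSpace ℂ (Fin d)} {x : EuclideanSpace ℝ (Fin d)}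

local notation "𝔼" => EuclideanSpace ℝ (Fin d)

/-- The difference of the two sides of the identity, under one integral sign. -/
noncomputable def combinedIntegrand (lam ε : ℝ) (K : 𝔼 → ℝ) (h : ℝ → ℝ) (p Q : 𝔼 → ℝ)
    (f u : 𝔼 → ℂ) (G : 𝔼 → EuclideanSpace ℂ (Fin d)) (x : 𝔼) : ℝ :=
  1 / 2 * radialTerm lam K h u G x + angularTerm K h G x
    + ((d : ℝ) - 1) / 2 * (gradWeightTerm K h u G x).re
    - ((d : ℝ) - 1) / 2 * weightQTerm K h Q u x
    - (gradPsiQTerm K h Q u G x).re - √lam * (gradSpeedTerm K h u G x).im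
    + 1 / 2 * gradPTerm K h p u x + (matrixFTerm K h G x).re
    + 1 / 2 * (gradTraceFTerm K h u G x).re - 1 / 2 * traceFQTerm K h Q u x
    + ε / (2 * √lam) * sommerfeldTerm lam K h u G x - ε / (2 * √lam) * psiQTerm K h Q u x
    + ε / (2 * √lam) * (gradPsiPrimeTerm K h u G x).re
    + (sourceGradTerm K h f G x).re + 1 / 2 * (sourceWeightTerm K h f u x).re
    - √lam * (sourceSpeedTerm K h f u x).im + ε / (2 * √lam) * (sourcePsiTerm K h f u x).re

/-- The weight of the multiplier `ū`. -/
noncomputable def zerothWeight (lam ε : ℝ) (K : 𝔼 → ℝ) (h : ℝ → ℝ) (x : 𝔼) : ℝ :=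
  ((d : ℝ) - 1) / 2 * (deriv h (K x) / K x * ‖∇ K x‖ ^ 2)
    + 1 / 2 * (deriv h (K x) / K x * eikonalTraceF K x) + ε / (2 * √lam) * deriv h (K x)

/-- The error made by cutting off, which is linear in the differential `L` of the cutoff. -/
noncomputable def cutoffError (lam ε : ℝ) (K : 𝔼 → ℝ) (h : ℝ → ℝ) (u : 𝔼 → ℂ)
    (G : 𝔼 → EuclideanSpace ℂ (Fin d)) (L : 𝔼 →L[ℝ] ℝ) (x : 𝔼) : ℝ :=
  deriv h (K x) * (L (reVec (G x)) * inner ℝ (∇ K x) (reVec (G x))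
      + L (imVec (G x)) * inner ℝ (∇ K x) (imVec (G x)))
    - 1 / 2 * deriv h (K x) * L (∇ K x) * ‖G x‖ ^ 2
    + 1 / 2 * lam * ‖∇ K x‖ ^ 2 * deriv h (K x) * L (∇ K x) * ‖u x‖ ^ 2
    + zerothWeight lam ε K h x * (L (reVec (G x)) * (u x).re + L (imVec (G x)) * (u x).im)
    + √lam * deriv h (K x) * ‖∇ K x‖ ^ 2
      * (L (reVec (G x)) * (u x).im - L (imVec (G x)) * (u x).re)

lemma gradPsiQTerm_re (hh : IsRegularProfile h) (hK : IsEikonalSolution p lam K) (hx : x ≠ 0) :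
    (gradPsiQTerm K h Q u G x).re = Q x * deriv h (K x) *
      (inner ℝ (∇ K x) (reVec (G x)) * (u x).re + inner ℝ (∇ K x) (imVec (G x)) * (u x).im) := by
  rw [gradPsiQTerm, gradient_profile_comp hh hK hx, rdot_smul, mul_assoc, Complex.re_ofReal_mul,
    map_mul, Complex.conj_ofReal, mul_assoc, Complex.re_ofReal_mul, Complex.mul_re,
    Complex.conj_re, Complex.conj_im, rdot_re, rdot_im]
  ring

lemma sourceGradTerm_re (hh : IsRegularProfile h) (hK : IsEikonalSolution p lam K) (hx : x ≠ 0) :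
    (sourceGradTerm K h f G x).re = deriv h (K x) *
      ((f x).re * inner ℝ (∇ K x) (reVec (G x)) + (f x).im * inner ℝ (∇ K x) (imVec (G x))) := by
  rw [sourceGradTerm, gradient_profile_comp hh hK hx, rdot_smul, map_mul, Complex.conj_ofReal,
    mul_left_comm, Complex.re_ofReal_mul, Complex.mul_re, Complex.conj_re, Complex.conj_im,
    rdot_re, rdot_im]
  ring

lemma gradPTerm_eq (hh : IsRegularProfile h) (hK : IsEikonalSolution p lam K) (hx : x ≠ 0) :
    gradPTerm K h p u x = deriv h (K x) * fderiv ℝ p x (∇ K x) * ‖u x‖ ^ 2 := by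
  rw [gradPTerm, gradient_profile_comp hh hK hx, real_inner_smul_left, real_inner_comm,
    inner_gradient]

lemma sourceWeightTerm_re : (sourceWeightTerm K h f u x).re = deriv h (K x) *
    (((d : ℝ) - 1) / K x * ‖∇ K x‖ ^ 2 + 1 / K x * eikonalTraceF K x)
      * ((f x).re * (u x).re + (f x).im * (u x).im) := by
  rw [sourceWeightTerm, mul_comm (f x), mul_assoc, Complex.re_ofReal_mul, Complex.mul_re,
    Complex.conj_re, Complex.conj_im]
  ring

lemma sourceSpeedTerm_im : (sourceSpeedTerm K h f u x).im = ‖∇ K x‖ ^ 2 * deriv h (K x)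
    * ((f x).im * (u x).re - (f x).re * (u x).im) := by
  rw [sourceSpeedTerm, mul_assoc, Complex.im_ofReal_mul, Complex.mul_im,
    Complex.conj_re, Complex.conj_im]
  ring

lemma sourcePsiTerm_re : (sourcePsiTerm K h f u x).re = deriv h (K x)
    * ((f x).re * (u x).re + (f x).im * (u x).im) := by
  rw [sourcePsiTerm, mul_assoc, Complex.re_ofReal_mul, Complex.mul_re,
    Complex.conj_re, Complex.conj_im]
  ring

/-- The identity of real numbers behind the pointwise identity. -/
lemma multiplier_algebra {fr fi a b P q r k n2 s ε Qx D t α β A2 B2 U G2 AF BF dA dB dN : ℝ}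
    {θ tA tB tN pN w1A w1B w2A w2B n2A n2B : ℝ} (hk : k ≠ 0) (hs : s ≠ 0)
    (hU : U = a ^ 2 + b ^ 2) (hG : G2 = A2 + B2) (hP : P = s ^ 2 * n2 - s ^ 2)
    (hdA : k * dA = AF + n2 * A2 - α ^ 2) (hdB : k * dB = BF + n2 * B2 - β ^ 2)
    (hdN : k * dN = (D - 1) * n2 + t) {ρ : ℝ}
    (hρ : ρ = (D - 1) / 2 * (q / k * n2) + 1 / 2 * (q / k * t) + ε / (2 * s) * q) :
    ((fr - (P + Qx + s ^ 2) * a + ε * b) * (q * (θ * α))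
        + (q * (tA * α + θ * dA) + r * θ * α ^ 2)
        - 1 / 2 * (r * θ * n2 + q * (tN + θ * dN)) * A2)
      + ((fi - (P + Qx + s ^ 2) * b - ε * a) * (q * (θ * β))
        + (q * (tB * β + θ * dB) + r * θ * β ^ 2)
        - 1 / 2 * (r * θ * n2 + q * (tN + θ * dN)) * B2)
      + 1 / 2 * ((2 * a * (q * (θ * (P + s ^ 2) * α))
          + (r * (θ * (P + s ^ 2)) * n2 + q * ((P + s ^ 2) * tN + θ * pN
            + θ * (P + s ^ 2) * dN)) * a * a)
        + (2 * b * (q * (θ * (P + s ^ 2) * β))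
          + (r * (θ * (P + s ^ 2)) * n2 + q * ((P + s ^ 2) * tN + θ * pN
            + θ * (P + s ^ 2) * dN)) * b * b))
      + (θ * ρ * (fr * a + fi * b - (P + Qx + s ^ 2) * U + G2)
        + ((θ * ((D - 1) / 2 * w1A + 1 / 2 * w2A + ε / (2 * s) * (r * α)) + ρ * tA) * a
          + (θ * ((D - 1) / 2 * w1B + 1 / 2 * w2B + ε / (2 * s) * (r * β)) + ρ * tB) * b))
      + (θ * (s * (q * n2)) * (fr * b - fi * a + ε * U)
        + ((θ * (s * (q * n2A + n2 * (r * α))) + s * (q * n2) * tA) * b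
          - (θ * (s * (q * n2B + n2 * (r * β))) + s * (q * n2) * tB) * a))
    = θ * (1 / 2 * (r * ((α + s * n2 * b) ^ 2 + (β - s * n2 * a) ^ 2))
        + (q / k - r / 2) * (n2 * G2 - (α ^ 2 + β ^ 2))
        + (D - 1) / 2 * (w1A * a + w1B * b) - (D - 1) / 2 * (q / k * n2 * Qx * U)
        - Qx * q * (α * a + β * b) - s * (q * (n2B * a - n2A * b))
        + 1 / 2 * (q * pN * U) + q / k * (AF + BF)
        + 1 / 2 * (w2A * a + w2B * b) - 1 / 2 * (q / k * t * Qx * U)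
        + ε / (2 * s) * (q * (G2 + 2 * s * (α * b - β * a) + s ^ 2 * n2 * U))
        - ε / (2 * s) * (q * Qx * U) + ε / (2 * s) * (r * α * a + r * β * b)
        + q * (fr * α + fi * β) + 1 / 2 * (q * ((D - 1) / k * n2 + 1 / k * t) * (fr * a + fi * b))
        - s * (n2 * q * (fi * a - fr * b)) + ε / (2 * s) * (q * (fr * a + fi * b)))
      + (q * (tA * α + tB * β) - 1 / 2 * q * tN * G2 + 1 / 2 * s ^ 2 * n2 * q * tN * U
        + ρ * (tA * a + tB * b) + s * q * n2 * (tA * b - tB * a)) := by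
  -- In the application `q`, `r` are `ψ'`, `ψ''`, while `k = K`, `s = √λ`, `n2 = |∇K|²`, and `α`,
  -- `β` are the products of `∇K` with the gradients of `Re u`, `Im u`. The letters `t·` are
  -- derivatives of the cutoff, and `dA`, `dB`, `dN` carry the second derivatives of `K`. Once these
  -- are eliminated by the Hessian formula, and `P` by the eikonal equation, the rest is polynomial.
  have h1 : dA = (AF + n2 * A2 - α ^ 2) / k := by rw [← hdA]; field_simp
  have h2 : dB = (BF + n2 * B2 - β ^ 2) / k := by rw [← hdB]; field_simp
  have h3 : dN = ((D - 1) * n2 + t) / k := by rw [← hdN]; field_simp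
  subst hU hG hP hρ h1 h2 h3
  field_simp
  ring

variable {θ : EuclideanSpace ℝ (Fin d) → ℝ}

lemma fderiv_profile_smul_gradient (hK : IsEikonalSolution p lam K)
    (b : CoefficientBounds lam p Q K h C x)
    (hdiff : DifferentiableAt ℝ (fun y => deriv h (K y)) x) (hθ : DifferentiableAt ℝ θ x) (v : 𝔼) :
    fderiv ℝ (fun y => deriv h (K y) • θ y • ∇ K y) x v
      = (deriv h (K x) * fderiv ℝ θ x v + deriv (deriv h) (K x) * θ x * inner ℝ (∇ K x) v) • ∇ K x
        + (deriv h (K x) * θ x) • fderiv ℝ (∇ K) x v := by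
  have hN := (contDiffOn_gradient hK.smooth).differentiableAt_of_ne b.ne_zero
  have h1 := (b.hasFDerivAt_profile hK hdiff).smul (hθ.hasFDerivAt.smul hN.hasFDerivAt)
  have h2 : fderiv ℝ (fun y => deriv h (K y) • θ y • ∇ K y) x = _ := h1.fderiv
  rw [h2]
  simp only [add_apply, smul_apply, Pi.smul_apply',
    ContinuousLinearMap.smulRight_apply, ← inner_gradient K, smul_add, smul_smul, smul_eq_mul]
  module

lemma divergence_profile_smul_gradient (hK : IsEikonalSolution p lam K)
    (b : CoefficientBounds lam p Q K h C x)
    (hdiff : DifferentiableAt ℝ (fun y => deriv h (K y)) x) (hθ : DifferentiableAt ℝ θ x) :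
    divergence (fun y => deriv h (K y) • θ y • ∇ K y) x
      = deriv (deriv h) (K x) * θ x * ‖∇ K x‖ ^ 2
        + deriv h (K x) * (fderiv ℝ θ x (∇ K x) + θ x * divergence (∇ K) x) := by
  have hN := (contDiffOn_gradient hK.smooth).differentiableAt_of_ne b.ne_zero
  have hθN : DifferentiableAt ℝ (fun y => θ y • ∇ K y) x := hθ.smul hN
  rw [divergence_smul hdiff hθN, divergence_smul hθ hN,
    (b.hasFDerivAt_profile hK hdiff).fderiv, smul_apply, ← inner_gradient K,
    real_inner_smul_right, real_inner_self_eq_norm_sq, smul_eq_mul]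
  ring

lemma hasFDerivAt_zerothWeight (hK : IsEikonalSolution p lam K)
    (hp : ContDiff ℝ ∞ p) (b : CoefficientBounds lam p Q K h C x)
    (hdiff : DifferentiableAt ℝ (fun y => deriv h (K y)) x) :
    HasFDerivAt (zerothWeight lam ε K h)
      ((((d : ℝ) - 1) / 2) • fderiv ℝ (fun y => deriv h (K y) / K y * ‖∇ K y‖ ^ 2) x
        + (1 / 2 : ℝ) • fderiv ℝ (fun y => deriv h (K y) / K y * eikonalTraceF K y) x
        + (ε / (2 * √lam)) • fderiv ℝ (fun y => deriv h (K y)) x) x := by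
  have h1 := (b.hasFDerivAt_profile_div_mul hK hdiff
    (hK.hasFDerivAt_speed hp b.ne_zero).differentiableAt).differentiableAt.hasFDerivAt
  have h2 := (b.hasFDerivAt_profile_div_mul hK hdiff
    ((isSymbol_eikonalTraceF hK).smooth.differentiableAt_of_ne
      b.ne_zero)).differentiableAt.hasFDerivAt
  exact ((h1.const_mul _).add (h2.const_mul _)).add (hdiff.hasFDerivAt.const_mul _)

/-- The left side collects the integrands of the six vanishing integrals. The two stress terms come
from the multiplier `θ ∇ψ · ∇ū`; the two flux terms integrate `½ (p + λ) θ ∇ψ · ∇|u|²` by parts; the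
last two groups are the real part for the weight `θ ρ` and the imaginary part for `θ √λ ψ' |∇K|²`.
The derivative of `ρ` is kept as the gradients appearing in the identity, since `ρ` contains second
derivatives of `g`. -/
theorem multiplier_pointwise (hlam : 0 < lam) (hh : IsRegularProfile h)
    (hK : IsEikonalSolution p lam K) (hp : ContDiff ℝ ∞ p)
    (b : CoefficientBounds lam p Q K h C x)
    (hdiff : DifferentiableAt ℝ (fun y => deriv h (K y)) x) (hθ : DifferentiableAt ℝ θ x) :
    ((helmholtzSource p Q lam ε f u x).re
        * inner ℝ (deriv h (K x) • θ x • ∇ K x) (reVec (G x))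
      + inner ℝ (fderiv ℝ (fun y => deriv h (K y) • θ y • ∇ K y) x (reVec (G x))) (reVec (G x))
      - 1 / 2 * divergence (fun y => deriv h (K y) • θ y • ∇ K y) x
        * inner ℝ (reVec (G x)) (reVec (G x)))
    + ((helmholtzSource p Q lam ε f u x).im
        * inner ℝ (deriv h (K x) • θ x • ∇ K x) (imVec (G x))
      + inner ℝ (fderiv ℝ (fun y => deriv h (K y) • θ y • ∇ K y) x (imVec (G x))) (imVec (G x))
      - 1 / 2 * divergence (fun y => deriv h (K y) • θ y • ∇ K y) x
        * inner ℝ (imVec (G x)) (imVec (G x)))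
    + 1 / 2 * ((2 * (u x).re
          * inner ℝ (deriv h (K x) • (θ x * (p x + lam)) • ∇ K x) (reVec (G x))
        + divergence (fun y => deriv h (K y) • (θ y * (p y + lam)) • ∇ K y) x
          * (u x).re * (u x).re)
      + (2 * (u x).im
          * inner ℝ (deriv h (K x) • (θ x * (p x + lam)) • ∇ K x) (imVec (G x))
        + divergence (fun y => deriv h (K y) • (θ y * (p y + lam)) • ∇ K y) x
          * (u x).im * (u x).im))
    + (θ x * zerothWeight lam ε K h x * ((f x).re * (u x).re + (f x).im * (u x).im
          - (p x + Q x + lam) * ‖u x‖ ^ 2 + ‖G x‖ ^ 2)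
      + (fderiv ℝ (fun y => θ y * zerothWeight lam ε K h y) x (reVec (G x)) * (u x).re
        + fderiv ℝ (fun y => θ y * zerothWeight lam ε K h y) x (imVec (G x)) * (u x).im))
    + (θ x * (√lam * (deriv h (K x) * ‖∇ K x‖ ^ 2))
        * ((f x).re * (u x).im - (f x).im * (u x).re + ε * ‖u x‖ ^ 2)
      + (fderiv ℝ (fun y => θ y * (√lam * (deriv h (K y) * ‖∇ K y‖ ^ 2))) x (reVec (G x))
          * (u x).im
        - fderiv ℝ (fun y => θ y * (√lam * (deriv h (K y) * ‖∇ K y‖ ^ 2))) x (imVec (G x))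
          * (u x).re))
    = θ x * combinedIntegrand lam ε K h p Q f u G x
      + cutoffError lam ε K h u G (fderiv ℝ θ x) x := by
  have hx := b.ne_zero
  have hs : √lam ≠ 0 := (Real.sqrt_pos.2 hlam).ne'
  have hs2 : √lam ^ 2 = lam := Real.sq_sqrt hlam.le
  have hP : p x = √lam ^ 2 * ‖∇ K x‖ ^ 2 - √lam ^ 2 := by
    rw [hK.eikonal x hx, hs2]; field_simp; ring
  have hpd : HasFDerivAt p (fderiv ℝ p x) x :=
    (hp.differentiable (by simp)).differentiableAt.hasFDerivAt
  have hθp := hθ.hasFDerivAt.mul (hpd.add_const lam)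
  have hq := b.hasFDerivAt_profile hK hdiff
  have hn2 := (hK.hasFDerivAt_speed hp hx).differentiableAt.hasFDerivAt
  have hρ := hθ.hasFDerivAt.mul (hasFDerivAt_zerothWeight (ε := ε) hK hp b hdiff)
  have hσ := hθ.hasFDerivAt.mul ((hq.mul hn2).const_mul (√lam))
  have hθp' : fderiv ℝ (fun y => θ y * (p y + lam)) x = _ := hθp.fderiv
  have hρ' : fderiv ℝ (fun y => θ y * zerothWeight lam ε K h y) x = _ := hρ.fderiv
  have hσ' : fderiv ℝ (fun y => θ y * (√lam * (deriv h (K y) * ‖∇ K y‖ ^ 2))) x = _ := hσ.fderiv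
  rw [hρ', hσ', fderiv_profile_smul_gradient hK b hdiff hθ,
    fderiv_profile_smul_gradient hK b hdiff hθ,
    divergence_profile_smul_gradient hK b hdiff hθ,
    divergence_profile_smul_gradient (θ := fun y => θ y * (p y + lam)) hK b hdiff
      hθp.differentiableAt,
    hθp', combinedIntegrand, cutoffError, radialTerm_eq lam h u G b.gradient_ne,
    angularTerm_eq h G b.gradient_ne, gradWeightTerm, rdot_gradient_mul_conj_re, weightQTerm,
    gradPsiQTerm_re hh hK hx, gradSpeedTerm_im, gradPTerm_eq hh hK hx, matrixFTerm_re,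
    gradTraceFTerm, rdot_gradient_mul_conj_re, traceFQTerm, sommerfeldTerm_eq, psiQTerm,
    gradPsiPrimeTerm, rdot_gradient_mul_conj_re, sourceGradTerm_re hh hK hx, sourceWeightTerm_re,
    sourceSpeedTerm_im, sourcePsiTerm_re, hq.fderiv, helmholtzSource_re, helmholtzSource_im]
  have key := multiplier_algebra (fr := (f x).re) (fi := (f x).im) (ε := ε) (Qx := Q x)
    (r := deriv (deriv h) (K x)) (θ := θ x) (tA := fderiv ℝ θ x (reVec (G x)))
    (tB := fderiv ℝ θ x (imVec (G x))) (tN := fderiv ℝ θ x (∇ K x)) (pN := fderiv ℝ p x (∇ K x))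
    (w1A := fderiv ℝ (fun y => deriv h (K y) / K y * ‖∇ K y‖ ^ 2) x (reVec (G x)))
    (w1B := fderiv ℝ (fun y => deriv h (K y) / K y * ‖∇ K y‖ ^ 2) x (imVec (G x)))
    (w2A := fderiv ℝ (fun y => deriv h (K y) / K y * eikonalTraceF K y) x (reVec (G x)))
    (w2B := fderiv ℝ (fun y => deriv h (K y) / K y * eikonalTraceF K y) x (imVec (G x)))
    (n2A := fderiv ℝ (fun y => ‖∇ K y‖ ^ 2) x (reVec (G x)))
    (n2B := fderiv ℝ (fun y => ‖∇ K y‖ ^ 2) x (imVec (G x)))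
    b.pos.ne' hs (sq_norm_eq_re_im (u x)) (norm_sq_eq_reVec_imVec (G x)) hP
    (dA := inner ℝ (fderiv ℝ (∇ K) x (reVec (G x))) (reVec (G x)))
    (dB := inner ℝ (fderiv ℝ (∇ K) x (imVec (G x))) (imVec (G x)))
    (dN := divergence (∇ K) x)
    (by rw [hK.quadratic_formula hx, real_inner_self_eq_norm_sq])
    (by rw [hK.quadratic_formula hx, real_inner_self_eq_norm_sq])
    (hK.laplacian_formula hx) (ρ := zerothWeight lam ε K h x) rfl
  simp only [hs2, real_inner_smul_left, inner_add_left, real_inner_self_eq_norm_sq,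
    Pi.mul_apply,
    add_apply, smul_apply, smul_eq_mul,
    ← inner_gradient K] at key ⊢
  linear_combination key

end PointwiseIdentity

/-! ### The identity with a cutoff, and the size of its error. -/

section CutoffLimit

variable {d : ℕ} {lam ε δ C : ℝ} {K : EuclideanSpace ℝ (Fin d) → ℝ} {h : ℝ → ℝ}
  {p Q : EuclideanSpace ℝ (Fin d) → ℝ} {f u : EuclideanSpace ℝ (Fin d) → ℂ}
  {G : EuclideanSpace ℝ (Fin d) → EuclideanSpace ℂ (Fin d)} {x : EuclideanSpace ℝ (Fin d)}

local notation "𝔼" => EuclideanSpace ℝ (Fin d)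

lemma CoefficientBounds.abs_zerothWeight_le (hd : 3 ≤ d)
    (b : CoefficientBounds lam p Q K h C x) :
    |zerothWeight lam ε K h x|
      ≤ (C ^ 4 + C ^ 2 + |ε / (2 * √lam)| * C) * sourceWeight K h x := by
  have hC := b.nonneg
  have e2 := sourceWeight_nonneg (K := K) (h := h) x
  have hd1 : (3 : ℝ) ≤ d := by exact_mod_cast hd
  have h1 := b.profile_div
  have h2 := b.speed_le
  have h3 := b.trace_le
  have h4 := b.profile_le_source
  have h5 : |((d : ℝ) - 1) / 2| ≤ C := by
    rw [abs_of_nonneg (by linarith)]; linarith [b.dim_le]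
  have hq0 : 0 ≤ |deriv h (K x)| / K x := div_nonneg (abs_nonneg _) b.pos.le
  have a1 : |((d : ℝ) - 1) / 2 * (deriv h (K x) / K x * ‖∇ K x‖ ^ 2)|
      ≤ C * (C * sourceWeight K h x * C ^ 2) := by
    rw [abs_mul, abs_mul, b.abs_profile_div, abs_of_nonneg (sq_nonneg ‖∇ K x‖)]
    gcongr
  have a2 : |1 / 2 * (deriv h (K x) / K x * eikonalTraceF K x)|
      ≤ 1 * (C * sourceWeight K h x * C) := by
    rw [abs_mul, abs_mul, b.abs_profile_div, abs_of_pos one_half_pos]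
    gcongr
    norm_num
  have a3 : |ε / (2 * √lam) * deriv h (K x)| ≤ |ε / (2 * √lam)| * (C * sourceWeight K h x) := by
    rw [abs_mul]
    gcongr
  rw [zerothWeight]
  refine (abs_add_le _ _).trans ((add_le_add ((abs_add_le _ _).trans (add_le_add a1 a2)) a3).trans
    (le_of_eq ?_))
  ring

lemma abs_apply_mul_add_le (L : 𝔼 →L[ℝ] ℝ) (z : EuclideanSpace ℂ (Fin d)) (y : ℂ) (s t : ℝ)
    (hs : |s| ≤ ‖y‖) (ht : |t| ≤ ‖y‖) :
    |L (reVec z) * s + L (imVec z) * t| ≤ 2 * ‖L‖ * (‖z‖ * ‖y‖) := by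
  have h1 : |L (reVec z)| ≤ ‖L‖ * ‖z‖ :=
    (L.le_opNorm _).trans (mul_le_mul_of_nonneg_left (norm_reVec_le z) (norm_nonneg _))
  have h2 : |L (imVec z)| ≤ ‖L‖ * ‖z‖ :=
    (L.le_opNorm _).trans (mul_le_mul_of_nonneg_left (norm_imVec_le z) (norm_nonneg _))
  refine (abs_add_le _ _).trans ?_
  rw [abs_mul, abs_mul]
  calc _ ≤ ‖L‖ * ‖z‖ * ‖y‖ + ‖L‖ * ‖z‖ * ‖y‖ := by gcongr
    _ = _ := by ring

/-- The differential of the cutoff costs one power of the singular weight. In the terms with an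
explicit `ψ'` the linear vanishing of `ψ'` pays for it. In the term with `ρ`, where that vanishing
is spent on `ψ'/K`, the factor `u` pays. -/
lemma CoefficientBounds.abs_cutoffError_le (hd : 3 ≤ d) (hlam : 0 < lam)
    (b : CoefficientBounds lam p Q K h C x) {M : ℝ} {L : 𝔼 →L[ℝ] ℝ}
    (hL : ‖L‖ ≤ M * singularWeight x) :
    |cutoffError lam ε K h u G L x| ≤ M * (3 * C ^ 2 + C ^ 6
      + 2 * (C ^ 4 + C ^ 2 + |ε / (2 * √lam)| * C) + 2 * C ^ 4) * dominant K h f u G x := by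
  have hC := b.nonneg
  have e1 := energyWeight_nonneg (K := K) (h := h) x
  have e2 := sourceWeight_nonneg (K := K) (h := h) x
  have e3 := sourceWeight_le_energyWeight (K := K) (h := h) x
  have hω := one_le_singularWeight x
  have hω0 : 0 ≤ singularWeight x := zero_le_one.trans hω
  have hM : 0 ≤ M := nonneg_of_mul_nonneg_left ((norm_nonneg _).trans hL) (by linarith)
  have hq := b.profile_le
  have hqω := b.profile_mul_le
  have hn := b.gradient_le
  have hn2 := b.speed_le
  have hs := b.sqrt_le
  have hLq : ‖L‖ * |deriv h (K x)| ≤ M * (C * energyWeight K h x) := by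
    calc _ ≤ M * singularWeight x * |deriv h (K x)| := by gcongr
      _ = M * (|deriv h (K x)| * singularWeight x) := by ring
      _ ≤ _ := by gcongr
  have hLN : |L (∇ K x)| ≤ ‖L‖ * C := (L.le_opNorm _).trans (by gcongr)
  have t1 : |deriv h (K x) * (L (reVec (G x)) * inner ℝ (∇ K x) (reVec (G x))
      + L (imVec (G x)) * inner ℝ (∇ K x) (imVec (G x)))| ≤ 2 * C ^ 2 * M
        * dominant K h f u G x := by
    have h1 : ∀ v : 𝔼, ‖v‖ ≤ ‖G x‖ → |L v * inner ℝ (∇ K x) v| ≤ ‖L‖ * C * ‖G x‖ ^ 2 := by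
      intro v hv
      rw [abs_mul]
      calc _ ≤ (‖L‖ * ‖G x‖) * (C * ‖G x‖) := by
            gcongr
            · exact (L.le_opNorm _).trans (by gcongr)
            · exact (abs_real_inner_le_norm _ _).trans (by gcongr)
        _ = _ := by ring
    rw [abs_mul]
    calc _ ≤ |deriv h (K x)| * (‖L‖ * C * ‖G x‖ ^ 2 + ‖L‖ * C * ‖G x‖ ^ 2) := by
          gcongr
          exact (abs_add_le _ _).trans (add_le_add (h1 _ (norm_reVec_le _))
            (h1 _ (norm_imVec_le _)))
      _ = 2 * C * (‖L‖ * |deriv h (K x)|) * ‖G x‖ ^ 2 := by ring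
      _ ≤ _ := mul_sq_norm_gradient_le_dominant (by positivity) (by
        calc _ ≤ 2 * C * (M * (C * energyWeight K h x)) := by gcongr
          _ = _ := by ring)
  have t2 : |1 / 2 * deriv h (K x) * L (∇ K x) * ‖G x‖ ^ 2|
      ≤ C ^ 2 * M * dominant K h f u G x := by
    rw [abs_mul, abs_mul, abs_mul, abs_of_nonneg (sq_nonneg ‖G x‖), abs_of_pos one_half_pos]
    refine mul_sq_norm_gradient_le_dominant (by positivity) ?_
    calc _ ≤ 1 * |deriv h (K x)| * (‖L‖ * C) := by gcongr; norm_num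
      _ = C * (‖L‖ * |deriv h (K x)|) := by ring
      _ ≤ C * (M * (C * energyWeight K h x)) := by gcongr
      _ = _ := by ring
  have t3 : |1 / 2 * lam * ‖∇ K x‖ ^ 2 * deriv h (K x) * L (∇ K x) * ‖u x‖ ^ 2|
      ≤ C ^ 6 * M * dominant K h f u G x := by
    have hlC : lam ≤ C ^ 2 := by
      rw [← Real.sq_sqrt hlam.le]; gcongr
    rw [abs_mul, abs_mul, abs_mul, abs_mul, abs_mul, abs_of_nonneg (sq_nonneg ‖u x‖),
      abs_of_pos one_half_pos, abs_of_pos hlam, abs_of_nonneg (sq_nonneg ‖∇ K x‖)]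
    refine mul_sq_norm_le_dominant (by positivity) ?_
    calc _ ≤ 1 * C ^ 2 * C ^ 2 * |deriv h (K x)| * (‖L‖ * C) := by gcongr; norm_num
      _ = C ^ 5 * (‖L‖ * |deriv h (K x)|) := by ring
      _ ≤ C ^ 5 * (M * (C * energyWeight K h x)) := by gcongr
      _ = C ^ 6 * M * (energyWeight K h x * 1 ^ 2) := by ring
      _ ≤ _ := by gcongr
  have t4 : |zerothWeight lam ε K h x * (L (reVec (G x)) * (u x).re + L (imVec (G x)) * (u x).im)|
      ≤ 2 * (C ^ 4 + C ^ 2 + |ε / (2 * √lam)| * C) * M * dominant K h f u G x := by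
    have h1 := b.abs_zerothWeight_le (ε := ε) hd
    rw [abs_mul]
    calc _ ≤ |zerothWeight lam ε K h x| * (2 * ‖L‖ * (‖G x‖ * ‖u x‖)) := by
          gcongr
          exact abs_apply_mul_add_le L _ _ _ _ (Complex.abs_re_le_norm _) (Complex.abs_im_le_norm _)
      _ = 2 * |zerothWeight lam ε K h x| * ‖L‖ * (‖G x‖ * ‖u x‖) := by ring
      _ ≤ _ := mul_norm_gradient_mul_norm_le_dominant (by positivity) (by
        calc _ ≤ 2 * ((C ^ 4 + C ^ 2 + |ε / (2 * √lam)| * C) * energyWeight K h x)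
              * (M * singularWeight x) := by
              gcongr
              exact h1.trans (by gcongr)
          _ = _ := by ring)
  have t5 : |√lam * deriv h (K x) * ‖∇ K x‖ ^ 2
      * (L (reVec (G x)) * (u x).im - L (imVec (G x)) * (u x).re)|
      ≤ 2 * C ^ 4 * M * dominant K h f u G x := by
    have h1 := abs_apply_mul_add_le L (G x) (u x) (u x).im (-(u x).re) (Complex.abs_im_le_norm _)
      (by rw [abs_neg]; exact Complex.abs_re_le_norm _)
    rw [mul_neg, ← sub_eq_add_neg] at h1
    rw [abs_mul, abs_mul, abs_mul, abs_of_nonneg (Real.sqrt_nonneg _),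
      abs_of_nonneg (sq_nonneg ‖∇ K x‖)]
    calc _ ≤ C * |deriv h (K x)| * C ^ 2 * (2 * ‖L‖ * (‖G x‖ * ‖u x‖)) := by gcongr
      _ = 2 * C ^ 3 * (‖L‖ * |deriv h (K x)|) * (‖G x‖ * ‖u x‖) := by ring
      _ ≤ _ := mul_norm_gradient_mul_norm_le_dominant (by positivity) (by
        calc _ ≤ 2 * C ^ 3 * (M * (C * energyWeight K h x)) := by gcongr
          _ = 2 * C ^ 4 * M * (energyWeight K h x * 1) := by ring
          _ ≤ _ := by gcongr)
  rw [cutoffError]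
  rw [abs_le] at t1 t2 t3 t4 t5 ⊢
  constructor <;> linarith

lemma cutoff_profile_smul {Y : Type*} [NormedAddCommGroup Y] [NormedSpace ℝ Y]
    (hh : IsRegularProfile h) (hK : IsEikonalSolution p lam K) {σ : 𝔼 → Y}
    (hσ : ContDiffOn ℝ ∞ σ {0}ᶜ) (n : ℕ) :
    LocallyLipschitz (fun y => deriv h (K y) • annulusCutoff n y • σ y) ∧
    HasCompactSupport (fun y => deriv h (K y) • annulusCutoff n y • σ y) ∧
    (0 : 𝔼) ∉ tsupport (fun y => deriv h (K y) • annulusCutoff n y • σ y) := by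
  have hsub := tsupport_annulusCutoff_smul_subset σ n
  have hsub2 : tsupport (fun y => deriv h (K y) • annulusCutoff n y • σ y)
      ⊆ tsupport (annulusCutoff n : 𝔼 → ℝ) :=
    (closure_mono (Function.support_smul_subset_right (fun y => deriv h (K y)) _)).trans hsub
  exact ⟨hh.locallyLipschitz_smul hK (contDiff_annulusCutoff_smul hσ n)
    fun h0 => zero_notMem_tsupport_annulusCutoff n (hsub h0),
    (hasCompactSupport_annulusCutoff n).of_isClosed_subset (isClosed_tsupport _) hsub2,
    fun h0 => zero_notMem_tsupport_annulusCutoff n (hsub2 h0)⟩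

lemma contDiffOn_speed (hK : IsEikonalSolution p lam K) :
    ContDiffOn ℝ ∞ (fun y => ‖∇ K y‖ ^ 2) {0}ᶜ :=
  (contDiffOn_gradient hK.smooth).norm_sq ℝ

lemma integral_combination {α : Type*} [MeasurableSpace α] {ν : Measure α}
    {g₁ g₂ g₃ g₄ g₅ g₆ : α → ℝ} (i₁ : Integrable g₁ ν) (s₁ : ∫ x, g₁ x ∂ν = 0)
    (i₂ : Integrable g₂ ν) (s₂ : ∫ x, g₂ x ∂ν = 0) (i₃ : Integrable g₃ ν)
    (s₃ : ∫ x, g₃ x ∂ν = 0) (i₄ : Integrable g₄ ν) (s₄ : ∫ x, g₄ x ∂ν = 0)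
    (i₅ : Integrable g₅ ν) (s₅ : ∫ x, g₅ x ∂ν = 0) (i₆ : Integrable g₆ ν)
    (s₆ : ∫ x, g₆ x ∂ν = 0) :
    Integrable (fun x => g₁ x + g₂ x + 1 / 2 * (g₃ x + g₄ x) + g₅ x + g₆ x) ν ∧
    ∫ x, (g₁ x + g₂ x + 1 / 2 * (g₃ x + g₄ x) + g₅ x + g₆ x) ∂ν = 0 := by
  have j₂ : Integrable (fun x => g₁ x + g₂ x) ν := i₁.add i₂
  have j₄ : Integrable (fun x => 1 / 2 * (g₃ x + g₄ x)) ν := (i₃.add i₄).const_mul (1 / 2)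
  have j₅ : Integrable (fun x => g₁ x + g₂ x + 1 / 2 * (g₃ x + g₄ x)) ν := j₂.add j₄
  have j₆ : Integrable (fun x => g₁ x + g₂ x + 1 / 2 * (g₃ x + g₄ x) + g₅ x) ν := j₅.add i₅
  refine ⟨j₆.add i₆, ?_⟩
  rw [integral_add j₆ i₆, integral_add j₅ i₅, integral_add j₂ j₄,
    integral_add i₁ i₂, integral_const_mul, integral_add i₃ i₄, s₁, s₂, s₃, s₄, s₅, s₆]
  norm_num

/-- The identity before the removal of the cutoff. -/
theorem integral_cutoff_combinedIntegrand (hd : 3 ≤ d) (hlam : 0 < lam) (hδ : 0 < δ)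
    (hpQ : IsAdmissiblePotential d p Q δ) (hK : IsEikonalSolution p lam K)
    (hh : IsRegularProfile h) (hf : AEStronglyMeasurable f volume)
    (hf2 : LocallyIntegrable (fun x => ‖f x‖ ^ 2) volume) (hu : IsH1LocWithGradient u G)
    (hsol : IsHelmholtzSolution p Q lam ε f u G)
    (hb : ∀ x, x ≠ 0 → CoefficientBounds lam p Q K h C x) (n : ℕ) :
    Integrable (fun x => annulusCutoff n x * combinedIntegrand lam ε K h p Q f u G x
      + cutoffError lam ε K h u G (fderiv ℝ (annulusCutoff n) x) x) ∧
    ∫ x, (annulusCutoff n x * combinedIntegrand lam ε K h p Q f u G x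
      + cutoffError lam ε K h u G (fderiv ℝ (annulusCutoff n) x) x) = 0 := by
  have hN := contDiffOn_gradient hK.smooth
  obtain ⟨hV, hVc, hV0⟩ := cutoff_profile_smul hh hK hN n
  have hpc : ContDiffOn ℝ ∞ (fun y => (p y + lam) • ∇ K y) {0}ᶜ :=
    (hpQ.smooth.contDiffOn.add contDiffOn_const).smul hN
  obtain ⟨hV', hVc', -⟩ := cutoff_profile_smul hh hK hpc n
  simp only [smul_smul (annulusCutoff n _)] at hV' hVc'
  have hKi : ContDiffOn ℝ ∞ (fun y => (K y)⁻¹) {0}ᶜ :=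
    hK.smooth.inv fun y hy => (hK.pos y hy).ne'
  have hρ0 : ContDiffOn ℝ ∞ (fun y => (K y)⁻¹ * (((d : ℝ) - 1) / 2 * ‖∇ K y‖ ^ 2
      + 1 / 2 * eikonalTraceF K y) + ε / (2 * √lam)) {0}ᶜ :=
    (hKi.mul ((contDiffOn_const.mul (contDiffOn_speed hK)).add
      (contDiffOn_const.mul (isSymbol_eikonalTraceF hK).smooth))).add contDiffOn_const
  obtain ⟨hρ, hρc, hρ1⟩ := cutoff_profile_smul hh hK hρ0 n
  -- All of `ρ` is `ψ'` times a function smooth off the origin, so its product with the cutoff is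
  -- Lipschitz although `ψ'` is the only Lipschitz regularity at hand.
  have hρe : (fun y => deriv h (K y) • annulusCutoff n y • ((K y)⁻¹ * (((d : ℝ) - 1) / 2
      * ‖∇ K y‖ ^ 2 + 1 / 2 * eikonalTraceF K y) + ε / (2 * √lam)))
      = fun y => annulusCutoff n y * zerothWeight lam ε K h y := by
    funext y
    simp only [zerothWeight, smul_eq_mul, div_eq_mul_inv]
    ring
  rw [hρe] at hρ hρc hρ1
  obtain ⟨hσ, hσc, hσ1⟩ := cutoff_profile_smul hh hK
    (contDiffOn_const (c := √lam).mul (contDiffOn_speed hK)) n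
  have hσe : (fun y => deriv h (K y) • annulusCutoff n y • (√lam * ‖∇ K y‖ ^ 2))
      = fun y => annulusCutoff n y * (√lam * (deriv h (K y) * ‖∇ K y‖ ^ 2)) := by
    funext y
    simp only [smul_eq_mul]
    ring
  rw [hσe] at hσ hσc hσ1
  obtain ⟨h1, h2⟩ := hsol.hasWeakDivergence hd hpQ hδ hf hf2 hu
  obtain ⟨i1, s1⟩ := hu.hasWeakGradient_re.stress_identity h1 hV hVc hV0
  obtain ⟨i2, s2⟩ := hu.hasWeakGradient_im.stress_identity h2 hV hVc hV0
  obtain ⟨i3, s3⟩ := hu.hasWeakGradient_re.flux_identity hV' hVc'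
  obtain ⟨i4, s4⟩ := hu.hasWeakGradient_im.flux_identity hV' hVc'
  obtain ⟨i5, s5⟩ := hsol.integral_mul_conj_re hd hpQ hδ hf hf2 hu hρ hρc hρ1
  obtain ⟨i6, s6⟩ := hsol.integral_mul_conj_im hd hpQ hδ hf hf2 hu hσ hσc hσ1
  obtain ⟨i7, s7⟩ := integral_combination i1 s1 i2 s2 i3 s3 i4 s4 i5 s5 i6 s6
  have hae := (ae_ne_zero hd).and (ae_differentiableAt_deriv_comp hd hh hK)
  have heq := hae.mono fun x hx => multiplier_pointwise (Q := Q) (f := f) (u := u) (G := G) (ε := ε)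
    hlam hh hK hpQ.smooth (hb x hx.1) hx.2
    ((contDiff_annulusCutoff n).differentiable (by simp)).differentiableAt
  exact ⟨i7.congr heq, (integral_congr_ae heq).symm.trans s7⟩

end CutoffLimit

/-! ### Removal of the cutoff. -/

section Removal

variable {d : ℕ} {lam ε δ C : ℝ} {K : EuclideanSpace ℝ (Fin d) → ℝ} {h : ℝ → ℝ}
  {p Q : EuclideanSpace ℝ (Fin d) → ℝ} {f u : EuclideanSpace ℝ (Fin d) → ℂ}
  {G : EuclideanSpace ℝ (Fin d) → EuclideanSpace ℂ (Fin d)} {x : EuclideanSpace ℝ (Fin d)}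

local notation "𝔼" => EuclideanSpace ℝ (Fin d)

/-- Removal of the cutoff, by dominated convergence. -/
theorem integral_combinedIntegrand (hd : 3 ≤ d) (hlam : 0 < lam) (hδ : 0 < δ)
    (hpQ : IsAdmissiblePotential d p Q δ) (hK : IsEikonalSolution p lam K)
    (hh : IsRegularProfile h) (hf : AEStronglyMeasurable f volume)
    (hf2 : LocallyIntegrable (fun x => ‖f x‖ ^ 2) volume) (hu : IsH1LocWithGradient u G)
    (hsol : IsHelmholtzSolution p Q lam ε f u G)
    (hb : ∀ x, x ≠ 0 → CoefficientBounds lam p Q K h C x)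
    (hD : Integrable (dominant K h f u G))
    (hT : Integrable (combinedIntegrand lam ε K h p Q f u G)) :
    ∫ x, combinedIntegrand lam ε K h p Q f u G x = 0 := by
  obtain ⟨M, hM0, hM⟩ := exists_fderiv_annulusCutoff_bound d
  set C' := M * (3 * C ^ 2 + C ^ 6 + 2 * (C ^ 4 + C ^ 2 + |ε / (2 * √lam)| * C) + 2 * C ^ 4)
  have hn := integral_cutoff_combinedIntegrand hd hlam hδ hpQ hK hh hf hf2 hu hsol hb
  -- The majorant does not depend on `n`, because `|∇θ| ≤ M/‖x‖` for all the cutoffs and `1/‖x‖` is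
  -- at most the singular weight. At each `x ≠ 0` the error is eventually zero.
  have key := tendsto_integral_of_dominated_convergence
    (F := fun (n : ℕ) x => annulusCutoff n x * combinedIntegrand lam ε K h p Q f u G x
      + cutoffError lam ε K h u G (fderiv ℝ (annulusCutoff n) x) x)
    (f := combinedIntegrand lam ε K h p Q f u G) (μ := volume)
    (fun x => ‖combinedIntegrand lam ε K h p Q f u G x‖ + C' * dominant K h f u G x)
    (fun n => (hn n).1.1) (hT.norm.add (hD.const_mul _)) (fun n => ?_) ?_
  · simp only [(hn _).2] at key
    exact tendsto_nhds_unique key tendsto_const_nhds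
  · filter_upwards [ae_ne_zero hd] with x hx
    refine (norm_add_le _ _).trans (add_le_add ?_ ?_)
    · rw [norm_mul, Real.norm_of_nonneg (annulusCutoff_nonneg n x)]
      exact mul_le_of_le_one_left (norm_nonneg _) (annulusCutoff_le_one n x)
    · refine (hb x hx).abs_cutoffError_le hd hlam ((hM n x hx).trans ?_)
      rw [div_eq_mul_inv]
      exact mul_le_mul_of_nonneg_left (inv_norm_le_singularWeight x) hM0
  · filter_upwards [ae_ne_zero hd] with x hx
    refine tendsto_const_nhds.congr' ?_
    filter_upwards [eventually_annulusCutoff_eq_one hx] with n hn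
    rw [hn.fderiv_eq, hn.self_of_nhds]
    simp [cutoffError]

end Removal

/-- `deriv (deriv h)` is zero where `h'` is not differentiable. The growth condition for all `t > 0`
thus amounts to the condition at those `t` where `h''` exists. -/
theorem mainTheorem4 (d : ℕ) (hd : 3 ≤ d)
    (lam ε δ : ℝ) (hlam : 0 < lam) (hδ : 0 < δ)
    (p Q K : EuclideanSpace ℝ (Fin d) → ℝ)
    (hpQ : IsAdmissiblePotential d p Q δ)
    (hpos : ∀ x, 0 < 1 + p x / lam)
    (hK : IsEikonalSolution p lam K)
    (h : ℝ → ℝ) (hh : IsRegularProfile h)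
    (f u : EuclideanSpace ℝ (Fin d) → ℂ)
    (G : EuclideanSpace ℝ (Fin d) → EuclideanSpace ℂ (Fin d))
    (hf : AEStronglyMeasurable f volume)
    (hf2 : LocallyIntegrable (fun x => ‖f x‖ ^ 2) volume)
    (hu : IsH1LocWithGradient u G)
    (hsol : IsHelmholtzSolution p Q lam ε f u G)
    (hdecay :
      Integrable (fun x => (|deriv h (K x)| + |deriv (deriv h) (K x)|) *
        (‖u x‖ ^ 2 + ‖G x‖ ^ 2) + |deriv h (K x)| * ‖f x‖ ^ 2) volume ∨
      (0 < ε ∧ MemLp u 2 volume ∧ MemLp G 2 volume ∧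
        ∃ (m : ℕ) (C : ℝ), (∀ t, 0 < t → |deriv (deriv h) t| ≤ C * (1 + t) ^ m) ∧
          Integrable (fun x => (1 + ‖x‖) ^ (m + 1) * ‖f x‖ ^ 2) volume)) :
    (Integrable (radialTerm lam K h u G) ∧
      Integrable (angularTerm K h G) ∧
      Integrable (gradWeightTerm K h u G) ∧
      Integrable (weightQTerm K h Q u) ∧
      Integrable (gradPsiQTerm K h Q u G) ∧
      Integrable (gradSpeedTerm K h u G) ∧
      Integrable (gradPTerm K h p u) ∧
      Integrable (matrixFTerm K h G) ∧
      Integrable (gradTraceFTerm K h u G) ∧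
      Integrable (traceFQTerm K h Q u) ∧
      Integrable (sommerfeldTerm lam K h u G) ∧
      Integrable (psiQTerm K h Q u) ∧
      Integrable (gradPsiPrimeTerm K h u G) ∧
      Integrable (sourceGradTerm K h f G) ∧
      Integrable (sourceWeightTerm K h f u) ∧
      Integrable (sourceSpeedTerm K h f u) ∧
      Integrable (sourcePsiTerm K h f u)) ∧
    (1 / 2 * (∫ x, radialTerm lam K h u G x)
      + (∫ x, angularTerm K h G x)
      + ((d : ℝ) - 1) / 2 * (∫ x, gradWeightTerm K h u G x).re
      - ((d : ℝ) - 1) / 2 * (∫ x, weightQTerm K h Q u x)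
      - (∫ x, gradPsiQTerm K h Q u G x).re
      - √lam * (∫ x, gradSpeedTerm K h u G x).im
      + 1 / 2 * (∫ x, gradPTerm K h p u x)
      + (∫ x, matrixFTerm K h G x).re
      + 1 / 2 * (∫ x, gradTraceFTerm K h u G x).re
      - 1 / 2 * (∫ x, traceFQTerm K h Q u x)
      + ε / (2 * √lam) * (∫ x, sommerfeldTerm lam K h u G x)
      - ε / (2 * √lam) * (∫ x, psiQTerm K h Q u x)
      + ε / (2 * √lam) * (∫ x, gradPsiPrimeTerm K h u G x).re
    = -(∫ x, sourceGradTerm K h f G x).re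
      - 1 / 2 * (∫ x, sourceWeightTerm K h f u x).re
      + √lam * (∫ x, sourceSpeedTerm K h f u x).im
      - ε / (2 * √lam) * (∫ x, sourcePsiTerm K h f u x).re) := by
  -- Alternative (b) is reduced to alternative (a).
  have ha : Integrable (fun x => (|deriv h (K x)| + |deriv (deriv h) (K x)|) *
      (‖u x‖ ^ 2 + ‖G x‖ ^ 2) + |deriv h (K x)| * ‖f x‖ ^ 2) volume := by
    rcases hdecay with ha | ⟨hε, hu2, hG2, m, C, hC, hfm⟩
    · exact ha
    · exact hsol.integrable_of_absorption hd hpQ hδ hf hf2 hu hε hK hh hu2 hG2 hC hfm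
  obtain ⟨C, hb⟩ := hK.exists_coefficientBounds hd hlam hδ hpQ hpos hh
  have hKm := hK.continuous.measurable
  have hD := integrable_dominant hd hKm hf hf2 hu ha
  have hfm := hf.aemeasurable
  have hum := hu.meas.aemeasurable
  have hGm := hu.meas_grad.aemeasurable
  have hne := ae_ne_zero hd
  have hQm := hpQ.measurable
  -- The three integrands that differentiate `ψ'` are bounded only where `h'(K)` is differentiable,
  -- which is almost everywhere.
  have hne2 := hne.and (ae_differentiableAt_deriv_comp hd hh hK)
  have i1 : Integrable (radialTerm lam K h u G) :=
    (hD.const_mul _).mono' (aemeasurable_radialTerm hKm hum hGm).aestronglyMeasurable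
      (hne.mono fun x hx => (hb x hx).norm_radialTerm_le)
  have i2 : Integrable (angularTerm K h G) :=
    (hD.const_mul _).mono' (aemeasurable_angularTerm hKm hGm).aestronglyMeasurable
      (hne.mono fun x hx => (hb x hx).norm_angularTerm_le)
  have i3 : Integrable (gradWeightTerm K h u G) :=
    (hD.const_mul _).mono' (aemeasurable_gradWeightTerm hum hGm).aestronglyMeasurable
      (hne2.mono fun x hx => (hb x hx.1).norm_gradWeightTerm_le hK hpQ.smooth hx.2)
  have i4 : Integrable (weightQTerm K h Q u) :=
    (hD.const_mul _).mono' (aemeasurable_weightQTerm hKm hum hQm).aestronglyMeasurable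
      (hne.mono fun x hx => (hb x hx).norm_weightQTerm_le)
  have i5 : Integrable (gradPsiQTerm K h Q u G) :=
    (hD.const_mul _).mono' (aemeasurable_gradPsiQTerm hum hGm hQm).aestronglyMeasurable
      (hne.mono fun x hx => (hb x hx).norm_gradPsiQTerm_le hh hK)
  have i6 : Integrable (gradSpeedTerm K h u G) :=
    (hD.const_mul _).mono' (aemeasurable_gradSpeedTerm hKm hum hGm).aestronglyMeasurable
      (hne.mono fun x hx => (hb x hx).norm_gradSpeedTerm_le)
  have i7 : Integrable (gradPTerm K h p u) :=
    (hD.const_mul _).mono' (aemeasurable_gradPTerm hum).aestronglyMeasurable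
      (hne.mono fun x hx => (hb x hx).norm_gradPTerm_le hh hK)
  have i8 : Integrable (matrixFTerm K h G) :=
    (hD.const_mul _).mono' (aemeasurable_matrixFTerm hKm hGm).aestronglyMeasurable
      (hne.mono fun x hx => (hb x hx).norm_matrixFTerm_le)
  have i9 : Integrable (gradTraceFTerm K h u G) :=
    (hD.const_mul _).mono' (aemeasurable_gradTraceFTerm hum hGm).aestronglyMeasurable
      (hne2.mono fun x hx => (hb x hx.1).norm_gradTraceFTerm_le hK hx.2)
  have i10 : Integrable (traceFQTerm K h Q u) :=
    (hD.const_mul _).mono' (aemeasurable_traceFQTerm hKm hum hQm).aestronglyMeasurable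
      (hne.mono fun x hx => (hb x hx).norm_traceFQTerm_le)
  have i11 : Integrable (sommerfeldTerm lam K h u G) :=
    (hD.const_mul _).mono' (aemeasurable_sommerfeldTerm hKm hum hGm).aestronglyMeasurable
      (hne.mono fun x hx => (hb x hx).norm_sommerfeldTerm_le)
  have i12 : Integrable (psiQTerm K h Q u) :=
    (hD.const_mul _).mono' (aemeasurable_psiQTerm hKm hum hQm).aestronglyMeasurable
      (hne.mono fun x hx => (hb x hx).norm_psiQTerm_le)
  have i13 : Integrable (gradPsiPrimeTerm K h u G) :=
    (hD.const_mul _).mono' (aemeasurable_gradPsiPrimeTerm hum hGm).aestronglyMeasurable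
      (hne2.mono fun x hx => (hb x hx.1).norm_gradPsiPrimeTerm_le hK hx.2)
  have i14 : Integrable (sourceGradTerm K h f G) :=
    (hD.const_mul _).mono' (aemeasurable_sourceGradTerm hGm hfm).aestronglyMeasurable
      (hne.mono fun x hx => (hb x hx).norm_sourceGradTerm_le hh hK)
  have i15 : Integrable (sourceWeightTerm K h f u) :=
    (hD.const_mul _).mono' (aemeasurable_sourceWeightTerm hKm hum hfm).aestronglyMeasurable
      (hne.mono fun x hx => (hb x hx).norm_sourceWeightTerm_le hd)
  have i16 : Integrable (sourceSpeedTerm K h f u) :=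
    (hD.const_mul _).mono' (aemeasurable_sourceSpeedTerm hKm hum hfm).aestronglyMeasurable
      (hne.mono fun x hx => (hb x hx).norm_sourceSpeedTerm_le)
  have i17 : Integrable (sourcePsiTerm K h f u) :=
    (hD.const_mul _).mono' (aemeasurable_sourcePsiTerm hKm hum hfm).aestronglyMeasurable
      (hne.mono fun x hx => (hb x hx).norm_sourcePsiTerm_le)
  refine ⟨⟨i1, i2, i3, i4, i5, i6, i7, i8, i9, i10, i11, i12, i13, i14, i15, i16, i17⟩, ?_⟩
  -- The sum is assembled in the order of the summands of `combinedIntegrand`, so that `k17` is its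
  -- integrability by unfolding.
  have j1 := i1.const_mul (1 / 2)
  have j3 := i3.re.const_mul (((d : ℝ) - 1) / 2)
  have j4 := i4.const_mul (((d : ℝ) - 1) / 2)
  have j6 := i6.im.const_mul √lam
  have j7 := i7.const_mul (1 / 2)
  have j9 := i9.re.const_mul (1 / 2)
  have j10 := i10.const_mul (1 / 2)
  have j11 := i11.const_mul (ε / (2 * √lam))
  have j12 := i12.const_mul (ε / (2 * √lam))
  have j13 := i13.re.const_mul (ε / (2 * √lam))
  have j15 := i15.re.const_mul (1 / 2)
  have j16 := i16.im.const_mul √lam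
  have j17 := i17.re.const_mul (ε / (2 * √lam))
  have k2 := j1.add i2
  have k3 := k2.add j3
  have k4 := k3.sub j4
  have k5 := k4.sub i5.re
  have k6 := k5.sub j6
  have k7 := k6.add j7
  have k8 := k7.add i8.re
  have k9 := k8.add j9
  have k10 := k9.sub j10
  have k11 := k10.add j11
  have k12 := k11.sub j12
  have k13 := k12.add j13
  have k14 := k13.add i14.re
  have k15 := k14.add j15
  have k16 := k15.sub j16
  have k17 := k16.add j17
  have hT : Integrable (combinedIntegrand lam ε K h p Q f u G) := k17
  have h0 := integral_combinedIntegrand hd hlam hδ hpQ hK hh hf hf2 hu hsol hb hD hT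
  have hsplit := integral_add' k16 j17
  rw [integral_sub' k15 j16, integral_add' k14 j15, integral_add' k13 i14.re,
    integral_add' k12 j13, integral_sub' k11 j12, integral_add' k10 j11, integral_sub' k9 j10,
    integral_add' k8 j9, integral_add' k7 i8.re, integral_add' k6 j7, integral_sub' k5 j6,
    integral_sub' k4 i5.re, integral_sub' k3 j4, integral_add' k2 j3, integral_add' j1 i2]
    at hsplit
  replace hsplit := hsplit.symm.trans h0
  simp only [integral_const_mul] at hsplit
  have e3 := integral_re i3
  have e5 := integral_re i5
  have e6 := integral_im i6
  have e8 := integral_re i8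
  have e9 := integral_re i9
  have e13 := integral_re i13
  have e14 := integral_re i14
  have e15 := integral_re i15
  have e16 := integral_im i16
  have e17 := integral_re i17
  rw [e3, e5, e6, e8, e9, e13, e14, e15, e16, e17] at hsplit
  simp only [RCLike.re_eq_complex_re, RCLike.im_eq_complex_im] at hsplit
  linarith
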